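/- Let $\mathbb S^n\subset\mathbb R^{n+1}$ be the round unit sphere, $p\in\mathbb S^n$, $0<R\le \pi/2$, and let $B^n_R=\{q\in\mathbb S^n: d(p,q)\le R\}$ be the closed geodesic ball of radius $R$ about $p$, where $d$ is the geodesic distance. Let $k=4$ or $k=6$, and let $\Sigma^k\subset B^n_R$ be a properly immersed free boundary minimal submanifold. That is, $\Sigma$ is given by a nonempty compact smooth $k$-dimensional manifold $M$ with (possibly empty) boundary and a smooth immersion $F:M\to\mathbb S^n$ with $F(M)\subset B^n_R$ such that * the mean curvature vector of $F$ in $\mathbb S^n$ vanishes identically, * $F(\partial M)\subset\partial B^n_R=\{q\in\mathbb S^n: d(p,q)=R\}$, * $\Sigma$ meets $\partial B^n_R$ orthogonally along $\partial\Sigma$, that is, for every $x\in\partial M$ the unit normal $\nabla d(p,\cdot)$ of $\partial B^n_R$ at $F(x)$ lies in $dF(T_xM)$. Let $|\Sigma|$ be the volume of $M$ in the Riemannian metric induced by $F$, and let $|B^k_R|$ be the volume of a geodesic ball of radius $R$ in the round unit sphere $\mathbb S^k$. Then $$|\Sigma|\ \ge\ |B^k_R|.$$ If equality holds, then $\Sigma$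 is a totally geodesic $k$-ball of radius $R$: the map $F$ is injective, and $F(M)=B^n_R\cap V$ for some $(k+1)$-dimensional linear subspace $V\subset\mathbb R^{n+1}$ that contains $p$. -/

import Mathlib

open MeasureTheory
open scoped Manifold ContDiff ENNReal

noncomputable section

namespace SphereFreeBoundary

/-- The Euclidean space `ℝ^{n+1}` whose unit sphere is the round sphere `𝕊ⁿ`. -/
abbrev Ambient (n : ℕ) : Type := EuclideanSpace ℝ (Fin (n + 1))

/-- The geodesic (great circle) distance of two points of the round unit sphere `𝕊ⁿ`: the angle
`arccos ⟪p, q⟫` between them. -/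
def geodesicDist {n : ℕ} (p q : Ambient n) : ℝ := InnerProductGeometry.angle p q

/-- The closed geodesic ball of radius `R` about `p` in `𝕊ⁿ`. -/
def geodesicBall {n : ℕ} (p : Ambient n) (R : ℝ) : Set (Ambient n) :=
  {q | ‖q‖ = 1 ∧ geodesicDist p q ≤ R}

/-- The geodesic sphere of radius `R` about `p` in `𝕊ⁿ`, that is, the boundary of the ball. -/
def geodesicSphere {n : ℕ} (p : Ambient n) (R : ℝ) : Set (Ambient n) :=
  {q | ‖q‖ = 1 ∧ geodesicDist p q = R}

/-- The gradient at `q ∈ 𝕊ⁿ` of the distance from `p`, namely `(cos r • q - p) / sin r` with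
`r = geodesicDist p q ∈ (0, π)`. On a geodesic sphere about `p` it is the outward unit normal. -/
def distGradient {n : ℕ} (p q : Ambient n) : Ambient n :=
  (Real.sin (geodesicDist p q))⁻¹ • (Real.cos (geodesicDist p q) • q - p)

/-- The volume `|B^k_R|` of a geodesic ball of radius `R` in the round sphere `𝕊ᵏ`, with respect
to the surface measure of the unit sphere of `ℝ^{k+1}`. -/
def ballVolume (k : ℕ) (R : ℝ) : ℝ≥0∞ :=
  (volume : Measure (Ambient k)).toSphere
    {q | geodesicDist (EuclideanSpace.single 0 1 : Ambient k) (q : Ambient k) ≤ R}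

section Immersion

variable {k n : ℕ} [NeZero k] {M : Type*} [TopologicalSpace M]
  [ChartedSpace (EuclideanHalfSpace k) M]

/-- The map `F` read in the chart of `M` around `c`, a map on an open subset of the closed
half-space of `ℝᵏ`. -/
def localRep (F : M → Ambient n) (c : M) : EuclideanSpace ℝ (Fin k) → Ambient n :=
  F ∘ (extChartAt (𝓡∂ k) c).symm

/-- The differential of `F` in the chart around `c`. -/
def localDeriv (F : M → Ambient n) (c : M) (u : EuclideanSpace ℝ (Fin k)) :
    EuclideanSpace ℝ (Fin k) →L[ℝ] Ambient n :=
  fderivWithin ℝ (localRep F c) (Set.range (𝓡∂ k)) u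

/-- The coordinate derivative `∂ᵢ F` in the chart around `c`. -/
def partialDeriv (F : M → Ambient n) (c : M) (u : EuclideanSpace ℝ (Fin k)) (i : Fin k) :
    Ambient n :=
  localDeriv F c u (EuclideanSpace.single i 1)

/-- The second coordinate derivative `∂ᵢ ∂ⱼ F` in the chart around `c`. -/
def secondPartialDeriv (F : M → Ambient n) (c : M) (u : EuclideanSpace ℝ (Fin k))
    (i j : Fin k) : Ambient n :=
  fderivWithin ℝ (localDeriv F c) (Set.range (𝓡∂ k)) u
    (EuclideanSpace.single i 1) (EuclideanSpace.single j 1)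

/-- The matrix `gᵢⱼ = ⟪∂ᵢ F, ∂ⱼ F⟫` of the metric induced by `F`, in the chart around `c`. -/
def inducedMetric (F : M → Ambient n) (c : M) (u : EuclideanSpace ℝ (Fin k)) :
    Matrix (Fin k) (Fin k) ℝ :=
  Matrix.of fun i j => inner ℝ (partialDeriv F c u i) (partialDeriv F c u j)

/-- The vectors of `T_q 𝕊ⁿ` that are normal to the immersed submanifold, where `q = F(x)` and `u`
is the coordinate of `x` in the chart around `c`: the orthogonal complement in `ℝ^{n+1}` of the
tangent space together with the position vector `q`. -/
def normalSpace (F : M → Ambient n) (c : M) (u : EuclideanSpace ℝ (Fin k)) :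
    Submodule ℝ (Ambient n) :=
  (Submodule.span ℝ (Set.range (partialDeriv F c u)) ⊔ Submodule.span ℝ {localRep F c u})ᗮ

/-- The vector valued second fundamental form in `𝕊ⁿ` of the immersion `F`, in the chart around
`c`: the part of `∂ᵢ ∂ⱼ F` that is tangent to `𝕊ⁿ` and normal to the submanifold. -/
def secondFundamentalForm (F : M → Ambient n) (c : M) (u : EuclideanSpace ℝ (Fin k))
    (i j : Fin k) : Ambient n :=
  (normalSpace F c u).starProjection (secondPartialDeriv F c u i j)

/-- The mean curvature vector in `𝕊ⁿ` of the immersion `F`: the trace of the second fundamental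
form with respect to the induced metric. -/
def meanCurvature (F : M → Ambient n) (c : M) (u : EuclideanSpace ℝ (Fin k)) : Ambient n :=
  ∑ i, ∑ j, (inducedMetric F c u)⁻¹ i j • secondFundamentalForm F c u i j

/-- The density `√(det gᵢⱼ)` of the Riemannian volume in the chart around `c`. -/
def volumeDensity (F : M → Ambient n) (c : M) (u : EuclideanSpace ℝ (Fin k)) : ℝ :=
  Real.sqrt (inducedMetric F c u).det

variable (k M) in
/-- A smooth partition of unity on `M` that is subordinate to the cover by chart domains. -/
def chartPartition [IsManifold (𝓡∂ k) ∞ M] [CompactSpace M] [T2Space M] :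
    SmoothPartitionOfUnity M (𝓡∂ k) M Set.univ :=
  (SmoothPartitionOfUnity.exists_isSubordinate_chartAt_source (𝓡∂ k) M).choose

variable (k M) in
theorem chartPartition_isSubordinate [IsManifold (𝓡∂ k) ∞ M] [CompactSpace M] [T2Space M] :
    (chartPartition k M).IsSubordinate
      (fun c => (chartAt (EuclideanHalfSpace k) c).source) :=
  (SmoothPartitionOfUnity.exists_isSubordinate_chartAt_source (𝓡∂ k) M).choose_spec

/-- The Riemannian volume of `M` for the metric induced by the immersion `F`, which is the
`k`-dimensional volume of the immersed submanifold counted with multiplicity: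
`∑_c ∫ ρ_c √(det gᵢⱼ) du`, with `ρ` a partition of unity subordinate to the charts. By the change
of variables formula, the value does not depend on `ρ`. -/
def immersedVolume [IsManifold (𝓡∂ k) ∞ M] [CompactSpace M] [T2Space M]
    (F : M → Ambient n) : ℝ≥0∞ :=
  ∑' c : M, ∫⁻ u in (extChartAt (𝓡∂ k) c).target,
    ENNReal.ofReal
      (chartPartition k M c ((extChartAt (𝓡∂ k) c).symm u) * volumeDensity F c u)

/-- `F : M → 𝕊ⁿ ⊆ ℝ^{n+1}` is a free boundary minimal immersion of the manifold with boundary `M`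
into the closed geodesic ball of radius `R` about `p`. -/
structure IsFreeBoundaryMinimal (F : M → Ambient n) (p : Ambient n) (R : ℝ) : Prop where
  smooth : ContMDiff (𝓡∂ k) 𝓘(ℝ, Ambient n) ∞ F
  immersion : ∀ x, Function.Injective (mfderiv (𝓡∂ k) 𝓘(ℝ, Ambient n) F x)
  mem_ball : ∀ x, F x ∈ geodesicBall p R
  minimal : ∀ c, ∀ u ∈ (extChartAt (𝓡∂ k) c).target, meanCurvature F c u = 0
  boundary : ∀ x ∈ (𝓡∂ k).boundary M, F x ∈ geodesicSphere p R
  /-- Along `∂M` the unit normal of the geodesic sphere is tangent to the submanifold. -/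
  orthogonal : ∀ x ∈ (𝓡∂ k).boundary M,
    ∃ v : TangentSpace (𝓡∂ k) x,
      mfderiv (𝓡∂ k) 𝓘(ℝ, Ambient n) F x v = distGradient p (F x)

end Immersion

/-- `B` is a totally geodesic `k`-dimensional ball of radius `R` about `p` in `𝕊ⁿ`: the
intersection of the geodesic ball with a great `k`-sphere through `p`. -/
def IsTotallyGeodesicBall {n : ℕ} (k : ℕ) (p : Ambient n) (R : ℝ) (B : Set (Ambient n)) : Prop :=
  ∃ V : Submodule ℝ (Ambient n),
    Module.finrank ℝ V = k + 1 ∧ p ∈ V ∧ B = geodesicBall p R ∩ V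

end SphereFreeBoundary

end

/-! Write k = 2κ and a = cos R. Fix a point y = F(x₀) of the image with ⟨y, p⟩ = a, and put w = 1 −
⟨q, y⟩, half of the squared chordal distance to y, and X = ⟨q, p⟩. The volume bound comes from a
singular calibrating vector field w^(−κ) (A y + B p), with A and B functions of w and X, whose
tangential part is integrated over Σ.

In a minimal submanifold of the sphere the tangential part of φ z, with z a constant vector, has
divergence dφ(zᵀ) − k φ ⟨z, F⟩; this is the equation ΔF = −kF (`sum_fderiv_conormal`). A and B are
chosen (`IsCalibration`) so that the field is tangent to the geodesic sphere along ∂Σ. By the free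
boundary condition the conormal of ∂Σ is normal to that sphere, so there is no boundary term
(`inner_conormal_boundary`, `integral_divergence`). Moreover the divergence equals a constant D
minus a quadratic form in the components of y and p normal to Σ, and this form is nonnegative on the
whole range of (w, X). For κ = 2 and κ = 3 such A and B are found explicitly as polynomials in w
(`exists_calibration_two`, `exists_calibration_three`).

The field is singular at y, so w^(−κ) is replaced by (w + ε)^(−κ). This costs an error term which
concentrates at the preimages of y as ε → 0 (`exists_divergence_eq`). Rescaling a chart by √ε and
applying Fatou's lemma shows that a preimage contributes at least the integral of an explicit bubble
over a half-space (`mass_le_liminf`), and over all of ℝᵏ if it is an interior point. With ω the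
volume of the unit ball of ℝᵏ, the half bubble has mass κ 2^κ ω, which is exactly D |B^k_R|
(`exists_calibration`, `ballVolume_eq`). Hence D |Σ| ≥ D |B^k_R|. The limit needs integrability of
negative powers of w; it is derived from the divergence theorem itself, without a monotonicity
formula (`exists_integral_pow_le`). If ∂M is empty, integrating the divergence of pᵀ shows that ⟨F,
p⟩ = 0 = a, so any point may serve as x₀.

An interior preimage of y, or two distinct preimages, would give 2 |B^k_R| ≤ |Σ|. In the case of
equality, therefore, ∂M is nonempty, points over the geodesic sphere have a single preimage, and the
quadratic form vanishes: y, and for a ≠ 0 also p, is everywhere spanned by F and its tangent plane.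
Take x₀ in ∂M and let V be spanned by y and the tangent plane at x₀; it contains p by the free
boundary condition. A linear function orthogonal to V is O(w) on Σ, and the divergence theorem with
its square as a weight and one more negative power of w forces it to vanish
(`inner_eq_zero_of_normalPart`), so F(M) ⊂ V. Over the open cap the image and the set of double
points are both open and closed in the great sphere of V (`mem_of_le_inner_of_open`): the image is
the whole closed cap, and a double point would propagate to y, which has only one preimage. -/

open MeasureTheory
open scoped Manifold ContDiff ENNReal

noncomputable section

namespace SphereFreeBoundary

/-! ### Linear algebra of frames: conormals, Gram determinants, Jacobi's formula. -/

section

section Conormal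

variable {ι A : Type*} [Fintype ι] [DecidableEq ι] [NormedAddCommGroup A] [InnerProductSpace ℝ A]

/-- The vectors `√(det g) ∑ⱼ gⁱʲ vⱼ` for the Gram matrix `g` of a frame `v`. -/
def conormal (v : ι → A) (i : ι) : A :=
  Real.sqrt (Matrix.gram ℝ v).det • ∑ j, (Matrix.gram ℝ v)⁻¹ i j • v j

theorem gram_det_pos {v : ι → A} (hv : LinearIndependent ℝ v) : 0 < (Matrix.gram ℝ v).det :=
  (Matrix.posDef_gram_of_linearIndependent hv).det_pos

theorem gram_inv_comm (v : ι → A) (i j : ι) :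
    (Matrix.gram ℝ v)⁻¹ i j = (Matrix.gram ℝ v)⁻¹ j i := by
  have h : ((Matrix.gram ℝ v)⁻¹).transpose = (Matrix.gram ℝ v)⁻¹ := by
    rw [Matrix.transpose_nonsing_inv]
    congr 1
    ext a b
    simp [Matrix.gram, real_inner_comm]
  exact (congrFun (congrFun h j) i)

theorem gram_inv_mul {v : ι → A} (hv : LinearIndependent ℝ v) (i l : ι) :
    ∑ j, (Matrix.gram ℝ v)⁻¹ i j * inner ℝ (v j) (v l) = if i = l then 1 else 0 := by
  have h := Matrix.nonsing_inv_mul (Matrix.gram ℝ v) (gram_det_pos hv).ne'.isUnit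
  have h2 := congrFun (congrFun h i) l
  rw [Matrix.mul_apply, Matrix.one_apply] at h2
  exact h2

theorem inner_conormal {v : ι → A} (hv : LinearIndependent ℝ v) (i l : ι) :
    inner ℝ (conormal v i) (v l) = if i = l then Real.sqrt (Matrix.gram ℝ v).det else 0 := by
  rw [conormal, inner_smul_left, sum_inner]
  simp only [inner_smul_left, conj_trivial]
  rw [gram_inv_mul hv]
  split_ifs <;> simp

/-- Up to the factor √det g the conormals are the frame dual to `v` inside its span, so expanding in
both frames gives the orthogonal projection. This turns sums over coordinate directions into the
chart-free tangential projection. -/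
theorem sum_inner_conormal_smul [FiniteDimensional ℝ A] {v : ι → A}
    (hv : LinearIndependent ℝ v) (z : A) :
    ∑ i, inner ℝ (conormal v i) z • v i =
      Real.sqrt (Matrix.gram ℝ v).det • (Submodule.span ℝ (Set.range v)).starProjection z := by
  have hd := Real.sqrt_pos.2 (gram_det_pos hv)
  have key : (Submodule.span ℝ (Set.range v)).starProjection z
      = (Real.sqrt (Matrix.gram ℝ v).det)⁻¹ • ∑ i, inner ℝ (conormal v i) z • v i := by
    apply Submodule.eq_starProjection_of_mem_of_inner_eq_zero
    · exact Submodule.smul_mem _ _ (Submodule.sum_mem _ fun i _ =>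
        Submodule.smul_mem _ _ (Submodule.subset_span ⟨i, rfl⟩))
    · intro x hx
      induction hx using Submodule.span_induction with
      | mem x hx =>
        obtain ⟨l, rfl⟩ := hx
        rw [inner_sub_left, inner_smul_left, sum_inner]
        simp only [inner_smul_left, conj_trivial, conormal, sum_inner]
        have : ∀ i, (Real.sqrt (Matrix.gram ℝ v).det *
            ∑ j, (Matrix.gram ℝ v)⁻¹ i j * inner ℝ (v j) z) * inner ℝ (v i) (v l)
            = Real.sqrt (Matrix.gram ℝ v).det *
              ∑ j, inner ℝ (v j) z * ((Matrix.gram ℝ v)⁻¹ j i * inner ℝ (v i) (v l)) := by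
          intro i
          rw [mul_assoc, Finset.sum_mul]
          congr 1
          refine Finset.sum_congr rfl fun j _ => ?_
          rw [gram_inv_comm v i j]; ring
        simp only [this]
        rw [← Finset.mul_sum, Finset.sum_comm]
        simp only [← Finset.mul_sum, gram_inv_mul hv]
        simp only [mul_ite, mul_one, mul_zero, Finset.sum_ite_eq', Finset.mem_univ, if_true]
        rw [← mul_assoc, inv_mul_cancel₀ hd.ne', one_mul, real_inner_comm, sub_self]
      | zero => simp
      | add x y _ _ hx hy => rw [inner_add_right, hx, hy, add_zero]
      | smul a x _ hx => rw [inner_smul_right, hx, mul_zero]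
  rw [key, smul_smul, mul_inv_cancel₀ hd.ne', one_smul]

theorem contDiff_gram_det {N : WithTop ℕ∞} :
    ContDiff ℝ N (fun v : ι → A => (Matrix.gram ℝ v).det) := by
  simp only [Matrix.det_apply, Matrix.gram, Matrix.of_apply]
  refine ContDiff.sum fun σ _ => ContDiff.const_smul _ (contDiff_prod fun i _ => ?_)
  exact (contDiff_apply ℝ A _).inner ℝ (contDiff_apply ℝ A _)

theorem contDiff_gram_adjugate {N : WithTop ℕ∞} (i j : ι) :
    ContDiff ℝ N (fun v : ι → A => (Matrix.gram ℝ v).adjugate i j) := by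
  simp only [Matrix.adjugate_apply, Matrix.det_apply]
  refine ContDiff.sum fun σ _ => ContDiff.const_smul _ (contDiff_prod fun l _ => ?_)
  by_cases h : σ l = j
  · simp only [Matrix.updateRow_apply, h, if_true]
    exact contDiff_const
  · simp only [Matrix.updateRow_apply, h, if_false, Matrix.gram, Matrix.of_apply]
    exact (contDiff_apply ℝ A _).inner ℝ (contDiff_apply ℝ A _)

theorem contDiffAt_gram_inv {N : WithTop ℕ∞} {v : ι → A} (hv : LinearIndependent ℝ v) (i j : ι) :
    ContDiffAt ℝ N (fun v : ι → A => (Matrix.gram ℝ v)⁻¹ i j) v := by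
  have : (fun v : ι → A => (Matrix.gram ℝ v)⁻¹ i j)
      = fun v => (Matrix.gram ℝ v).det⁻¹ * (Matrix.gram ℝ v).adjugate i j := by
    funext v
    simp [Matrix.inv_def]
  rw [this]
  exact (contDiff_gram_det.contDiffAt.inv (gram_det_pos hv).ne').mul
    (contDiff_gram_adjugate i j).contDiffAt

theorem contDiffAt_conormal {N : WithTop ℕ∞} {v : ι → A} (hv : LinearIndependent ℝ v) (i : ι) :
    ContDiffAt ℝ N (fun v : ι → A => conormal v i) v := by
  unfold conormal
  refine (contDiff_gram_det.contDiffAt.sqrt (gram_det_pos hv).ne').smul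
    (ContDiffAt.sum fun j _ => (contDiffAt_gram_inv hv i j).smul ?_)
  exact (contDiff_apply ℝ A j).contDiffAt

/-- Jacobi's formula for the derivative of a determinant. -/
theorem hasFDerivAt_det {X : Type*} [NormedAddCommGroup X] [NormedSpace ℝ X]
    {G : X → Matrix ι ι ℝ} {u : X} (hG : ∀ i j, DifferentiableAt ℝ (fun v => G v i j) u)
    (hu : (G u).det ≠ 0) (e : X) :
    fderiv ℝ (fun v => (G v).det) u e =
      (G u).det * ∑ i, ∑ j, (G u)⁻¹ i j * fderiv ℝ (fun v => G v j i) u e := by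
  have hG' : DifferentiableAt ℝ (fun v => (fun i j => G v i j : ι → ι → ℝ)) u :=
    differentiableAt_pi.2 fun i => differentiableAt_pi.2 fun j => hG i j
  have hdet : ContDiff ℝ 1 (fun m : ι → ι → ℝ => (Matrix.of m).det) := by
    simp only [Matrix.det_apply, Matrix.of_apply]
    refine ContDiff.sum fun σ _ => ContDiff.const_smul _ (contDiff_prod fun i _ => ?_)
    exact contDiff_apply_apply ℝ ℝ _ _
  have hdd : Differentiable ℝ (fun m : ι → ι → ℝ => (Matrix.of m).det) :=
    hdet.differentiable one_ne_zero
  set H : ι → ι → ℝ := fderiv ℝ (fun v => (fun i j => G v i j : ι → ι → ℝ)) u e with hH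
  have hHij : ∀ i j, fderiv ℝ (fun v => G v i j) u e = H i j := by
    intro i j
    have h1 := (hasFDerivAt_pi'.1 ((hasFDerivAt_pi'.1 hG'.hasFDerivAt) i)) j
    rw [h1.fderiv, hH]
    rfl
  have hcomp : fderiv ℝ (fun v => (G v).det) u e
      = fderiv ℝ (fun m : ι → ι → ℝ => (Matrix.of m).det) (fun i j => G u i j) H := by
    have := ((hdd (fun i j => G u i j)).hasFDerivAt.comp u hG'.hasFDerivAt).fderiv
    rw [show (fun v => (G v).det) = (fun m : ι → ι → ℝ => (Matrix.of m).det) ∘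
      (fun v => (fun i j => G v i j : ι → ι → ℝ)) from rfl, this]
    rfl
  rw [hcomp]
  have hline : HasDerivAt (fun s : ℝ => (Matrix.of ((fun i j => G u i j) + s • H)).det)
      (fderiv ℝ (fun m : ι → ι → ℝ => (Matrix.of m).det) (fun i j => G u i j) H) 0 := by
    have h1 : HasDerivAt (fun s : ℝ => (fun i j => G u i j : ι → ι → ℝ) + s • H) H 0 := by
      simpa using ((hasDerivAt_id (0:ℝ)).smul_const H).const_add (fun i j => G u i j : ι → ι → ℝ)
    have h2 := (hdd (fun i j => G u i j)).hasFDerivAt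
    rw [← show (fun i j => G u i j : ι → ι → ℝ) + (0:ℝ) • H = fun i j => G u i j by simp] at h2
    simpa [Function.comp_def] using h2.comp_hasDerivAt (0:ℝ) h1
  -- Along the line s ↦ G + sH the formula reduces to det(1 + sM) = 1 + s tr M + O(s²) with M =
  -- G⁻¹H.
  have hform : ∀ s : ℝ, (Matrix.of ((fun i j => G u i j) + s • H)).det
      = (G u).det * (1 + Matrix.trace ((G u)⁻¹ * Matrix.of H) * s
        + ((1 + (Polynomial.X : Polynomial ℝ) • ((G u)⁻¹ * Matrix.of H).map
          Polynomial.C).det).divX.divX.eval s * s ^ 2) := by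
    intro s
    rw [← Matrix.det_one_add_smul, ← Matrix.det_mul, mul_add, mul_one, Matrix.mul_smul,
      ← mul_assoc, Matrix.mul_nonsing_inv _ hu.isUnit, one_mul]
    rfl
  have hline2 : HasDerivAt (fun s : ℝ => (Matrix.of ((fun i j => G u i j) + s • H)).det)
      ((G u).det * Matrix.trace ((G u)⁻¹ * Matrix.of H)) 0 := by
    simp only [hform]
    set p := ((1 + (Polynomial.X : Polynomial ℝ) • ((G u)⁻¹ * Matrix.of H).map
          Polynomial.C).det).divX.divX
    have h1 : HasDerivAt (fun s : ℝ => p.eval s * s ^ 2) 0 0 := by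
      have := (p.hasDerivAt 0).mul (hasDerivAt_pow 2 (0:ℝ))
      exact this.congr_deriv (by simp)
    have h2 : HasDerivAt (fun s : ℝ => 1 + Matrix.trace ((G u)⁻¹ * Matrix.of H) * s)
        (Matrix.trace ((G u)⁻¹ * Matrix.of H)) 0 := by
      simpa using ((hasDerivAt_id (0:ℝ)).const_mul
        (Matrix.trace ((G u)⁻¹ * Matrix.of H))).const_add 1
    simpa using (h2.add h1).const_mul (G u).det
  rw [hline.unique hline2, Matrix.trace]
  simp only [Matrix.diag_apply, Matrix.mul_apply, Matrix.of_apply, hHij]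

end Conormal


end

/-! ### The equation ΔF = −kF for a minimal immersion, in coordinates. -/

section

section LocalMinimality

open Filter Topology

variable {k : ℕ} {A : Type*} [NormedAddCommGroup A] [InnerProductSpace ℝ A]

/-- The coordinate frame `∂ᵢ f` of a map. -/
def coordFrame (L : EuclideanSpace ℝ (Fin k) →L[ℝ] A) (i : Fin k) : A :=
  L (EuclideanSpace.single i 1)

theorem linearIndependent_coordFrame {L : EuclideanSpace ℝ (Fin k) →L[ℝ] A}
    (hL : Function.Injective L) : LinearIndependent ℝ (coordFrame L) := by
  have h := (EuclideanSpace.basisFun (Fin k) ℝ).toBasis.linearIndependent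
  have h2 := h.map' (L : EuclideanSpace ℝ (Fin k) →ₗ[ℝ] A) (LinearMap.ker_eq_bot.2 hL)
  have h3 : coordFrame L = (L : EuclideanSpace ℝ (Fin k) →ₗ[ℝ] A) ∘
      (EuclideanSpace.basisFun (Fin k) ℝ).toBasis := by
    funext i
    simp [coordFrame]
  rw [h3]
  exact h2

theorem span_range_coordFrame (L : EuclideanSpace ℝ (Fin k) →L[ℝ] A) :
    Submodule.span ℝ (Set.range (coordFrame L)) =
      LinearMap.range (L : EuclideanSpace ℝ (Fin k) →ₗ[ℝ] A) := by
  have h := (EuclideanSpace.basisFun (Fin k) ℝ).toBasis.span_eq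
  rw [LinearMap.range_eq_map, ← h, Submodule.map_span, ← Set.range_comp]
  congr 2
  funext i
  simp [coordFrame]

theorem contDiff_coordFrame {N : WithTop ℕ∞} :
    ContDiff ℝ N (coordFrame : (EuclideanSpace ℝ (Fin k) →L[ℝ] A) → Fin k → A) := by
  refine contDiff_pi.2 fun i => ?_
  exact (ContinuousLinearMap.apply ℝ A (EuclideanSpace.single i (1:ℝ))).contDiff

theorem eventually_linearIndependent {X : Type*} [TopologicalSpace X] {v : X → Fin k → A} {u : X}
    {l : Filter X} (hv : Tendsto v l (𝓝 (v u))) (hu : LinearIndependent ℝ (v u)) :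
    ∀ᶠ w in l, LinearIndependent ℝ (v w) := by
  have h1 : Tendsto (fun w => (Matrix.gram ℝ (v w)).det) l (𝓝 (Matrix.gram ℝ (v u)).det) :=
    ((contDiff_gram_det (N := 0)).continuous.tendsto (v u)).comp hv
  filter_upwards [h1.eventually (lt_mem_nhds (gram_det_pos hu))] with w hw
  exact Matrix.linearIndependent_of_det_gram_ne_zero hw.ne'

/-- In a minimal immersion into the unit sphere the coordinate divergence of the conormal fields,
that is `√g Δ f`, equals `- k √g f`. -/
theorem sum_fderiv_conormal [FiniteDimensional ℝ A] {f : EuclideanSpace ℝ (Fin k) → A}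
    {u : EuclideanSpace ℝ (Fin k)} (hf : ContDiffAt ℝ 2 f u) (hunit : ∀ᶠ v in 𝓝 u, ‖f v‖ = 1)
    (hinj : Function.Injective (fderiv ℝ f u))
    (hmin : ∑ i, ∑ j, (Matrix.gram ℝ (coordFrame (fderiv ℝ f u)))⁻¹ i j •
      (Submodule.span ℝ (Set.range (coordFrame (fderiv ℝ f u))) ⊔
        Submodule.span ℝ {f u})ᗮ.starProjection
        (fderiv ℝ (fderiv ℝ f) u (EuclideanSpace.single i 1) (EuclideanSpace.single j 1)) = 0) :
    ∑ i, fderiv ℝ (fun v => conormal (coordFrame (fderiv ℝ f v)) i) u (EuclideanSpace.single i 1) =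
      (-(k * Real.sqrt (Matrix.gram ℝ (coordFrame (fderiv ℝ f u))).det)) • f u := by
  set e : Fin k → EuclideanSpace ℝ (Fin k) := fun i => EuclideanSpace.single i 1 with he
  set V : EuclideanSpace ℝ (Fin k) → Fin k → A := fun v => coordFrame (fderiv ℝ f v) with hV
  set B : Fin k → Fin k → A := fun i j => fderiv ℝ (fderiv ℝ f) u (e i) (e j) with hB
  have hlin : LinearIndependent ℝ (V u) := linearIndependent_coordFrame hinj
  have hdf : ContDiffAt ℝ 1 (fderiv ℝ f) u := hf.fderiv_right (by norm_num)
  have hdf' : DifferentiableAt ℝ (fderiv ℝ f) u := hdf.differentiableAt one_ne_zero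
  have hVc : ContDiffAt ℝ 1 V u := contDiff_coordFrame.contDiffAt.comp u hdf
  have hVd : ∀ j, HasFDerivAt (fun v => V v j)
      ((ContinuousLinearMap.apply ℝ A (e j)).comp (fderiv ℝ (fderiv ℝ f) u)) u := fun j =>
    (ContinuousLinearMap.apply ℝ A (e j)).hasFDerivAt.comp u hdf'.hasFDerivAt
  have hsymm : ∀ i j, B i j = B j i := fun i j =>
    (hf.isSymmSndFDerivAt (by simp)).eq (e i) (e j)
  have hev : ∀ᶠ v in 𝓝 u, LinearIndependent ℝ (V v) :=
    eventually_linearIndependent hVc.continuousAt hlin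
  have hfd : ∀ᶠ v in 𝓝 u, DifferentiableAt ℝ f v := by
    have := hf.eventually (by simp)
    filter_upwards [this] with v hv using hv.differentiableAt two_ne_zero
  have horth : ∀ᶠ v in 𝓝 u, ∀ j, inner ℝ (V v j) (f v) = 0 := by
    filter_upwards [hfd, hunit.eventually_nhds] with v hv hu j
    have h1 : HasFDerivAt (fun z => inner ℝ (f z) (f z)) _ v := hv.hasFDerivAt.inner ℝ hv.hasFDerivAt
    have h2 : HasFDerivAt (fun z => inner ℝ (f z) (f z)) (0 : EuclideanSpace ℝ (Fin k) →L[ℝ] ℝ) v := by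
      refine (hasFDerivAt_const (1:ℝ) v).congr_of_eventuallyEq ?_
      filter_upwards [hu] with z hz
      rw [real_inner_self_eq_norm_sq, hz]; norm_num
    have h3 := congrArg (fun L => L (e j)) (h1.unique h2)
    simp only [ContinuousLinearMap.comp_apply, ContinuousLinearMap.prod_apply,
      fderivInnerCLM_apply, zero_apply] at h3
    have h4 : inner ℝ (f v) (V v j) = inner ℝ (V v j) (f v) := real_inner_comm _ _
    change inner ℝ (f v) (V v j) + inner ℝ (V v j) (f v) = 0 at h3
    linarith
  have hYd : ∀ i, DifferentiableAt ℝ (fun v => conormal (V v) i) u := fun i =>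
    ((contDiffAt_conormal (N := 1) hlin i).comp u hVc).differentiableAt one_ne_zero
  set DY : Fin k → A := fun i => fderiv ℝ (fun v => conormal (V v) i) u (e i) with hDY
  set S : ℝ := Real.sqrt (Matrix.gram ℝ (V u)).det with hS
  have hSpos : 0 < S := Real.sqrt_pos.2 (gram_det_pos hlin)
  -- tangential components
  have hdetd : DifferentiableAt ℝ (fun v => (Matrix.gram ℝ (V v)).det) u :=
    ((contDiff_gram_det (N := 1)).contDiffAt.comp u hVc).differentiableAt one_ne_zero
  have hDS : ∀ l, fderiv ℝ (fun v => Real.sqrt (Matrix.gram ℝ (V v)).det) u (e l) =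
      S * ∑ i, ∑ j, (Matrix.gram ℝ (V u))⁻¹ i j * inner ℝ (V u j) (B l i) := by
    intro l
    rw [(hdetd.hasFDerivAt.sqrt (gram_det_pos hlin).ne').fderiv]
    rw [smul_apply, smul_eq_mul]
    have hg : ∀ i j, HasFDerivAt (fun v => Matrix.gram ℝ (V v) i j) _ u := fun i j =>
      (hVd i).inner ℝ (hVd j)
    rw [hasFDerivAt_det (fun i j => (hg i j).differentiableAt) (gram_det_pos hlin).ne']
    have hg2 : ∀ i j, fderiv ℝ (fun v => Matrix.gram ℝ (V v) i j) u (e l)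
        = inner ℝ (V u i) (B l j) + inner ℝ (B l i) (V u j) := by
      intro i j
      rw [(hg i j).fderiv]
      simp [fderivInnerCLM_apply, hB]
    simp only [hg2]
    have hsum : ∑ i, ∑ j, (Matrix.gram ℝ (V u))⁻¹ i j *
        (inner ℝ (V u j) (B l i) + inner ℝ (B l j) (V u i)) =
        2 * ∑ i, ∑ j, (Matrix.gram ℝ (V u))⁻¹ i j * inner ℝ (V u j) (B l i) := by
      simp only [mul_add, Finset.sum_add_distrib]
      rw [two_mul]
      congr 1
      rw [Finset.sum_comm]
      refine Finset.sum_congr rfl fun i _ => Finset.sum_congr rfl fun j _ => ?_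
      rw [gram_inv_comm (V u) j i, real_inner_comm]
    rw [hsum]
    have hS2 : (Matrix.gram ℝ (V u)).det = S * S :=
      (Real.mul_self_sqrt (gram_det_pos hlin).le).symm
    rw [hS2, Real.sqrt_mul_self hSpos.le]
    field_simp
  -- Differentiating ⟨Yᵢ, ∂ₗf⟩ = √g δᵢₗ and summing over i leaves ∂ₗ√g − Σ ⟨Yᵢ, ∂ᵢ∂ₗf⟩, which is
  -- zero by Jacobi's formula.
  have hT : ∀ l, inner ℝ (∑ i, DY i) (V u l) = 0 := by
    intro l
    have h1 : ∀ i, inner ℝ (DY i) (V u l) =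
        (if i = l then fderiv ℝ (fun v => Real.sqrt (Matrix.gram ℝ (V v)).det) u (e i) else 0)
          - inner ℝ (conormal (V u) i) (B i l) := by
      intro i
      have h2 : HasFDerivAt (fun v => inner ℝ (conormal (V v) i) (V v l)) _ u :=
        (hYd i).hasFDerivAt.inner ℝ (hVd l)
      have h3 : (fun v => inner ℝ (conormal (V v) i) (V v l)) =ᶠ[𝓝 u]
          fun v => if i = l then Real.sqrt (Matrix.gram ℝ (V v)).det else 0 := by
        filter_upwards [hev] with v hv using inner_conormal hv i l
      have h4 := congrArg (fun L => L (e i)) (h2.fderiv.symm.trans h3.fderiv_eq)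
      simp only [ContinuousLinearMap.comp_apply, ContinuousLinearMap.prod_apply,
        fderivInnerCLM_apply] at h4
      change inner ℝ (conormal (V u) i) (B i l) + inner ℝ (DY i) (V u l) = _ at h4
      split_ifs at h4 ⊢ with hil
      · linarith
      · simp at h4; linarith
    rw [sum_inner]
    simp only [h1, Finset.sum_sub_distrib, Finset.sum_ite_eq', Finset.mem_univ, if_true, hDS]
    rw [sub_eq_zero, Finset.mul_sum]
    refine Finset.sum_congr rfl fun i _ => ?_
    rw [conormal, inner_smul_left, sum_inner]
    simp only [inner_smul_left, conj_trivial]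
    congr 1
    refine Finset.sum_congr rfl fun j _ => ?_
    rw [hsymm l i]
  -- Since |f| = 1, ⟨Yᵢ, f⟩ = 0; moving the derivative to f, each of the k indices contributes −⟨Yᵢ,
  -- ∂ᵢf⟩ = −√g.
  have hF : inner ℝ (∑ i, DY i) (f u) = -(k * S) := by
    have h1 : ∀ i, inner ℝ (DY i) (f u) = - S := by
      intro i
      have h2 : HasFDerivAt (fun v => inner ℝ (conormal (V v) i) (f v)) _ u :=
        (hYd i).hasFDerivAt.inner ℝ hfd.self_of_nhds.hasFDerivAt
      have h3 : (fun v => inner ℝ (conormal (V v) i) (f v)) =ᶠ[𝓝 u] fun v => (0:ℝ) := by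
        filter_upwards [horth] with v hv
        simp [conormal, inner_smul_left, sum_inner, hv]
      have h4 := congrArg (fun L => L (e i)) (h2.fderiv.symm.trans h3.fderiv_eq)
      simp only [ContinuousLinearMap.comp_apply, ContinuousLinearMap.prod_apply,
        fderivInnerCLM_apply] at h4
      change inner ℝ (conormal (V u) i) (V u i) + inner ℝ (DY i) (f u) = _ at h4
      rw [inner_conormal hlin] at h4
      simp at h4
      linarith
    rw [sum_inner]
    simp [h1]
  -- Against a normal vector z the derivatives of the coefficients drop out because ⟨∂ⱼf, z⟩ = 0.
  -- What remains is √g times the z-component of the mean curvature.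
  have hN : ∀ z ∈ (Submodule.span ℝ (Set.range (V u)) ⊔ Submodule.span ℝ {f u})ᗮ,
      inner ℝ (∑ i, DY i) z = 0 := by
    intro z hz
    have hzV : ∀ j, inner ℝ (V u j) z = 0 := fun j =>
      (Submodule.mem_orthogonal _ _).1 hz _
        (Submodule.mem_sup_left (Submodule.subset_span ⟨j, rfl⟩))
    have hqd : ∀ i j, DifferentiableAt ℝ
        (fun v => Real.sqrt (Matrix.gram ℝ (V v)).det * (Matrix.gram ℝ (V v))⁻¹ i j) u := by
      intro i j
      refine (hdetd.sqrt (gram_det_pos hlin).ne').mul ?_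
      exact ((contDiffAt_gram_inv (N := 1) hlin i j).comp u hVc).differentiableAt one_ne_zero
    have h1 : ∀ i, inner ℝ (DY i) z
        = S * ∑ j, (Matrix.gram ℝ (V u))⁻¹ i j * inner ℝ (B i j) z := by
      intro i
      have h2 : HasFDerivAt (fun v => inner ℝ (conormal (V v) i) z) _ u :=
        (hYd i).hasFDerivAt.inner ℝ (hasFDerivAt_const z u)
      have h3 : HasFDerivAt (fun v => ∑ j, (Real.sqrt (Matrix.gram ℝ (V v)).det *
          (Matrix.gram ℝ (V v))⁻¹ i j) * inner ℝ (V v j) z) _ u :=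
        HasFDerivAt.fun_sum fun j _ =>
          (hqd i j).hasFDerivAt.mul ((hVd j).inner ℝ (hasFDerivAt_const z u))
      have h5 : (fun v => inner ℝ (conormal (V v) i) z) = fun v =>
          ∑ j, (Real.sqrt (Matrix.gram ℝ (V v)).det *
          (Matrix.gram ℝ (V v))⁻¹ i j) * inner ℝ (V v j) z := by
        funext v
        simp [conormal, inner_smul_left, sum_inner, Finset.mul_sum, mul_assoc]
      rw [h5] at h2
      have h4 := congrArg (fun L => L (e i)) (h2.unique h3)
      simp only [ContinuousLinearMap.comp_apply, ContinuousLinearMap.prod_apply,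
        fderivInnerCLM_apply, sum_apply, 
        smul_apply, hzV, zero_apply, inner_zero_right,
        zero_add, zero_smul, add_zero, smul_eq_mul] at h4
      change inner ℝ (DY i) z = ∑ j, S * (Matrix.gram ℝ (V u))⁻¹ i j * inner ℝ (B i j) z at h4
      rw [h4, Finset.mul_sum]
      simp only [mul_assoc]
    rw [sum_inner]
    simp only [h1]
    rw [← Finset.mul_sum]
    have h6 := congrArg (fun x => inner ℝ x z) hmin
    simp only [sum_inner, inner_smul_left, conj_trivial, inner_zero_left,
      Submodule.inner_starProjection_left_eq_right] at h6
    have hz' : (Submodule.span ℝ (Set.range (coordFrame (fderiv ℝ f u))) ⊔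
        Submodule.span ℝ {f u})ᗮ.starProjection z = z :=
      Submodule.starProjection_eq_self_iff.2 hz
    rw [hz'] at h6
    change ∑ i, ∑ j, (Matrix.gram ℝ (V u))⁻¹ i j * inner ℝ (B i j) z = 0 at h6
    rw [h6, mul_zero]
  have hff : inner ℝ (f u) (f u) = (1:ℝ) := by
    rw [real_inner_self_eq_norm_sq, hunit.self_of_nhds]; norm_num
  -- Z is orthogonal to the tangent plane and to f, hence is itself an admissible normal vector;
  -- pairing it with itself gives zero.
  set Z := ∑ i, DY i + (k * S) • f u with hZ
  have hZN : Z ∈ (Submodule.span ℝ (Set.range (V u)) ⊔ Submodule.span ℝ {f u})ᗮ := by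
    rw [← Submodule.inf_orthogonal]
    refine ⟨(Submodule.mem_orthogonal' _ _).2 fun x hx => ?_,
      Submodule.mem_orthogonal_singleton_iff_inner_left.2 ?_⟩
    · induction hx using Submodule.span_induction with
      | mem x hx =>
        obtain ⟨l, rfl⟩ := hx
        rw [hZ, inner_add_left, hT, inner_smul_left, real_inner_comm, horth.self_of_nhds l]
        simp
      | zero => simp
      | add x y _ _ hx hy => rw [inner_add_right, hx, hy, add_zero]
      | smul a x _ hx => rw [inner_smul_right, hx, mul_zero]
    · rw [hZ, inner_add_left, hF, inner_smul_left, hff]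
      simp
  have hZ0 : inner ℝ Z Z = (0:ℝ) := by
    nth_rewrite 1 [hZ]
    rw [inner_add_left, hN Z hZN, inner_smul_left,
      (Submodule.mem_orthogonal _ _).1 hZN (f u)
        (Submodule.mem_sup_right (Submodule.mem_span_singleton_self _))]
    simp
  rw [inner_self_eq_zero] at hZ0
  rw [neg_smul]
  exact eq_neg_of_add_eq_zero_left hZ0

end LocalMinimality


end

/-! ### The divergence theorem on a half-space. -/

section

section HalfSpace

open Filter Topology

/-- The divergence theorem on the closed half-space for a compactly supported field that is
tangent to the boundary. -/
theorem integral_divergence_halfSpace {k : ℕ} [NeZero k]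
    {f : Fin k → EuclideanSpace ℝ (Fin k) → ℝ}
    {f' : Fin k → EuclideanSpace ℝ (Fin k) → EuclideanSpace ℝ (Fin k) →L[ℝ] ℝ}
    {K : Set (EuclideanSpace ℝ (Fin k))} (hK : IsCompact K)
    (hcont : ∀ i, ContinuousOn (f i) {u | 0 ≤ u 0})
    (hder : ∀ i u, 0 < u 0 → HasFDerivAt (f i) (f' i u) u)
    (hzero : ∀ i, ∀ u ∉ K, f i u = 0) (hzero' : ∀ i, ∀ u ∉ K, f' i u = 0)
    (hbd : ∀ u, u 0 = 0 → f 0 u = 0)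
    (hint : IntegrableOn (fun u => ∑ i, f' i u (EuclideanSpace.single i 1)) {u | 0 ≤ u 0}) :
    ∫ u in {u : EuclideanSpace ℝ (Fin k) | 0 ≤ u 0}, ∑ i, f' i u (EuclideanSpace.single i 1) = 0 := by
  obtain ⟨m, rfl⟩ : ∃ m, k = m + 1 := Nat.exists_eq_succ_of_ne_zero (NeZero.ne k)
  obtain ⟨L, hL0, hL⟩ : ∃ L : ℝ, 0 < L ∧ ∀ u ∈ K, ∀ i, |u i| < L := by
    obtain ⟨C, hC0, hC⟩ := hK.isBounded.exists_pos_norm_lt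
    exact ⟨C, hC0, fun u hu i => (by
      simpa using (PiLp.norm_apply_le u i).trans_lt (hC u hu))⟩
  -- One face of the box lies on the hyperplane u₀ = 0, where the relevant component vanishes; all
  -- other faces lie off the support.
  set a : Fin (m + 1) → ℝ := fun i => if i = 0 then 0 else -L with ha
  set b : Fin (m + 1) → ℝ := fun _ => L with hb
  have hab : a ≤ b := by
    intro i
    simp only [ha, hb]
    split_ifs <;> linarith
  have hmp := PiLp.volume_preserving_toLp (Fin (m + 1))
  set T : (Fin (m + 1) → ℝ) → EuclideanSpace ℝ (Fin (m + 1)) := WithLp.toLp 2 with hT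
  have hTL : ∀ x, HasFDerivAt T
      ((EuclideanSpace.equiv (Fin (m+1)) ℝ).symm : (Fin (m+1) → ℝ) →L[ℝ] _) x := fun x =>
    (EuclideanSpace.equiv (Fin (m+1)) ℝ).symm.hasFDerivAt
  have hTc : Continuous T := (EuclideanSpace.equiv (Fin (m+1)) ℝ).symm.continuous
  have hemb : MeasurableEmbedding T :=
    (MeasurableEquiv.toLp 2 (Fin (m+1) → ℝ)).measurableEmbedding
  have hpre : T ⁻¹' {u | 0 ≤ u 0} = {x | 0 ≤ x 0} := rfl
  have h0 : ∫ u in {u : EuclideanSpace ℝ (Fin (m+1)) | 0 ≤ u 0},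
      ∑ i, f' i u (EuclideanSpace.single i 1)
      = ∫ x in {x : Fin (m+1) → ℝ | 0 ≤ x 0}, ∑ i, f' i (T x) (EuclideanSpace.single i 1) := by
    rw [← hpre]
    exact (hmp.setIntegral_preimage_emb hemb
      (fun u => ∑ i, f' i u (EuclideanSpace.single i 1)) _).symm
  have hint' : IntegrableOn (fun x : Fin (m+1) → ℝ => ∑ i, f' i (T x) (EuclideanSpace.single i 1))
      {x | 0 ≤ x 0} := by
    rw [← hpre]
    exact (hmp.integrableOn_comp_preimage hemb).2 hint
  have hsub : Set.Icc a b ⊆ {x : Fin (m+1) → ℝ | 0 ≤ x 0} := by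
    intro x hx
    simpa [ha] using hx.1 0
  have hout : ∀ x ∈ {x : Fin (m+1) → ℝ | 0 ≤ x 0} \ Set.Icc a b, T x ∉ K := by
    rintro x ⟨hx0, hx⟩ hxK
    refine hx ⟨fun i => ?_, fun i => (abs_lt.1 (hL _ hxK i)).2.le⟩
    simp only [ha]
    split_ifs with hi
    · rw [hi]; exact hx0
    · exact (abs_lt.1 (hL _ hxK i)).1.le
  rw [h0, setIntegral_eq_of_subset_of_forall_sdiff_eq_zero
    (measurableSet_le measurable_const (measurable_pi_apply 0)) hsub
    (fun x hx => by simp [hzero' _ _ (hout x hx)])]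
  have hdiv := integral_divergence_of_hasFDerivAt_off_countable' a b hab
    (fun i x => f i (T x)) (fun i x => (f' i (T x)).comp
      ((EuclideanSpace.equiv (Fin (m+1)) ℝ).symm : (Fin (m+1) → ℝ) →L[ℝ] _)) ∅
    Set.countable_empty
    (fun i => (hcont i).comp hTc.continuousOn (fun x hx => hsub hx))
    (fun x hx i => (hder i (T x) (by
      have := (Set.mem_univ_pi.1 hx.1 0).1
      simpa [ha] using this)).comp x (hTL x))
    (by
      refine (hint'.mono_set hsub).congr_fun (fun x _ => ?_) measurableSet_Icc
      refine Finset.sum_congr rfl fun i _ => ?_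
      rw [ContinuousLinearMap.comp_apply]
      congr 1)
  have hlhs : ∀ x, ∑ i, f' i (T x) (EuclideanSpace.single i 1) =
      ∑ i, ((f' i (T x)).comp
      ((EuclideanSpace.equiv (Fin (m+1)) ℝ).symm : (Fin (m+1) → ℝ) →L[ℝ] _)) (Pi.single i 1) := by
    intro x
    refine Finset.sum_congr rfl fun i _ => ?_
    rw [ContinuousLinearMap.comp_apply]
    congr 1
  simp only [hlhs]
  rw [hdiv]
  refine Finset.sum_eq_zero fun i _ => ?_
  have hface : ∀ x : Fin m → ℝ, f i (T (i.insertNth (b i) x)) = 0 := by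
    intro x
    refine hzero i _ fun hx => ?_
    have h1 := hL _ hx i
    simp [hT, hb, abs_of_pos hL0] at h1
  have hface' : ∀ x : Fin m → ℝ, f i (T (i.insertNth (a i) x)) = 0 := by
    intro x
    by_cases hi : i = 0
    · subst hi
      exact hbd _ (by simp [hT, ha])
    · refine hzero i _ fun hx => ?_
      have h1 := hL _ hx i
      simp [hT, ha, hi, abs_of_pos hL0] at h1
  simp [hface, hface']

end HalfSpace


end

/-! ### The immersion and its differential in charts, up to the boundary. -/

section

section Charts

open Filter Topology

variable {k n : ℕ} [NeZero k] {M : Type*} [TopologicalSpace M]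
  [ChartedSpace (EuclideanHalfSpace k) M]

variable (k) in
/-- The manifold derivative of a map to a vector space, as a map on `ℝᵏ`. -/
def diff {A : Type*} [NormedAddCommGroup A] [NormedSpace ℝ A] (F : M → A) (x : M) :
    EuclideanSpace ℝ (Fin k) →L[ℝ] A :=
  mfderiv (𝓡∂ k) 𝓘(ℝ, A) F x

/-- The derivative of the inverse of the chart around `c`. -/
def chartSymmDeriv (c : M) (u : EuclideanSpace ℝ (Fin k)) :
    EuclideanSpace ℝ (Fin k) →L[ℝ] EuclideanSpace ℝ (Fin k) :=
  mfderivWithin 𝓘(ℝ, EuclideanSpace ℝ (Fin k)) (𝓡∂ k) (extChartAt (𝓡∂ k) c).symm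
    (Set.range (𝓡∂ k)) u

theorem target_nonneg {c : M} {u : EuclideanSpace ℝ (Fin k)}
    (hu : u ∈ (extChartAt (𝓡∂ k) c).target) : 0 ≤ u 0 := by
  have := extChartAt_target_subset_range (I := 𝓡∂ k) c hu
  rwa [range_modelWithCornersEuclideanHalfSpace] at this

theorem range_mem_nhds {u : EuclideanSpace ℝ (Fin k)} (hu : 0 < u 0) :
    Set.range (𝓡∂ k) ∈ 𝓝 u := by
  rw [← mem_interior_iff_mem_nhds, interior_range_modelWithCornersEuclideanHalfSpace]
  exact hu

theorem target_mem_nhds {c : M} {u : EuclideanSpace ℝ (Fin k)}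
    (hu : u ∈ (extChartAt (𝓡∂ k) c).target) (h0 : 0 < u 0) :
    (extChartAt (𝓡∂ k) c).target ∈ 𝓝 u := by
  have := extChartAt_target_mem_nhdsWithin_of_mem (I := 𝓡∂ k) hu
  rwa [nhdsWithin_eq_nhds.2 (range_mem_nhds h0)] at this

variable [IsManifold (𝓡∂ k) ∞ M]

theorem isInvertible_chartSymmDeriv {c : M} {u : EuclideanSpace ℝ (Fin k)}
    (hu : u ∈ (extChartAt (𝓡∂ k) c).target) : (chartSymmDeriv c u).IsInvertible := by
  have : IsManifold (𝓡∂ k) 1 M := IsManifold.of_le (n := ∞) (by simp)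
  exact isInvertible_mfderivWithin_extChartAt_symm (I := 𝓡∂ k) hu

section Comp

variable {A : Type*} [NormedAddCommGroup A] [NormedSpace ℝ A]

theorem contDiffOn_comp_symm {F : M → A} (hF : ContMDiff (𝓡∂ k) 𝓘(ℝ, A) ∞ F) (c : M) :
    ContDiffOn ℝ ∞ (F ∘ (extChartAt (𝓡∂ k) c).symm) (extChartAt (𝓡∂ k) c).target := by
  rw [← contMDiffOn_iff_contDiffOn]
  exact hF.comp_contMDiffOn (contMDiffOn_extChartAt_symm c)

theorem contDiffWithinAt_comp_symm {F : M → A} (hF : ContMDiff (𝓡∂ k) 𝓘(ℝ, A) ∞ F) {c : M}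
    {u : EuclideanSpace ℝ (Fin k)} (hu : u ∈ (extChartAt (𝓡∂ k) c).target) :
    ContDiffWithinAt ℝ ∞ (F ∘ (extChartAt (𝓡∂ k) c).symm) (Set.range (𝓡∂ k)) u :=
  (contDiffOn_comp_symm hF c u hu).mono_of_mem_nhdsWithin
    (extChartAt_target_mem_nhdsWithin_of_mem hu)

theorem fderivWithin_comp_symm {F : M → A} (hF : ContMDiff (𝓡∂ k) 𝓘(ℝ, A) ∞ F) {c : M}
    {u : EuclideanSpace ℝ (Fin k)} (hu : u ∈ (extChartAt (𝓡∂ k) c).target) :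
    fderivWithin ℝ (F ∘ (extChartAt (𝓡∂ k) c).symm) (Set.range (𝓡∂ k)) u =
      (diff k F ((extChartAt (𝓡∂ k) c).symm u)).comp (chartSymmDeriv c u) := by
  have : IsManifold (𝓡∂ k) 1 M := IsManifold.of_le (n := ∞) (by simp)
  have huR := extChartAt_target_subset_range (I := 𝓡∂ k) c hu
  have h1 : UniqueMDiffWithinAt 𝓘(ℝ, EuclideanSpace ℝ (Fin k)) (Set.range (𝓡∂ k)) u :=
    ((𝓡∂ k).uniqueDiffOn u huR).uniqueMDiffWithinAt
  have h2 := mfderiv_comp_mfderivWithin (I := 𝓘(ℝ, EuclideanSpace ℝ (Fin k))) u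
    ((hF.mdifferentiable (by simp)) ((extChartAt (𝓡∂ k) c).symm u))
    (mdifferentiableWithinAt_extChartAt_symm hu) h1
  rw [mfderivWithin_eq_fderivWithin] at h2
  exact h2

theorem hasFDerivWithinAt_comp_symm {F : M → A} (hF : ContMDiff (𝓡∂ k) 𝓘(ℝ, A) ∞ F) {c : M}
    {u : EuclideanSpace ℝ (Fin k)} (hu : u ∈ (extChartAt (𝓡∂ k) c).target) :
    HasFDerivWithinAt (F ∘ (extChartAt (𝓡∂ k) c).symm)
      ((diff k F ((extChartAt (𝓡∂ k) c).symm u)).comp (chartSymmDeriv c u))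
      (Set.range (𝓡∂ k)) u := by
  rw [← fderivWithin_comp_symm hF hu]
  exact ((contDiffWithinAt_comp_symm hF hu).differentiableWithinAt (by simp)).hasFDerivWithinAt

theorem contDiffWithinAt_fderivWithin_comp_symm {F : M → A}
    (hF : ContMDiff (𝓡∂ k) 𝓘(ℝ, A) ∞ F) {c : M}
    {u : EuclideanSpace ℝ (Fin k)} (hu : u ∈ (extChartAt (𝓡∂ k) c).target) :
    ContDiffWithinAt ℝ ∞ (fderivWithin ℝ (F ∘ (extChartAt (𝓡∂ k) c).symm) (Set.range (𝓡∂ k)))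
      (Set.range (𝓡∂ k)) u :=
  (contDiffWithinAt_comp_symm hF hu).fderivWithin_right (𝓡∂ k).uniqueDiffOn (by simp)
    (extChartAt_target_subset_range (I := 𝓡∂ k) c hu)

theorem continuousOn_fderivWithin_comp_symm {F : M → A}
    (hF : ContMDiff (𝓡∂ k) 𝓘(ℝ, A) ∞ F) (c : M) :
    ContinuousOn (fderivWithin ℝ (F ∘ (extChartAt (𝓡∂ k) c).symm) (Set.range (𝓡∂ k)))
      (extChartAt (𝓡∂ k) c).target := fun _ hu =>
  (contDiffWithinAt_fderivWithin_comp_symm hF hu).continuousWithinAt.mono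
    (extChartAt_target_subset_range c)

end Comp

variable (k) in
/-- The tangent space of the immersed submanifold, as a subspace of the ambient space. -/
def tangentPlane (F : M → Ambient n) (x : M) : Submodule ℝ (Ambient n) :=
  LinearMap.range (diff k F x : EuclideanSpace ℝ (Fin k) →ₗ[ℝ] Ambient n)

variable {F : M → Ambient n} {p : Ambient n} {R : ℝ}

namespace IsFreeBoundaryMinimal

theorem norm_eq_one (hF : IsFreeBoundaryMinimal (k := k) F p R) (x : M) : ‖F x‖ = 1 :=
  (hF.mem_ball x).1

theorem injective_diff (hF : IsFreeBoundaryMinimal (k := k) F p R) (x : M) :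
    Function.Injective (diff k F x) := hF.immersion x

variable {c : M} {u : EuclideanSpace ℝ (Fin k)}

theorem localDeriv_eq (hF : IsFreeBoundaryMinimal (k := k) F p R)
    (hu : u ∈ (extChartAt (𝓡∂ k) c).target) :
    localDeriv F c u = (diff k F ((extChartAt (𝓡∂ k) c).symm u)).comp (chartSymmDeriv c u) :=
  fderivWithin_comp_symm hF.smooth hu

theorem injective_localDeriv (hF : IsFreeBoundaryMinimal (k := k) F p R)
    (hu : u ∈ (extChartAt (𝓡∂ k) c).target) : Function.Injective (localDeriv F c u) := by
  rw [hF.localDeriv_eq hu]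
  exact (hF.injective_diff _).comp (isInvertible_chartSymmDeriv hu).injective

theorem linearIndependent (hF : IsFreeBoundaryMinimal (k := k) F p R)
    (hu : u ∈ (extChartAt (𝓡∂ k) c).target) :
    LinearIndependent ℝ (coordFrame (localDeriv F c u)) :=
  linearIndependent_coordFrame (hF.injective_localDeriv hu)

theorem range_localDeriv (hF : IsFreeBoundaryMinimal (k := k) F p R)
    (hu : u ∈ (extChartAt (𝓡∂ k) c).target) :
    Submodule.span ℝ (Set.range (coordFrame (localDeriv F c u))) =
      tangentPlane k F ((extChartAt (𝓡∂ k) c).symm u) := by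
  rw [span_range_coordFrame, hF.localDeriv_eq hu, tangentPlane]
  obtain ⟨e, he⟩ := isInvertible_chartSymmDeriv hu
  rw [← he]
  ext z
  simp only [LinearMap.mem_range, ContinuousLinearMap.coe_coe, ContinuousLinearMap.comp_apply]
  refine ⟨fun ⟨v, hv⟩ => ⟨_, hv⟩, fun ⟨v, hv⟩ => ⟨e.symm v, ?_⟩⟩
  simpa using hv

theorem continuousOn_localDeriv (hF : IsFreeBoundaryMinimal (k := k) F p R) (c : M) :
    ContinuousOn (localDeriv F c) (extChartAt (𝓡∂ k) c).target :=
  continuousOn_fderivWithin_comp_symm hF.smooth c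

theorem continuousOn_conormal (hF : IsFreeBoundaryMinimal (k := k) F p R) (c : M) (i : Fin k) :
    ContinuousOn (fun v => conormal (coordFrame (localDeriv F c v)) i)
      (extChartAt (𝓡∂ k) c).target := fun v hv => by
  have h1 := (contDiffAt_conormal (N := 0) (hF.linearIndependent hv) i).continuousAt
  exact h1.comp_continuousWithinAt (f := fun v => coordFrame (localDeriv F c v))
    ((contDiff_coordFrame (N := 0)).continuous.continuousAt.comp_continuousWithinAt
      (hF.continuousOn_localDeriv c v hv))

theorem continuousOn_volumeDensity (hF : IsFreeBoundaryMinimal (k := k) F p R) (c : M) :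
    ContinuousOn (volumeDensity F c) (extChartAt (𝓡∂ k) c).target := by
  have h1 : Continuous fun L : EuclideanSpace ℝ (Fin k) →L[ℝ] Ambient n =>
      Real.sqrt (Matrix.gram ℝ (coordFrame L)).det :=
    Real.continuous_sqrt.comp ((contDiff_gram_det (N := 0)).continuous.comp
      (contDiff_coordFrame (N := 0)).continuous)
  exact h1.comp_continuousOn (hF.continuousOn_localDeriv c)

theorem volumeDensity_pos (hF : IsFreeBoundaryMinimal (k := k) F p R)
    (hu : u ∈ (extChartAt (𝓡∂ k) c).target) : 0 < volumeDensity F c u :=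
  Real.sqrt_pos.2 (gram_det_pos (hF.linearIndependent hu))

theorem localDeriv_eventuallyEq (h0 : 0 < u 0) :
    localDeriv F c =ᶠ[𝓝 u] fderiv ℝ (localRep F c) := by
  filter_upwards [(isOpen_lt continuous_const
    (EuclideanSpace.proj (𝕜 := ℝ) (0 : Fin k)).continuous).mem_nhds h0] with v hv
  exact fderivWithin_of_mem_nhds (range_mem_nhds hv)

theorem contDiffAt_localRep (hF : IsFreeBoundaryMinimal (k := k) F p R)
    (hu : u ∈ (extChartAt (𝓡∂ k) c).target) (h0 : 0 < u 0) :
    ContDiffAt ℝ ∞ (localRep F c) u :=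
  (contDiffOn_comp_symm hF.smooth c).contDiffAt (target_mem_nhds hu h0)

theorem differentiableAt_conormal (hF : IsFreeBoundaryMinimal (k := k) F p R)
    (hu : u ∈ (extChartAt (𝓡∂ k) c).target) (h0 : 0 < u 0) (i : Fin k) :
    DifferentiableAt ℝ (fun v => conormal (coordFrame (localDeriv F c v)) i) u := by
  have h1 : ContDiffAt ℝ 1 (localDeriv F c) u :=
    ((hF.contDiffAt_localRep hu h0).fderiv_right (m := 1)
      (by rw [one_add_one_eq_two]; exact ENat.LEInfty.out)).congr_of_eventuallyEq (localDeriv_eventuallyEq h0)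
  exact ((contDiffAt_conormal (N := 1) (hF.linearIndependent hu) i).comp u
    (contDiff_coordFrame.contDiffAt.comp u h1)).differentiableAt one_ne_zero

theorem sum_fderiv_conormal (hF : IsFreeBoundaryMinimal (k := k) F p R)
    (hu : u ∈ (extChartAt (𝓡∂ k) c).target) (h0 : 0 < u 0) :
    ∑ i, fderiv ℝ (fun v => conormal (coordFrame (localDeriv F c v)) i) u
      (EuclideanSpace.single i 1) = (-(k * volumeDensity F c u)) • localRep F c u := by
  have hev := localDeriv_eventuallyEq (F := F) (c := c) h0
  have h1 := SphereFreeBoundary.sum_fderiv_conormal (f := localRep F c) (u := u)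
    ((hF.contDiffAt_localRep hu h0).of_le ENat.LEInfty.out)
    (Eventually.of_forall fun v => hF.norm_eq_one _)
    (by rw [← hev.self_of_nhds]; exact hF.injective_localDeriv hu)
    (by
      have h2 := hF.minimal c u hu
      have h3 : ∀ i j, secondPartialDeriv F c u i j =
          fderiv ℝ (fderiv ℝ (localRep F c)) u (EuclideanSpace.single i 1)
            (EuclideanSpace.single j 1) := by
        intro i j
        rw [secondPartialDeriv, fderivWithin_of_mem_nhds (range_mem_nhds h0), hev.fderiv_eq]
      simp only [meanCurvature, secondFundamentalForm, h3] at h2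
      rw [← hev.self_of_nhds]
      exact h2)
  have h4 : ∀ i, (fun v => conormal (coordFrame (localDeriv F c v)) i) =ᶠ[𝓝 u]
      fun v => conormal (coordFrame (fderiv ℝ (localRep F c) v)) i := fun i => by
    filter_upwards [hev] with v hv
    rw [hv]
  simp only [fun i => (h4 i).fderiv_eq (𝕜 := ℝ)]
  rw [h1, ← hev.self_of_nhds]
  rfl

end IsFreeBoundaryMinimal

end Charts


end

/-! ### Change of charts and the Riemannian volume as a measure on M. -/

section

section GramComp

variable {k : ℕ} {A : Type*} [NormedAddCommGroup A] [InnerProductSpace ℝ A]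

/-- The Gram matrix transforms as SᵀGS. This is the Jacobian factor both for changes of charts and
for normalising the bubble integrals. -/
theorem gram_det_comp (L : EuclideanSpace ℝ (Fin k) →L[ℝ] A)
    (S : EuclideanSpace ℝ (Fin k) →L[ℝ] EuclideanSpace ℝ (Fin k)) :
    (Matrix.gram ℝ (coordFrame (L.comp S))).det = S.det ^ 2 *
      (Matrix.gram ℝ (coordFrame L)).det := by
  set b := (EuclideanSpace.basisFun (Fin k) ℝ).toBasis with hb
  set m := LinearMap.toMatrix b b (S : EuclideanSpace ℝ (Fin k) →ₗ[ℝ] EuclideanSpace ℝ (Fin k))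
    with hm
  have hdet : S.det = m.det := by
    rw [hm, LinearMap.det_toMatrix]
  have hcol : ∀ j, coordFrame (L.comp S) j = ∑ i, m i j • coordFrame L i := by
    intro j
    have h1 : S (b j) = ∑ i, m i j • b i := by
      have := b.sum_repr (S (b j))
      rw [← this]
      simp [hm, LinearMap.toMatrix_apply]
    have h2 : ∀ i, b i = EuclideanSpace.single i 1 := by simp [hb]
    simp only [h2] at h1
    simp only [coordFrame, ContinuousLinearMap.comp_apply, h1, map_sum, map_smul]
  have hg : Matrix.gram ℝ (coordFrame (L.comp S)) =
      m.transpose * Matrix.gram ℝ (coordFrame L) * m := by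
    ext i j
    simp only [Matrix.gram, Matrix.of_apply, hcol, Matrix.mul_apply, sum_inner, inner_sum,
      inner_smul_left, inner_smul_right, Matrix.transpose_apply, conj_trivial, Finset.sum_mul]
    refine Finset.sum_congr rfl fun a _ => ?_
    rw [Finset.mul_sum]
    refine Finset.sum_congr rfl fun b _ => ?_
    ring
  rw [hg, Matrix.det_mul, Matrix.det_mul, Matrix.det_transpose, hdet]
  ring

end GramComp

section VolumeMeasure

open Filter Topology Set

variable {k n : ℕ} [NeZero k] {M : Type*} [TopologicalSpace M]
  [ChartedSpace (EuclideanHalfSpace k) M] [MeasurableSpace M]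

/-- The Riemannian volume of the chart domain around `c`, as a measure on `M`. -/
def chartMeasure (F : M → Ambient n) (c : M) : Measure M :=
  Measure.map (extChartAt (𝓡∂ k) c).symm
    ((volume.restrict (extChartAt (𝓡∂ k) c).target).withDensity
      fun u => ENNReal.ofReal (volumeDensity F c u))

variable (k) in
/-- The Riemannian volume of the metric induced by `F`, as a measure on `M`. -/
def volumeMeasure [IsManifold (𝓡∂ k) ∞ M] [CompactSpace M] [T2Space M] (F : M → Ambient n) :
    Measure M :=
  Measure.sum fun c => (chartMeasure (k := k) F c).withDensity
    fun x => ENNReal.ofReal (chartPartition k M c x)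

omit [MeasurableSpace M] in
theorem measurableSet_target (c : M) : MeasurableSet (extChartAt (𝓡∂ k) c).target := by
  rw [extChartAt_target]
  exact ((((chartAt (EuclideanHalfSpace k) c).open_target).preimage
    (𝓡∂ k).continuous_symm).measurableSet).inter (𝓡∂ k).isClosed_range.measurableSet

variable [BorelSpace M]

theorem aemeasurable_symm (c : M) : AEMeasurable (extChartAt (𝓡∂ k) c).symm
    ((volume : Measure (EuclideanSpace ℝ (Fin k))).restrict (extChartAt (𝓡∂ k) c).target) :=
  (continuousOn_extChartAt_symm c).aemeasurable (measurableSet_target c)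

theorem measurableSet_target_inter_preimage (c : M) {A : Set M} (hA : MeasurableSet A) :
    MeasurableSet ((extChartAt (𝓡∂ k) c).target ∩ (extChartAt (𝓡∂ k) c).symm ⁻¹' A) := by
  have h : Measurable ((extChartAt (𝓡∂ k) c).target.domRestrict (extChartAt (𝓡∂ k) c).symm) :=
    (continuousOn_iff_continuous_domRestrict.1 (continuousOn_extChartAt_symm c)).measurable
  have := (measurableSet_target c).subtype_image (h hA)
  convert this using 1
  ext u
  simp only [mem_inter_iff, mem_preimage, mem_image, domRestrict_apply, Subtype.exists,
    exists_and_right, exists_eq_right]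
  exact ⟨fun h => ⟨h.1, h.2⟩, fun ⟨h1, h2⟩ => ⟨h1, h2⟩⟩

variable [IsManifold (𝓡∂ k) ∞ M] {F : M → Ambient n} {p : Ambient n} {R : ℝ}

namespace IsFreeBoundaryMinimal

theorem aemeasurable_density (hF : IsFreeBoundaryMinimal (k := k) F p R) (c : M) :
    AEMeasurable (fun u => ENNReal.ofReal (volumeDensity F c u))
      (volume.restrict (extChartAt (𝓡∂ k) c).target) :=
  ((hF.continuousOn_volumeDensity c).aemeasurable (measurableSet_target c)).ennreal_ofReal

theorem aemeasurable_symm_withDensity (F : M → Ambient n) (c : M) :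
    AEMeasurable (extChartAt (𝓡∂ k) c).symm
      ((volume.restrict (extChartAt (𝓡∂ k) c).target).withDensity
        fun u => ENNReal.ofReal (volumeDensity F c u)) :=
  (aemeasurable_symm c).mono_ac (withDensity_absolutelyContinuous _ _)

theorem lintegral_chartMeasure (hF : IsFreeBoundaryMinimal (k := k) F p R) (c : M)
    {f : M → ℝ≥0∞} (hf : Measurable f) :
    ∫⁻ x, f x ∂(chartMeasure (k := k) F c) = ∫⁻ u in (extChartAt (𝓡∂ k) c).target,
      f ((extChartAt (𝓡∂ k) c).symm u) * ENNReal.ofReal (volumeDensity F c u) := by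
  rw [chartMeasure, lintegral_map' hf.aemeasurable (aemeasurable_symm_withDensity F c)]
  refine (lintegral_withDensity_eq_lintegral_mul₀ (hF.aemeasurable_density c)
      (hf.comp_aemeasurable (aemeasurable_symm c))).trans ?_
  simp only [Pi.mul_apply, Function.comp_apply, mul_comm]

theorem chartMeasure_apply (hF : IsFreeBoundaryMinimal (k := k) F p R) (c : M) {A : Set M}
    (hA : MeasurableSet A) : chartMeasure (k := k) F c A =
      ∫⁻ u in (extChartAt (𝓡∂ k) c).target ∩ (extChartAt (𝓡∂ k) c).symm ⁻¹' A,
        ENNReal.ofReal (volumeDensity F c u) := by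
  rw [← lintegral_indicator_one hA, hF.lintegral_chartMeasure c (measurable_one.indicator hA)]
  have : ∀ u, A.indicator (1 : M → ℝ≥0∞) ((extChartAt (𝓡∂ k) c).symm u) *
      ENNReal.ofReal (volumeDensity F c u) =
      ((extChartAt (𝓡∂ k) c).target ∩ (extChartAt (𝓡∂ k) c).symm ⁻¹' A).indicator
        (fun u => ENNReal.ofReal (volumeDensity F c u)) u ∨
        u ∉ (extChartAt (𝓡∂ k) c).target := by
    intro u
    by_cases hu : u ∈ (extChartAt (𝓡∂ k) c).target
    · left
      by_cases hA : (extChartAt (𝓡∂ k) c).symm u ∈ A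
      · rw [indicator_of_mem hA, indicator_of_mem (mem_inter hu hA), Pi.one_apply, one_mul]
      · rw [indicator_of_notMem hA, indicator_of_notMem fun h => hA h.2, zero_mul]
    · right; exact hu
  rw [setLIntegral_congr_fun (measurableSet_target c)
    (fun u hu => (this u).resolve_right (not_not.2 hu)),
    setLIntegral_indicator (measurableSet_target_inter_preimage c hA)]
  congr 2
  ext u
  simp only [mem_inter_iff, mem_preimage]
  tauto

theorem chartMeasure_compl_source (hF : IsFreeBoundaryMinimal (k := k) F p R) (c : M) :
    chartMeasure (k := k) F c (extChartAt (𝓡∂ k) c).sourceᶜ = 0 := by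
  rw [hF.chartMeasure_apply c (isOpen_extChartAt_source c).measurableSet.compl]
  have : (extChartAt (𝓡∂ k) c).target ∩ (extChartAt (𝓡∂ k) c).symm ⁻¹'
      (extChartAt (𝓡∂ k) c).sourceᶜ = ∅ := by
    ext u
    simp only [mem_inter_iff, mem_preimage, mem_compl_iff, mem_empty_iff_false, iff_false, not_and,
      not_not]
    exact fun hu => (extChartAt (𝓡∂ k) c).map_target hu
  rw [this]
  simp

/-- The volume of a set is computed by any chart that contains the set. -/
theorem chartMeasure_eq (hF : IsFreeBoundaryMinimal (k := k) F p R) (c c' : M) {A : Set M}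
    (hA : MeasurableSet A) (hAc : A ⊆ (extChartAt (𝓡∂ k) c).source)
    (hAc' : A ⊆ (extChartAt (𝓡∂ k) c').source) :
    chartMeasure (k := k) F c A = chartMeasure (k := k) F c' A := by
  rw [hF.chartMeasure_apply c hA, hF.chartMeasure_apply c' hA]
  set s := (extChartAt (𝓡∂ k) c).target ∩ (extChartAt (𝓡∂ k) c).symm ⁻¹' A with hs
  set φ : EuclideanSpace ℝ (Fin k) → EuclideanSpace ℝ (Fin k) :=
    extChartAt (𝓡∂ k) c' ∘ (extChartAt (𝓡∂ k) c).symm with hφ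
  have himg : φ '' s = (extChartAt (𝓡∂ k) c').target ∩ (extChartAt (𝓡∂ k) c').symm ⁻¹' A := by
    ext v
    constructor
    · rintro ⟨u, ⟨hu, huA⟩, rfl⟩
      refine ⟨(extChartAt (𝓡∂ k) c').map_source (hAc' huA), ?_⟩
      rw [mem_preimage, hφ, Function.comp_apply, (extChartAt (𝓡∂ k) c').left_inv (hAc' huA)]
      exact huA
    · rintro ⟨hv, hvA⟩
      refine ⟨extChartAt (𝓡∂ k) c ((extChartAt (𝓡∂ k) c').symm v),
        ⟨(extChartAt (𝓡∂ k) c).map_source (hAc hvA), ?_⟩, ?_⟩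
      · rw [mem_preimage, (extChartAt (𝓡∂ k) c).left_inv (hAc hvA)]
        exact hvA
      · rw [hφ, Function.comp_apply, (extChartAt (𝓡∂ k) c).left_inv (hAc hvA),
          (extChartAt (𝓡∂ k) c').right_inv hv]
  have hinj : InjOn φ s := by
    rintro u ⟨hu, huA⟩ v ⟨hv, hvA⟩ huv
    have h1 := (extChartAt (𝓡∂ k) c').injOn (hAc' huA) (hAc' hvA) huv
    exact (extChartAt (𝓡∂ k) c).symm.injOn hu hv h1
  have hsrc : ∀ u ∈ s, u ∈ ((extChartAt (𝓡∂ k) c).symm.trans (extChartAt (𝓡∂ k) c')).source :=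
    fun u hu => by
      rw [PartialEquiv.trans_source]
      exact ⟨hu.1, hAc' hu.2⟩
  have hd : ∀ u ∈ s, HasFDerivWithinAt φ (fderivWithin ℝ φ (range (𝓡∂ k)) u) (range (𝓡∂ k)) u :=
    fun u hu => ((contDiffWithinAt_ext_coord_change (I := 𝓡∂ k) (n := ∞) c' c
      (hsrc u hu)).differentiableWithinAt (by simp)).hasFDerivWithinAt
  have hsr : s ⊆ range (𝓡∂ k) := inter_subset_left.trans (extChartAt_target_subset_range c)
  rw [← himg, lintegral_image_eq_lintegral_abs_det_fderiv_mul volume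
    (measurableSet_target_inter_preimage c hA) (fun u hu => (hd u hu).mono hsr) hinj]
  refine setLIntegral_congr_fun (measurableSet_target_inter_preimage c hA) fun u hu => ?_
  have hφu : φ u ∈ (extChartAt (𝓡∂ k) c').target := by
    have := mem_image_of_mem φ hu
    rw [himg] at this
    exact this.1
  have hchain : localDeriv F c u = (localDeriv F c' (φ u)).comp
      (fderivWithin ℝ φ (range (𝓡∂ k)) u) := by
    have h1 : HasFDerivWithinAt (localRep F c') (localDeriv F c' (φ u)) (range (𝓡∂ k)) (φ u) :=
      ((contDiffWithinAt_comp_symm hF.smooth hφu).differentiableWithinAt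
        (by simp)).hasFDerivWithinAt
    have hmaps : MapsTo φ (range (𝓡∂ k)) (range (𝓡∂ k)) := fun v _ => by
      simp [hφ]
    have h2 := h1.comp u (hd u hu) hmaps
    have h3 : HasFDerivWithinAt (localRep F c) (localDeriv F c u) (range (𝓡∂ k)) u :=
      ((contDiffWithinAt_comp_symm hF.smooth hu.1).differentiableWithinAt
        (by simp)).hasFDerivWithinAt
    have hev : localRep F c =ᶠ[𝓝[range (𝓡∂ k)] u] localRep F c' ∘ φ := by
      have hcont : ContinuousWithinAt (extChartAt (𝓡∂ k) c).symm (range (𝓡∂ k)) u :=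
        (continuousAt_extChartAt_symm'' hu.1).continuousWithinAt
      filter_upwards [hcont (extChartAt_source_mem_nhds' (I := 𝓡∂ k) (hAc' hu.2))] with v hv
      change F _ = F _
      rw [hφ, Function.comp_apply, (extChartAt (𝓡∂ k) c').left_inv hv]
    exact ((𝓡∂ k).uniqueDiffOn u (hsr hu)).eq h3
      (h2.congr_of_eventuallyEq hev (hev.self_of_nhdsWithin (hsr hu)))
  have hdens : volumeDensity F c u = |(fderivWithin ℝ φ (range (𝓡∂ k)) u).det| *
      volumeDensity F c' (φ u) := by
    have : volumeDensity F c u = Real.sqrt (Matrix.gram ℝ (coordFrame (localDeriv F c u))).det := rfl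
    rw [this, hchain, gram_det_comp, Real.sqrt_mul (sq_nonneg _), Real.sqrt_sq_eq_abs]
    rfl
  simp only [hdens]
  rw [ENNReal.ofReal_mul (abs_nonneg _)]

variable [CompactSpace M] [T2Space M]

theorem volumeMeasure_univ (hF : IsFreeBoundaryMinimal (k := k) F p R) :
    volumeMeasure k F univ = immersedVolume (k := k) F := by
  rw [volumeMeasure, Measure.sum_apply _ MeasurableSet.univ, immersedVolume]
  refine tsum_congr fun c => ?_
  rw [withDensity_apply _ MeasurableSet.univ, setLIntegral_univ, hF.lintegral_chartMeasure c
    (chartPartition k M c).contMDiff.continuous.measurable.ennreal_ofReal]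
  refine setLIntegral_congr_fun (measurableSet_target c) fun u _ => ?_
  rw [← ENNReal.ofReal_mul ((chartPartition k M).nonneg c _)]

end IsFreeBoundaryMinimal

section Partition

variable (k M) [CompactSpace M] [T2Space M]

omit [MeasurableSpace M] [BorelSpace M] in
theorem finite_chartPartition : {c | (Function.support (chartPartition k M c)).Nonempty}.Finite :=
  (chartPartition k M).locallyFinite.finite_nonempty_of_compact

/-- The finitely many charts that contribute to the partition of unity. -/
def activeCharts : Finset M := (finite_chartPartition k M).toFinset

variable {k M}

omit [MeasurableSpace M] [BorelSpace M] in
theorem chartPartition_eq_zero {c : M} (hc : c ∉ activeCharts k M) (x : M) :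
    chartPartition k M c x = 0 := by
  by_contra h
  exact hc ((finite_chartPartition k M).mem_toFinset.2 ⟨x, h⟩)

omit [MeasurableSpace M] [BorelSpace M] in
theorem sum_chartPartition (x : M) : ∑ c ∈ activeCharts k M, chartPartition k M c x = 1 := by
  rw [← (chartPartition k M).sum_eq_one (mem_univ x)]
  refine (finsum_eq_sum_of_support_subset _ fun c hc => ?_).symm
  exact (finite_chartPartition k M).mem_toFinset.2 ⟨x, hc⟩

omit [MeasurableSpace M] [BorelSpace M] in
theorem tsupport_chartPartition (c : M) :
    tsupport (chartPartition k M c) ⊆ (extChartAt (𝓡∂ k) c).source := by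
  rw [extChartAt_source]
  exact chartPartition_isSubordinate k M c

end Partition

namespace IsFreeBoundaryMinimal

variable [CompactSpace M] [T2Space M]

theorem volumeMeasure_eq_sum (F : M → Ambient n) : volumeMeasure k F =
    ∑ c ∈ activeCharts k M, (chartMeasure (k := k) F c).withDensity
      fun x => ENNReal.ofReal (chartPartition k M c x) := by
  ext A hA
  rw [volumeMeasure, Measure.sum_apply _ hA, Measure.finsetSum_apply]
  refine tsum_eq_sum fun c hc => ?_
  simp [chartPartition_eq_zero hc]

/-- Chart measures agree on overlaps and the weights of the partition sum to one, so gluing does not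
alter the measure on any chart. From here on an integrand supported in one chart is computed in that
chart alone. -/
theorem volumeMeasure_restrict (hF : IsFreeBoundaryMinimal (k := k) F p R) (c : M) :
    (volumeMeasure k F).restrict (extChartAt (𝓡∂ k) c).source = chartMeasure (k := k) F c := by
  have hsrc : ∀ c : M, MeasurableSet (extChartAt (𝓡∂ k) c).source := fun c =>
    (isOpen_extChartAt_source c).measurableSet
  have hmeas : ∀ c : M, Measurable fun x : M => ENNReal.ofReal (chartPartition k M c x) := fun c =>
    (chartPartition k M c).contMDiff.continuous.measurable.ennreal_ofReal
  have hres : ∀ c c' : M, (chartMeasure (k := k) F c').restrict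
      ((extChartAt (𝓡∂ k) c).source ∩ (extChartAt (𝓡∂ k) c').source) =
      (chartMeasure (k := k) F c).restrict
      ((extChartAt (𝓡∂ k) c).source ∩ (extChartAt (𝓡∂ k) c').source) := by
    intro c c'
    ext A hA
    rw [Measure.restrict_apply hA, Measure.restrict_apply hA]
    exact hF.chartMeasure_eq _ _ (hA.inter ((hsrc c).inter (hsrc c')))
      (inter_subset_right.trans inter_subset_right) (inter_subset_right.trans inter_subset_left)
  have hterm : ∀ c' : M, ((chartMeasure (k := k) F c').withDensity
      fun x => ENNReal.ofReal (chartPartition k M c' x)).restrict (extChartAt (𝓡∂ k) c).source =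
      (chartMeasure (k := k) F c).withDensity
      fun x => ENNReal.ofReal (chartPartition k M c' x) := by
    intro c'
    have hzero : ∀ x, x ∉ (extChartAt (𝓡∂ k) c').source →
        ENNReal.ofReal (chartPartition k M c' x) = 0 := fun x hx => by
      rw [image_eq_zero_of_notMem_tsupport fun h => hx (tsupport_chartPartition c' h)]
      simp
    have hcut : ∀ (ν : Measure M) (B : Set M),
        ∫⁻ x in B, ENNReal.ofReal (chartPartition k M c' x) ∂ν =
        ∫⁻ x in B ∩ (extChartAt (𝓡∂ k) c').source,
          ENNReal.ofReal (chartPartition k M c' x) ∂ν := by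
      intro ν B
      rw [inter_comm, ← setLIntegral_indicator (hsrc c')]
      refine lintegral_congr fun x => ?_
      by_cases hx : x ∈ (extChartAt (𝓡∂ k) c').source
      · rw [indicator_of_mem hx]
      · rw [indicator_of_notMem hx, hzero x hx]
    ext A hA
    rw [Measure.restrict_apply hA, withDensity_apply _ (hA.inter (hsrc c)),
      withDensity_apply _ hA]
    have h1 : ∫⁻ x in A ∩ (extChartAt (𝓡∂ k) c).source, ENNReal.ofReal (chartPartition k M c' x)
        ∂(chartMeasure (k := k) F c') =
        ∫⁻ x in A ∩ ((extChartAt (𝓡∂ k) c).source ∩ (extChartAt (𝓡∂ k) c').source),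
          ENNReal.ofReal (chartPartition k M c' x) ∂(chartMeasure (k := k) F c') := by
      rw [← inter_assoc]
      exact hcut _ _
    have h2 : ∫⁻ x in A, ENNReal.ofReal (chartPartition k M c' x)
        ∂(chartMeasure (k := k) F c) =
        ∫⁻ x in A ∩ ((extChartAt (𝓡∂ k) c).source ∩ (extChartAt (𝓡∂ k) c').source),
          ENNReal.ofReal (chartPartition k M c' x) ∂(chartMeasure (k := k) F c) := by
      have h3 : ∫⁻ x in A, ENNReal.ofReal (chartPartition k M c' x)
        ∂(chartMeasure (k := k) F c) = ∫⁻ x in A ∩ (extChartAt (𝓡∂ k) c).source,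
          ENNReal.ofReal (chartPartition k M c' x) ∂(chartMeasure (k := k) F c) := by
        refine setLIntegral_congr ?_
        refine (inter_ae_eq_left_of_ae_eq_univ ?_).symm
        exact eventuallyEq_univ.2 (mem_ae_iff.2 (hF.chartMeasure_compl_source c))
      rw [h3, ← inter_assoc]
      exact hcut _ _
    rw [h1, h2, ← Measure.restrict_restrict hA, ← Measure.restrict_restrict hA, hres]
  ext A hA
  have h4 := fun c' => congrArg (fun ν : Measure M => ν A) (hterm c')
  simp only [Measure.restrict_apply hA] at h4
  rw [Measure.restrict_apply hA, volumeMeasure_eq_sum, Measure.finsetSum_apply]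
  simp only [h4]
  simp only [withDensity_apply _ hA]
  rw [← lintegral_finsetSum _ fun c' _ => hmeas c']
  have h5 : ∀ x : M, ∑ c' ∈ activeCharts k M, ENNReal.ofReal (chartPartition k M c' x) = 1 := by
    intro x
    rw [← ENNReal.ofReal_sum_of_nonneg fun c' _ => (chartPartition k M).nonneg c' x,
      sum_chartPartition, ENNReal.ofReal_one]
  simp [h5]

end IsFreeBoundaryMinimal

end VolumeMeasure


end

/-! ### Tangential projection, and the conormal along the boundary. -/

section

open Filter Topology Set

variable {k n : ℕ} [NeZero k] {M : Type*} [TopologicalSpace M]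
  [ChartedSpace (EuclideanHalfSpace k) M] [IsManifold (𝓡∂ k) ∞ M]

theorem volume_hyperplane : volume {u : EuclideanSpace ℝ (Fin k) | u 0 = 0} = 0 := by
  set S : Submodule ℝ (EuclideanSpace ℝ (Fin k)) :=
    LinearMap.ker (EuclideanSpace.proj (𝕜 := ℝ) (0 : Fin k)).toLinearMap with hS
  have h1 : S ≠ ⊤ := by
    intro h
    have : EuclideanSpace.single (0 : Fin k) (1:ℝ) ∈ S := h ▸ Submodule.mem_top
    simp [hS] at this
  exact Measure.addHaar_submodule volume S h1

theorem mem_boundary {c : M} {u : EuclideanSpace ℝ (Fin k)}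
    (hu : u ∈ (extChartAt (𝓡∂ k) c).target) (h0 : u 0 = 0) :
    (extChartAt (𝓡∂ k) c).symm u ∈ (𝓡∂ k).boundary M := by
  have hs : (extChartAt (𝓡∂ k) c).symm u ∈ (chartAt (EuclideanHalfSpace k) c).source := by
    rw [← extChartAt_source (𝓡∂ k)]
    exact (extChartAt (𝓡∂ k) c).map_target hu
  rw [← ModelWithCorners.compl_interior]
  intro hint
  have h1 := ((𝓡∂ k).isInteriorPoint_iff_of_mem_atlas (n := ∞) (by simp)
    (chart_mem_atlas (EuclideanHalfSpace k) c) hs).1 hint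
  change extChartAt (𝓡∂ k) c ((extChartAt (𝓡∂ k) c).symm u) ∈
    interior (extChartAt (𝓡∂ k) c).target at h1
  rw [(extChartAt (𝓡∂ k) c).right_inv hu] at h1
  have h2 := interior_mono (extChartAt_target_subset_range (I := 𝓡∂ k) c) h1
  rw [interior_range_modelWithCornersEuclideanHalfSpace] at h2
  exact (ne_of_gt h2) h0

theorem continuous_of_comp_symm {X : Type*} [TopologicalSpace X] {f : M → X}
    (hf : ∀ c : M, ContinuousOn (f ∘ (extChartAt (𝓡∂ k) c).symm) (extChartAt (𝓡∂ k) c).target) :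
    Continuous f := by
  rw [continuous_iff_continuousAt]
  intro x
  have hs := extChartAt_source_mem_nhds (I := 𝓡∂ k) x
  have h1 : ContinuousOn ((f ∘ (extChartAt (𝓡∂ k) x).symm) ∘ extChartAt (𝓡∂ k) x)
      (extChartAt (𝓡∂ k) x).source :=
    (hf x).comp (continuousOn_extChartAt x) (extChartAt (𝓡∂ k) x).mapsTo
  refine (h1.continuousAt hs).congr ?_
  filter_upwards [hs] with y hy
  simp only [Function.comp_apply, (extChartAt (𝓡∂ k) x).left_inv hy]

variable {F : M → Ambient n} {p : Ambient n} {R : ℝ}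

variable (k) in
/-- The orthogonal projection to the tangent space of the immersed submanifold. -/
def tangentProj (F : M → Ambient n) (x : M) : Ambient n →L[ℝ] Ambient n :=
  (tangentPlane k F x).starProjection

variable (k) in
/-- The tangent vector of `M` that corresponds to the tangential part of an ambient vector. -/
def tangentLift (F : M → Ambient n) (x : M) (z : Ambient n) : EuclideanSpace ℝ (Fin k) :=
  Function.invFun (diff k F x) (tangentProj k F x z)

theorem diff_tangentLift (F : M → Ambient n) (x : M) (z : Ambient n) :
    diff k F x (tangentLift k F x z) = tangentProj k F x z :=
  Function.invFun_eq (Submodule.starProjection_apply_mem (tangentPlane k F x) z)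

namespace IsFreeBoundaryMinimal

theorem cos_eq_inner (hF : IsFreeBoundaryMinimal (k := k) F p R) (hp : ‖p‖ = 1) {x : M}
    (hx : x ∈ (𝓡∂ k).boundary M) : inner ℝ (F x) p = Real.cos R := by
  rw [← (hF.boundary x hx).2, geodesicDist, InnerProductGeometry.cos_angle, hp, hF.norm_eq_one,
    real_inner_comm]
  simp

variable {c : M} {u : EuclideanSpace ℝ (Fin k)}

theorem volumeDensity_smul_tangentProj (hF : IsFreeBoundaryMinimal (k := k) F p R)
    (hu : u ∈ (extChartAt (𝓡∂ k) c).target) (z : Ambient n) :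
    volumeDensity F c u • tangentProj k F ((extChartAt (𝓡∂ k) c).symm u) z =
      ∑ i, inner ℝ (conormal (coordFrame (localDeriv F c u)) i) z •
        coordFrame (localDeriv F c u) i := by
  rw [sum_inner_conormal_smul (hF.linearIndependent hu), hF.range_localDeriv hu]
  rfl

theorem volumeDensity_smul_tangentLift (hF : IsFreeBoundaryMinimal (k := k) F p R)
    (hu : u ∈ (extChartAt (𝓡∂ k) c).target) (z : Ambient n) :
    volumeDensity F c u • tangentLift k F ((extChartAt (𝓡∂ k) c).symm u) z =
      ∑ i, inner ℝ (conormal (coordFrame (localDeriv F c u)) i) z •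
        chartSymmDeriv c u (EuclideanSpace.single i 1) := by
  apply hF.injective_diff ((extChartAt (𝓡∂ k) c).symm u)
  rw [map_smul, diff_tangentLift, hF.volumeDensity_smul_tangentProj hu, map_sum]
  refine Finset.sum_congr rfl fun i _ => ?_
  rw [map_smul, coordFrame, hF.localDeriv_eq hu]
  rfl

theorem continuous_tangentProj (hF : IsFreeBoundaryMinimal (k := k) F p R) (z : Ambient n) :
    Continuous fun x => tangentProj k F x z := by
  refine continuous_of_comp_symm (k := k) fun c => ?_
  have h : ContinuousOn (fun u => (volumeDensity F c u)⁻¹ •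
      ∑ i, inner ℝ (conormal (coordFrame (localDeriv F c u)) i) z •
        coordFrame (localDeriv F c u) i) (extChartAt (𝓡∂ k) c).target := by
    refine ((hF.continuousOn_volumeDensity c).inv₀ fun u hu =>
      (hF.volumeDensity_pos hu).ne').smul ?_
    refine continuousOn_finsetSum _ fun i _ => ?_
    refine ((hF.continuousOn_conormal c i).inner (𝕜 := ℝ) continuousOn_const).smul ?_
    exact (hF.continuousOn_localDeriv c).clm_apply continuousOn_const
  refine h.congr fun u hu => ?_
  simp only [← hF.volumeDensity_smul_tangentProj hu, smul_smul,
    inv_mul_cancel₀ (hF.volumeDensity_pos hu).ne', one_smul, Function.comp_apply]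

/-- The derivative of a function along the tangential part of an ambient vector, in a chart. -/
theorem volumeDensity_mul_diff_tangentLift (hF : IsFreeBoundaryMinimal (k := k) F p R)
    (hu : u ∈ (extChartAt (𝓡∂ k) c).target) {η : M → ℝ}
    (hη : ContMDiff (𝓡∂ k) 𝓘(ℝ, ℝ) ∞ η) (z : Ambient n) :
    volumeDensity F c u * diff k η ((extChartAt (𝓡∂ k) c).symm u)
      (tangentLift k F ((extChartAt (𝓡∂ k) c).symm u) z) =
      ∑ i, inner ℝ (conormal (coordFrame (localDeriv F c u)) i) z *
        fderivWithin ℝ (η ∘ (extChartAt (𝓡∂ k) c).symm) (range (𝓡∂ k)) u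
          (EuclideanSpace.single i 1) := by
  rw [← smul_eq_mul, ← map_smul, hF.volumeDensity_smul_tangentLift hu, map_sum,
    fderivWithin_comp_symm hη hu]
  refine Finset.sum_congr rfl fun i _ => ?_
  rw [map_smul]
  rfl

/-- At the boundary the conormal of the boundary face is orthogonal to every vector that is
tangent to the geodesic sphere. -/
theorem inner_conormal_boundary (hF : IsFreeBoundaryMinimal (k := k) F p R) (hp : ‖p‖ = 1)
    (hR0 : 0 < R) (hR : R ≤ Real.pi / 2)
    (hu : u ∈ (extChartAt (𝓡∂ k) c).target) (h0 : u 0 = 0) {z : Ambient n}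
    (hz : inner ℝ z (Real.cos R • localRep F c u - p) = 0) :
    inner ℝ (conormal (coordFrame (localDeriv F c u)) 0) z = 0 := by
  set V := coordFrame (localDeriv F c u) with hV
  have hlin : LinearIndependent ℝ V := hF.linearIndependent hu
  set x := (extChartAt (𝓡∂ k) c).symm u with hx
  have hxb : x ∈ (𝓡∂ k).boundary M := mem_boundary hu h0
  have huR : u ∈ range (𝓡∂ k) := extChartAt_target_subset_range c hu
  have hder : HasFDerivWithinAt (localRep F c) (localDeriv F c u) (range (𝓡∂ k)) u :=
    ((contDiffWithinAt_comp_symm hF.smooth hu).differentiableWithinAt (by simp)).hasFDerivWithinAt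
  have hsin : Real.sin R ≠ 0 := (Real.sin_pos_of_pos_of_lt_pi hR0 (by linarith [Real.pi_pos])).ne'
  have hVF : ∀ j, inner ℝ (V j) (F x) = 0 := by
    intro j
    have h1 : HasFDerivWithinAt (fun v => inner ℝ (localRep F c v) (localRep F c v)) _
      (range (𝓡∂ k)) u := hder.inner ℝ hder
    have h2 : HasFDerivWithinAt (fun v => inner ℝ (localRep F c v) (localRep F c v))
        (0 : EuclideanSpace ℝ (Fin k) →L[ℝ] ℝ) (range (𝓡∂ k)) u := by
      refine (hasFDerivWithinAt_const (1:ℝ) u _).congr (fun v _ => ?_) ?_ <;>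
      · rw [real_inner_self_eq_norm_sq, localRep, Function.comp_apply, hF.norm_eq_one]; norm_num
    have h3 := congrArg (fun L => L (EuclideanSpace.single j (1:ℝ)))
      (((𝓡∂ k).uniqueDiffOn u huR).eq h1 h2)
    simp only [ContinuousLinearMap.comp_apply, ContinuousLinearMap.prod_apply,
      fderivInnerCLM_apply, zero_apply] at h3
    change inner ℝ (F x) (V j) + inner ℝ (V j) (F x) = 0 at h3
    rw [real_inner_comm] at h3
    linarith
  -- For j ≠ 0 the coordinate line through u stays in the face u₀ = 0, that is in ∂M, where ⟨F, p⟩ =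
  -- cos R is constant.
  have hVp : ∀ j, j ≠ 0 → inner ℝ (V j) p = 0 := by
    intro j hj
    set γ : ℝ → EuclideanSpace ℝ (Fin k) := fun s => u + s • EuclideanSpace.single j (1:ℝ) with hγ
    have hγ0 : ∀ s, (γ s) 0 = 0 := fun s => by simp [hγ, h0, hj.symm]
    have hγd : HasDerivAt γ (EuclideanSpace.single j (1:ℝ)) 0 := by
      have := ((hasDerivAt_id (0:ℝ)).smul_const (EuclideanSpace.single j (1:ℝ))).const_add u
      rw [one_smul] at this
      exact this
    have hγ00 : γ 0 = u := by simp [hγ]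
    have hγR : ∀ s, γ s ∈ range (𝓡∂ k) := fun s => by
      rw [range_modelWithCornersEuclideanHalfSpace]
      exact (hγ0 s).ge
    have h1 : HasDerivWithinAt (localRep F c ∘ γ) (V j) univ 0 := by
      rw [← hγ00] at hder
      have := hder.comp_hasDerivWithinAt (0:ℝ) (hγd.hasDerivWithinAt (s := univ))
        (fun s _ => hγR s)
      rw [hγ00] at this
      exact this
    rw [hasDerivWithinAt_univ] at h1
    have h2 : HasDerivAt (fun s => inner ℝ (localRep F c (γ s)) p) (inner ℝ (V j) p) 0 := by
      have := h1.inner ℝ (hasDerivAt_const (0:ℝ) p)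
      simpa using this
    have h3 : (fun s => inner ℝ (localRep F c (γ s)) p) =ᶠ[𝓝 0] fun _ => Real.cos R := by
      have hcont : Tendsto γ (𝓝 0) (𝓝[range (𝓡∂ k)] u) := by
        rw [tendsto_nhdsWithin_iff]
        refine ⟨?_, Eventually.of_forall hγR⟩
        have := hγd.continuousAt.tendsto
        rwa [hγ00] at this
      filter_upwards [hcont (extChartAt_target_mem_nhdsWithin_of_mem (I := 𝓡∂ k) hu)] with s hs
      exact hF.cos_eq_inner hp (mem_boundary hs (hγ0 s))
    exact h2.unique ((hasDerivAt_const (0:ℝ) (Real.cos R)).congr_of_eventuallyEq h3)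
  set ν := Real.cos R • F x - p with hν
  have hνT : ν ∈ Submodule.span ℝ (range V) := by
    rw [hV, hF.range_localDeriv hu]
    obtain ⟨v, hv⟩ := hF.orthogonal x hxb
    have hv' : diff k F x (show EuclideanSpace ℝ (Fin k) from v) = distGradient p (F x) := hv
    refine ⟨Real.sin R • (show EuclideanSpace ℝ (Fin k) from v), ?_⟩
    rw [ContinuousLinearMap.coe_coe, map_smul, hv', distGradient, (hF.boundary x hxb).2, smul_smul,
      mul_inv_cancel₀ hsin, one_smul]
  have hνV : ∀ j, j ≠ 0 → inner ℝ (V j) ν = 0 := fun j hj => by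
    rw [hν, inner_sub_right, inner_smul_right, hVF, hVp j hj]; simp
  have hνne : ν ≠ 0 := by
    intro h
    have h1 : inner ℝ ν p = 0 := by rw [h, inner_zero_left]
    rw [hν, inner_sub_left, inner_smul_left, hF.cos_eq_inner hp hxb,
      real_inner_self_eq_norm_sq, hp] at h1
    simp only [conj_trivial] at h1
    have := Real.sin_sq_add_cos_sq R
    exact hsin (pow_eq_zero_iff (two_ne_zero) |>.1 (by nlinarith))
  have hS := Real.sqrt_pos.2 (gram_det_pos hlin)
  have hq : ∀ i, inner ℝ (conormal V i) ν =
      (Real.sqrt (Matrix.gram ℝ V).det * inner ℝ (V 0) ν) * (Matrix.gram ℝ V)⁻¹ i 0 := by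
    intro i
    rw [conormal, inner_smul_left, sum_inner, Finset.sum_eq_single 0]
    · rw [inner_smul_left]; simp only [conj_trivial]; ring
    · intro j _ hj
      rw [inner_smul_left, hνV j hj, mul_zero]
    · simp
  have hsum := sum_inner_conormal_smul hlin ν
  rw [Submodule.starProjection_eq_self_iff.2 hνT] at hsum
  -- By the free boundary condition ν is tangent to the submanifold. It is orthogonal to all face
  -- directions, as is the conormal of index 0, so the two are proportional.
  have hcon : (inner ℝ (V 0) ν) • conormal V 0 = Real.sqrt (Matrix.gram ℝ V).det • ν := by
    rw [← hsum, conormal, smul_smul, Finset.smul_sum]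
    refine Finset.sum_congr rfl fun i _ => ?_
    rw [hq, smul_smul, gram_inv_comm V i 0]
    ring_nf
  have hq0 : inner ℝ (V 0) ν ≠ 0 := by
    intro h
    rw [h, zero_smul] at hcon
    exact (smul_ne_zero hS.ne' hνne) hcon.symm
  have hfin := congrArg (fun w => inner ℝ w z) hcon
  simp only [inner_smul_left, conj_trivial] at hfin
  have hz' : inner ℝ ν z = 0 := by rw [real_inner_comm]; exact hz
  rw [hz', mul_zero] at hfin
  exact (mul_eq_zero.1 hfin).resolve_left hq0

end IsFreeBoundaryMinimal


end

/-! ### The divergence theorem on a free boundary minimal submanifold. -/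

section

open Filter Topology Set

variable {k n : ℕ} [NeZero k] {M : Type*} [TopologicalSpace M]
  [ChartedSpace (EuclideanHalfSpace k) M] [IsManifold (𝓡∂ k) ∞ M]
  [MeasurableSpace M] [BorelSpace M] [CompactSpace M] [T2Space M]
  {F : M → Ambient n} {p : Ambient n} {R : ℝ}

omit [MeasurableSpace M] [BorelSpace M] in
theorem isCompact_image_tsupport {c : M} {η : M → ℝ}
    (hη : tsupport η ⊆ (extChartAt (𝓡∂ k) c).source) :
    IsCompact (extChartAt (𝓡∂ k) c '' tsupport η) :=
  (isClosed_tsupport η).isCompact.image_of_continuousOn ((continuousOn_extChartAt c).mono hη)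

omit [MeasurableSpace M] [BorelSpace M] [CompactSpace M] [T2Space M] [IsManifold (𝓡∂ k) ∞ M] in
theorem image_tsupport_subset {c : M} {η : M → ℝ}
    (hη : tsupport η ⊆ (extChartAt (𝓡∂ k) c).source) :
    extChartAt (𝓡∂ k) c '' tsupport η ⊆ (extChartAt (𝓡∂ k) c).target := by
  rintro _ ⟨x, hx, rfl⟩
  exact (extChartAt (𝓡∂ k) c).map_source (hη hx)

omit [MeasurableSpace M] [BorelSpace M] [CompactSpace M] [T2Space M] [IsManifold (𝓡∂ k) ∞ M] in
theorem symm_notMem_tsupport {c : M} {η : M → ℝ} {u : EuclideanSpace ℝ (Fin k)}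
    (hu : u ∈ (extChartAt (𝓡∂ k) c).target) (huK : u ∉ extChartAt (𝓡∂ k) c '' tsupport η) :
    (extChartAt (𝓡∂ k) c).symm u ∉ tsupport η := fun h =>
  huK ⟨_, h, (extChartAt (𝓡∂ k) c).right_inv hu⟩

namespace IsFreeBoundaryMinimal

theorem isFiniteMeasure (hF : IsFreeBoundaryMinimal (k := k) F p R) :
    IsFiniteMeasure (volumeMeasure k F) := by
  rw [volumeMeasure_eq_sum]
  refine ⟨?_⟩
  rw [Measure.finsetSum_apply]
  refine ENNReal.sum_lt_top.2 fun c _ => ?_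
  rw [withDensity_apply _ MeasurableSet.univ, setLIntegral_univ, hF.lintegral_chartMeasure c
    (chartPartition k M c).contMDiff.continuous.measurable.ennreal_ofReal]
  set K := extChartAt (𝓡∂ k) c '' tsupport (chartPartition k M c) with hK
  have hKc : IsCompact K := isCompact_image_tsupport (tsupport_chartPartition c)
  obtain ⟨C, hC⟩ := hKc.exists_bound_of_continuousOn
    ((hF.continuousOn_volumeDensity c).mono (image_tsupport_subset (tsupport_chartPartition c)))
  calc ∫⁻ u in (extChartAt (𝓡∂ k) c).target,
      ENNReal.ofReal (chartPartition k M c ((extChartAt (𝓡∂ k) c).symm u)) *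
        ENNReal.ofReal (volumeDensity F c u)
      ≤ ∫⁻ u in (extChartAt (𝓡∂ k) c).target, K.indicator (fun _ => ENNReal.ofReal C) u := by
        refine setLIntegral_mono' (measurableSet_target c) fun u hu => ?_
        by_cases huK : u ∈ K
        · rw [indicator_of_mem huK]
          calc _ ≤ 1 * ENNReal.ofReal C := by
                gcongr
                · rw [← ENNReal.ofReal_one]
                  exact ENNReal.ofReal_le_ofReal ((chartPartition k M).le_one c _)
                · exact (le_abs_self _).trans (hC u huK)
            _ = _ := one_mul _
        · rw [indicator_of_notMem huK,
            image_eq_zero_of_notMem_tsupport (symm_notMem_tsupport hu huK)]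
          simp
    _ ≤ ∫⁻ u, K.indicator (fun _ => ENNReal.ofReal C) u := setLIntegral_le_lintegral _ _
    _ = ENNReal.ofReal C * volume K := by
        rw [lintegral_indicator hKc.measurableSet, setLIntegral_const]
    _ < ⊤ := ENNReal.mul_lt_top ENNReal.ofReal_lt_top hKc.measure_lt_top

theorem setLIntegral_source (hF : IsFreeBoundaryMinimal (k := k) F p R) (c : M) {f : M → ℝ≥0∞}
    (hf : Measurable f) : ∫⁻ x in (extChartAt (𝓡∂ k) c).source, f x ∂(volumeMeasure k F) =
      ∫⁻ u in (extChartAt (𝓡∂ k) c).target,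
      f ((extChartAt (𝓡∂ k) c).symm u) * ENNReal.ofReal (volumeDensity F c u) := by
  rw [hF.volumeMeasure_restrict, hF.lintegral_chartMeasure c hf]

theorem integral_eq_chart (hF : IsFreeBoundaryMinimal (k := k) F p R) (c : M) {f : M → ℝ}
    (hf : Measurable f) (hs : ∀ x ∉ (extChartAt (𝓡∂ k) c).source, f x = 0) :
    ∫ x, f x ∂(volumeMeasure k F) = ∫ u in (extChartAt (𝓡∂ k) c).target,
      volumeDensity F c u * f ((extChartAt (𝓡∂ k) c).symm u) := by
  rw [← setIntegral_eq_integral_of_forall_compl_eq_zero hs, hF.volumeMeasure_restrict,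
    chartMeasure, integral_map (aemeasurable_symm_withDensity F c) hf.aestronglyMeasurable,
    integral_withDensity_eq_integral_toReal_smul₀ (hF.aemeasurable_density c)
      (Eventually.of_forall fun _ => ENNReal.ofReal_lt_top)]
  refine setIntegral_congr_fun (measurableSet_target c) fun u hu => ?_
  simp only [ENNReal.toReal_ofReal (hF.volumeDensity_pos hu).le, smul_eq_mul]

/-- Every nonempty relatively open subset of the half-space contains a nonempty open set of ℝᵏ, on
which the density is positive. This upgrades almost everywhere identities of continuous functions to
identities on all of M, boundary included. -/
theorem isOpenPosMeasure (hF : IsFreeBoundaryMinimal (k := k) F p R) :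
    (volumeMeasure k F).IsOpenPosMeasure := by
  refine ⟨fun U hU ⟨x, hx⟩ h0 => ?_⟩
  have h1 : chartMeasure (k := k) F x U = 0 := by
    rw [← hF.volumeMeasure_restrict]
    exact le_antisymm ((Measure.restrict_apply_le _ _).trans h0.le) bot_le
  rw [hF.chartMeasure_apply x hU.measurableSet] at h1
  set s := (extChartAt (𝓡∂ k) x).target ∩ (extChartAt (𝓡∂ k) x).symm ⁻¹' U with hs
  have hsm : MeasurableSet s := measurableSet_target_inter_preimage x hU.measurableSet
  have h2 : volume s = 0 := by
    rw [lintegral_eq_zero_iff' ((hF.aemeasurable_density x).mono_measure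
      (Measure.restrict_mono inter_subset_left le_rfl))] at h1
    have h3 : ∀ᵐ u ∂(volume.restrict s), False := by
      filter_upwards [h1, ae_restrict_mem hsm] with u hu hus
      exact (ENNReal.ofReal_pos.2 (hF.volumeDensity_pos hus.1)).ne' hu
    rw [eventually_false_iff_eq_bot, ae_eq_bot, Measure.restrict_eq_zero] at h3
    exact h3
  set u₀ := extChartAt (𝓡∂ k) x x with hu₀
  have hu₀t : u₀ ∈ (extChartAt (𝓡∂ k) x).target := mem_extChartAt_target x
  have hnhds : s ∈ 𝓝[range (𝓡∂ k)] u₀ := by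
    refine inter_mem (extChartAt_target_mem_nhdsWithin x) ?_
    have hc : ContinuousAt (extChartAt (𝓡∂ k) x).symm u₀ := continuousAt_extChartAt_symm'' hu₀t
    refine hc.continuousWithinAt (hU.mem_nhds ?_)
    rwa [hu₀, extChartAt_to_inv]
  obtain ⟨O, hO, huO, hOs⟩ := mem_nhdsWithin.1 hnhds
  have hcl : u₀ ∈ closure (interior (range (𝓡∂ k))) := by
    rw [interior_range_modelWithCornersEuclideanHalfSpace, closure_open_halfSpace]
    exact target_nonneg hu₀t
  obtain ⟨v, hvO, hvI⟩ := mem_closure_iff.1 hcl O hO huO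
  have hne : (O ∩ interior (range (𝓡∂ k))).Nonempty := ⟨v, hvO, hvI⟩
  have hpos := (hO.inter isOpen_interior).measure_pos (volume : Measure (EuclideanSpace ℝ (Fin k)))
    hne
  exact (hpos.trans_le (measure_mono (t := s) fun w hw => hOs ⟨hw.1, interior_subset hw.2⟩)).ne' h2

section Divergence

variable {ι : Type*} [Fintype ι]

/-- The divergence theorem for a tangential field, localised in a chart by a cut-off. -/
theorem integral_cutoff_divergence (hF : IsFreeBoundaryMinimal (k := k) F p R) (hp : ‖p‖ = 1)
    (hR0 : 0 < R) (hR : R ≤ Real.pi / 2) {φ : ι → Ambient n → ℝ} {φ' : ι → M → Ambient n →L[ℝ] ℝ}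
    (z : ι → Ambient n) (hφ : ∀ a x, HasFDerivAt (φ a) (φ' a x) (F x))
    (hφ' : ∀ a, Continuous (φ' a))
    (hbd : ∀ x ∈ (𝓡∂ k).boundary M, inner ℝ (∑ a, φ a (F x) • z a) (Real.cos R • F x - p) = 0)
    {c : M} {η : M → ℝ} (hη : ContMDiff (𝓡∂ k) 𝓘(ℝ, ℝ) ∞ η)
    (hηc : tsupport η ⊆ (extChartAt (𝓡∂ k) c).source) :
    Continuous (fun x => η x * ∑ a, (φ' a x (tangentProj k F x (z a)) -
        k * (φ a (F x) * inner ℝ (z a) (F x))) +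
      ∑ a, φ a (F x) * diff k η x (tangentLift k F x (z a))) ∧
    ∫ x, (η x * ∑ a, (φ' a x (tangentProj k F x (z a)) -
        k * (φ a (F x) * inner ℝ (z a) (F x))) +
      ∑ a, φ a (F x) * diff k η x (tangentLift k F x (z a))) ∂(volumeMeasure k F) = 0 := by
  have hFc : Continuous F := hF.smooth.continuous
  have hφc : ∀ a, Continuous fun x => φ a (F x) := fun a =>
    continuous_iff_continuousAt.2 fun x =>
      ContinuousAt.comp (g := φ a) (hφ a x).continuousAt hFc.continuousAt
  have hlift : ∀ a, Continuous fun x => diff k η x (tangentLift k F x (z a)) := by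
    intro a
    refine continuous_of_comp_symm (k := k) fun c => ?_
    have h : ContinuousOn (fun u => (volumeDensity F c u)⁻¹ *
        ∑ i, inner ℝ (conormal (coordFrame (localDeriv F c u)) i) (z a) *
        fderivWithin ℝ (η ∘ (extChartAt (𝓡∂ k) c).symm) (range (𝓡∂ k)) u
          (EuclideanSpace.single i 1)) (extChartAt (𝓡∂ k) c).target := by
      refine ((hF.continuousOn_volumeDensity c).inv₀ fun u hu =>
        (hF.volumeDensity_pos hu).ne').mul ?_
      refine continuousOn_finsetSum _ fun i _ => ?_
      refine ((hF.continuousOn_conormal c i).inner (𝕜 := ℝ) continuousOn_const).mul ?_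
      exact (continuousOn_fderivWithin_comp_symm hη c).clm_apply continuousOn_const
    refine h.congr fun u hu => ?_
    simp only [← hF.volumeDensity_mul_diff_tangentLift hu hη, ← mul_assoc,
      inv_mul_cancel₀ (hF.volumeDensity_pos hu).ne', one_mul, Function.comp_apply]
  set f : M → ℝ := fun x => η x * ∑ a, (φ' a x (tangentProj k F x (z a)) -
        k * (φ a (F x) * inner ℝ (z a) (F x))) +
      ∑ a, φ a (F x) * diff k η x (tangentLift k F x (z a)) with hf
  have hfc : Continuous f := by
    refine (hη.continuous.mul (continuous_finsetSum _ fun a _ => ?_)).add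
      (continuous_finsetSum _ fun a _ => (hφc a).mul (hlift a))
    exact ((hφ' a).clm_apply (hF.continuous_tangentProj _)).sub
      (continuous_const.mul ((hφc a).mul (continuous_const.inner hFc)))
  refine ⟨hfc, ?_⟩
  have hdη : ∀ x ∉ tsupport η, diff k η x = 0 := by
    intro x hx
    have h1 : η =ᶠ[𝓝 x] fun _ => (0:ℝ) := notMem_tsupport_iff_eventuallyEq.1 hx
    exact (h1.mfderiv_eq (I := 𝓡∂ k) (I' := 𝓘(ℝ, ℝ))).trans mfderiv_const
  have hf0 : ∀ x ∉ tsupport η, f x = 0 := by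
    intro x hx
    simp only [hf, image_eq_zero_of_notMem_tsupport hx, hdη x hx]
    simp
  rw [hF.integral_eq_chart c hfc.measurable fun x hx => hf0 x fun h => hx (hηc h)]
  set K := extChartAt (𝓡∂ k) c '' tsupport η with hK
  have hKc : IsCompact K := isCompact_image_tsupport hηc
  have hKt : K ⊆ (extChartAt (𝓡∂ k) c).target := image_tsupport_subset hηc
  set Y : Fin k → EuclideanSpace ℝ (Fin k) → Ambient n :=
    fun i u => conormal (coordFrame (localDeriv F c u)) i with hY
  set ηh : EuclideanSpace ℝ (Fin k) → ℝ := η ∘ (extChartAt (𝓡∂ k) c).symm with hηh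
  set W : Ambient n → Ambient n := fun q => ∑ a, φ a q • z a with hW
  -- √g times the divergence of the tangential part of ηW is the coordinate divergence of these
  -- components.
  set g : Fin k → EuclideanSpace ℝ (Fin k) → ℝ := fun i u =>
    ηh u * inner ℝ (W (localRep F c u)) (Y i u) with hg
  -- Extension by zero beyond the chart; inside the chart nothing changes, since η vanishes off its
  -- support.
  set G : Fin k → EuclideanSpace ℝ (Fin k) → ℝ := fun i => K.indicator (g i) with hG
  have hGg : ∀ i, ∀ u ∈ (extChartAt (𝓡∂ k) c).target, G i u = g i u := by
    intro i u hu
    by_cases huK : u ∈ K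
    · simp only [hG, indicator_of_mem huK]
    · simp only [hG, indicator_of_notMem huK, hg, hηh, Function.comp_apply,
        image_eq_zero_of_notMem_tsupport (symm_notMem_tsupport hu huK), zero_mul]
  set G' : Fin k → EuclideanSpace ℝ (Fin k) → EuclideanSpace ℝ (Fin k) →L[ℝ] ℝ :=
    fun i => K.indicator fun u => fderiv ℝ (g i) u with hG'
  have hηd : ∀ u ∈ (extChartAt (𝓡∂ k) c).target, 0 < u 0 → HasFDerivAt ηh
      (fderivWithin ℝ ηh (range (𝓡∂ k)) u) u := by
    intro u hu h0
    rw [fderivWithin_of_mem_nhds (range_mem_nhds h0)]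
    exact (((contDiffOn_comp_symm hη c).contDiffAt
      (target_mem_nhds hu h0)).differentiableAt (by simp)).hasFDerivAt
  have hWd : ∀ u ∈ (extChartAt (𝓡∂ k) c).target, 0 < u 0 →
      HasFDerivAt (fun v => W (localRep F c v))
      ((∑ a, (φ' a ((extChartAt (𝓡∂ k) c).symm u)).smulRight (z a)).comp (localDeriv F c u)) u := by
    intro u hu h0
    have h1 : HasFDerivAt (localRep F c) (localDeriv F c u) u := by
      rw [(localDeriv_eventuallyEq (F := F) (c := c) h0).self_of_nhds]
      exact ((hF.contDiffAt_localRep hu h0).differentiableAt (by simp)).hasFDerivAt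
    have h2 : HasFDerivAt W (∑ a, (φ' a ((extChartAt (𝓡∂ k) c).symm u)).smulRight (z a))
        (localRep F c u) :=
      HasFDerivAt.fun_sum fun a _ => (hφ a _).smul_const (z a)
    exact h2.comp u h1
  have hYd : ∀ u ∈ (extChartAt (𝓡∂ k) c).target, 0 < u 0 → ∀ i, HasFDerivAt (Y i)
      (fderiv ℝ (Y i) u) u := fun u hu h0 i =>
    (hF.differentiableAt_conormal hu h0 i).hasFDerivAt
  have hgd : ∀ u ∈ (extChartAt (𝓡∂ k) c).target, 0 < u 0 → ∀ i, HasFDerivAt (g i)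
      (fderiv ℝ (g i) u) u := fun u hu h0 i =>
    (((hηd u hu h0).mul ((hWd u hu h0).inner ℝ (hYd u hu h0 i))).differentiableAt).hasFDerivAt
  have hgval : ∀ u ∈ (extChartAt (𝓡∂ k) c).target, 0 < u 0 →
      ∑ i, fderiv ℝ (g i) u (EuclideanSpace.single i 1) =
        volumeDensity F c u * f ((extChartAt (𝓡∂ k) c).symm u) := by
    intro u hu h0
    set x := (extChartAt (𝓡∂ k) c).symm u with hx
    have h1 : ∀ i, fderiv ℝ (g i) u (EuclideanSpace.single i 1) =
        η x * (inner ℝ (W (F x)) (fderiv ℝ (Y i) u (EuclideanSpace.single i 1)) +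
          ∑ a, φ' a x (coordFrame (localDeriv F c u) i) * inner ℝ (z a) (Y i u)) +
        inner ℝ (W (F x)) (Y i u) *
          fderivWithin ℝ ηh (range (𝓡∂ k)) u (EuclideanSpace.single i 1) := by
      intro i
      have h : HasFDerivAt (g i) _ u :=
        (hηd u hu h0).mul ((hWd u hu h0).inner ℝ (hYd u hu h0 i))
      rw [h.fderiv]
      simp only [ContinuousLinearMap.comp_apply, ContinuousLinearMap.prod_apply,
        fderivInnerCLM_apply, add_apply, smul_apply, smul_eq_mul, sum_apply,
        ContinuousLinearMap.smulRight_apply, sum_inner, inner_smul_left, conj_trivial]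
      rfl
    simp only [h1, Finset.sum_add_distrib]
    rw [← Finset.mul_sum, Finset.sum_add_distrib, ← inner_sum, hF.sum_fderiv_conormal hu h0]
    have h2 : ∑ i, ∑ a, φ' a x (coordFrame (localDeriv F c u) i) * inner ℝ (z a) (Y i u) =
        volumeDensity F c u * ∑ a, φ' a x (tangentProj k F x (z a)) := by
      rw [Finset.sum_comm, Finset.mul_sum]
      refine Finset.sum_congr rfl fun a _ => ?_
      rw [← smul_eq_mul, ← map_smul, hF.volumeDensity_smul_tangentProj hu, map_sum]
      refine Finset.sum_congr rfl fun i _ => ?_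
      rw [map_smul, smul_eq_mul, real_inner_comm, mul_comm]
    have h3 : ∑ i, inner ℝ (W (F x)) (Y i u) *
          fderivWithin ℝ ηh (range (𝓡∂ k)) u (EuclideanSpace.single i 1) =
        volumeDensity F c u * ∑ a, φ a (F x) * diff k η x (tangentLift k F x (z a)) := by
      rw [Finset.mul_sum]
      have h4 : ∀ a, volumeDensity F c u * (φ a (F x) * diff k η x (tangentLift k F x (z a))) =
          φ a (F x) * ∑ i, inner ℝ (Y i u) (z a) *
            fderivWithin ℝ ηh (range (𝓡∂ k)) u (EuclideanSpace.single i 1) := by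
        intro a
        rw [← hF.volumeDensity_mul_diff_tangentLift hu hη]
        ring
      simp only [h4, Finset.mul_sum]
      rw [Finset.sum_comm]
      refine Finset.sum_congr rfl fun i _ => ?_
      rw [hW, sum_inner, Finset.sum_mul]
      refine Finset.sum_congr rfl fun a _ => ?_
      rw [inner_smul_left, real_inner_comm]
      simp only [conj_trivial]
      ring
    rw [h2, h3]
    have h5 : inner ℝ (W (F x)) (-(k * volumeDensity F c u) • localRep F c u) =
        -(volumeDensity F c u * ∑ a, k * (φ a (F x) * inner ℝ (z a) (F x))) := by
      rw [inner_smul_right, hW, sum_inner, ← Finset.mul_sum]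
      simp only [inner_smul_left, conj_trivial]
      change -(k * volumeDensity F c u) * ∑ a, φ a (F x) * inner ℝ (z a) (F x) = _
      ring
    rw [h5]
    simp only [hf, Finset.sum_sub_distrib]
    ring
  have hGK : ∀ i, ∀ u ∉ K, G i u = 0 := fun i u hu => indicator_of_notMem hu _
  have hGK' : ∀ i, ∀ u ∉ K, G' i u = 0 := fun i u hu => indicator_of_notMem hu _
  have hH : {u : EuclideanSpace ℝ (Fin k) | 0 ≤ u 0} = range (𝓡∂ k) :=
    (range_modelWithCornersEuclideanHalfSpace k).symm
  have hHm : MeasurableSet {u : EuclideanSpace ℝ (Fin k) | 0 ≤ u 0} :=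
    hH ▸ (𝓡∂ k).isClosed_range.measurableSet
  have hdens : ∀ u ∈ (extChartAt (𝓡∂ k) c).target, u ∉ K →
      volumeDensity F c u * f ((extChartAt (𝓡∂ k) c).symm u) = 0 := fun u hu huK => by
    rw [hf0 _ (symm_notMem_tsupport hu huK), mul_zero]
  have hae : (fun u => ∑ i, G' i u (EuclideanSpace.single i 1))
      =ᵐ[volume.restrict {u : EuclideanSpace ℝ (Fin k) | 0 ≤ u 0}]
      K.indicator fun u => volumeDensity F c u * f ((extChartAt (𝓡∂ k) c).symm u) := by
    have h1 : ∀ᵐ u ∂(volume : Measure (EuclideanSpace ℝ (Fin k))), u 0 ≠ 0 :=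
      compl_mem_ae_iff.2 volume_hyperplane
    filter_upwards [ae_restrict_of_ae h1, ae_restrict_mem hHm] with u hu0 hu
    by_cases huK : u ∈ K
    · have h0 : 0 < u 0 := lt_of_le_of_ne hu (Ne.symm hu0)
      rw [indicator_of_mem huK, ← hgval u (hKt huK) h0]
      simp only [hG', indicator_of_mem huK]
    · rw [indicator_of_notMem huK]
      simp [hGK' _ u huK]
  have hcontD : ContinuousOn (fun u => volumeDensity F c u * f ((extChartAt (𝓡∂ k) c).symm u)) K :=
    ((hF.continuousOn_volumeDensity c).mul
      (hfc.comp_continuousOn (continuousOn_extChartAt_symm c))).mono hKt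
  have hintD : Integrable (K.indicator fun u =>
      volumeDensity F c u * f ((extChartAt (𝓡∂ k) c).symm u)) :=
    (hcontD.integrableOn_compact hKc).integrable_indicator hKc.measurableSet
  have hmain := integral_divergence_halfSpace (f := G) (f' := G') hKc
    (by
      intro i u hu
      rw [hH]
      by_cases huK : u ∈ K
      · have hut := hKt huK
        have h1 : ContinuousWithinAt (g i) (extChartAt (𝓡∂ k) c).target u := by
          have hWc : ContinuousWithinAt (fun v => W (localRep F c v))
              (extChartAt (𝓡∂ k) c).target u := by
            have : Continuous fun x => W (F x) :=
              continuous_finsetSum _ fun a _ => (hφc a).smul continuous_const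
            exact this.continuousAt.comp_continuousWithinAt (continuousOn_extChartAt_symm c u hut)
          have hηc' : ContinuousWithinAt ηh (extChartAt (𝓡∂ k) c).target u :=
            (contDiffOn_comp_symm hη c).continuousOn u hut
          exact hηc'.mul (hWc.inner (𝕜 := ℝ) (hF.continuousOn_conormal c i u hut))
        have h2 : ContinuousWithinAt (G i) (extChartAt (𝓡∂ k) c).target u :=
          h1.congr (fun v hv => hGg i v hv) (hGg i u hut)
        exact h2.mono_of_mem_nhdsWithin (extChartAt_target_mem_nhdsWithin_of_mem hut)
      · have : G i =ᶠ[𝓝 u] fun _ => (0:ℝ) := by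
          filter_upwards [hKc.isClosed.isOpen_compl.mem_nhds huK] with v hv using hGK i v hv
        exact (continuousAt_const.congr this.symm).continuousWithinAt)
    (by
      intro i u h0
      by_cases huK : u ∈ K
      · have hut := hKt huK
        have h1 : G i =ᶠ[𝓝 u] g i := by
          filter_upwards [target_mem_nhds hut h0] with v hv using hGg i v hv
        simp only [hG', indicator_of_mem huK]
        exact (hgd u hut h0 i).congr_of_eventuallyEq h1
      · have : G i =ᶠ[𝓝 u] fun _ => (0:ℝ) := by
          filter_upwards [hKc.isClosed.isOpen_compl.mem_nhds huK] with v hv using hGK i v hv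
        rw [hGK' i u huK]
        exact (hasFDerivAt_const (0:ℝ) u).congr_of_eventuallyEq this)
    hGK hGK'
    (by
      intro u h0
      by_cases huK : u ∈ K
      · have hut := hKt huK
        rw [hGg 0 u hut]
        simp only [hg]
        have h := hF.inner_conormal_boundary hp hR0 hR hut h0 (hbd _ (mem_boundary hut h0))
        rw [real_inner_comm]
        exact mul_eq_zero_of_right _ h
      · exact hGK 0 u huK)
    ((hintD.integrableOn).congr_fun_ae hae.symm)
  rw [integral_congr_ae hae, setIntegral_indicator hKc.measurableSet] at hmain
  rw [setIntegral_eq_of_subset_of_forall_sdiff_eq_zero (measurableSet_target c) hKt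
    fun u hu => hdens u hu.1 hu.2, ← hmain]
  congr 2
  rw [inter_eq_right.2]
  exact fun u hu => target_nonneg (hKt hu)

/-- The divergence theorem for the tangential part of an ambient vector field, on a minimal
submanifold of the sphere, when the field is tangent to the geodesic sphere along the boundary. -/
theorem integral_divergence (hF : IsFreeBoundaryMinimal (k := k) F p R) (hp : ‖p‖ = 1)
    (hR0 : 0 < R) (hR : R ≤ Real.pi / 2) {φ : ι → Ambient n → ℝ} {φ' : ι → M → Ambient n →L[ℝ] ℝ}
    (z : ι → Ambient n) (hφ : ∀ a x, HasFDerivAt (φ a) (φ' a x) (F x))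
    (hφ' : ∀ a, Continuous (φ' a))
    (hbd : ∀ x ∈ (𝓡∂ k).boundary M, inner ℝ (∑ a, φ a (F x) • z a) (Real.cos R • F x - p) = 0) :
    ∫ x, ∑ a, (φ' a x (tangentProj k F x (z a)) - k * (φ a (F x) * inner ℝ (z a) (F x)))
      ∂(volumeMeasure k F) = 0 := by
  have := hF.isFiniteMeasure
  set D : M → ℝ := fun x => ∑ a, (φ' a x (tangentProj k F x (z a)) -
    k * (φ a (F x) * inner ℝ (z a) (F x))) with hD
  have hcut := fun c => hF.integral_cutoff_divergence hp hR0 hR z hφ hφ' hbd (c := c)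
    (chartPartition k M c).contMDiff (tsupport_chartPartition c)
  have hsum := Finset.sum_eq_zero (s := activeCharts k M) fun c _ => (hcut c).2
  rw [← integral_finsetSum _ fun c _ =>
    (hcut c).1.integrable_of_hasCompactSupport (HasCompactSupport.of_compactSpace _)] at hsum
  rw [← hsum]
  refine integral_congr_ae (Eventually.of_forall fun x => ?_)
  -- The weights sum to the constant 1, so their differentials sum to zero and the cut-off terms
  -- cancel.
  have hds : ∑ c ∈ activeCharts k M, diff k (chartPartition k M c) x = 0 := by
    have h1 : ∀ t : Finset M, MDifferentiableAt (𝓡∂ k) 𝓘(ℝ, ℝ)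
          (∑ c ∈ t, (chartPartition k M c : M → ℝ)) x ∧
        diff k (∑ c ∈ t, (chartPartition k M c : M → ℝ)) x =
          ∑ c ∈ t, diff k (chartPartition k M c) x := by
      intro t
      classical
      induction t using Finset.induction_on with
      | empty => exact ⟨mdifferentiableAt_const, mfderiv_const⟩
      | insert c t hc ih =>
        have hd := (chartPartition k M c).contMDiff.mdifferentiable (by simp) x
        rw [Finset.sum_insert hc, Finset.sum_insert hc, ← ih.2]
        exact ⟨hd.add ih.1, mfderiv_add hd ih.1⟩
    have h2 : (∑ c ∈ activeCharts k M, (chartPartition k M c : M → ℝ)) = fun _ => 1 := by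
      funext y
      rw [Finset.sum_apply, sum_chartPartition]
    rw [← (h1 _).2, h2]
    exact mfderiv_const
  simp only [Finset.sum_add_distrib]
  rw [← Finset.sum_mul, sum_chartPartition, one_mul, Finset.sum_comm]
  have h3 : ∀ a, ∑ c ∈ activeCharts k M, φ a (F x) *
      diff k (chartPartition k M c) x (tangentLift k F x (z a)) = 0 := by
    intro a
    rw [← Finset.mul_sum, ← sum_apply, hds]
    simp
  simp [h3]

end Divergence

end IsFreeBoundaryMinimal


end

/-! ### Calibrations, and the explicit one in dimension four. -/

section

theorem hasFDerivAt_of_partial {f : ℝ → ℝ → ℝ} {w x fw fx : ℝ}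
    (hd : DifferentiableAt ℝ (fun q : ℝ × ℝ => f q.1 q.2) (w, x))
    (hw : HasDerivAt (fun s => f s x) fw w) (hx : HasDerivAt (fun s => f w s) fx x) :
    HasFDerivAt (fun q : ℝ × ℝ => f q.1 q.2)
      (fw • ContinuousLinearMap.fst ℝ ℝ ℝ + fx • ContinuousLinearMap.snd ℝ ℝ ℝ) (w, x) := by
  convert hd.hasFDerivAt using 1
  have h1 : HasDerivAt (fun s => f s x) (fderiv ℝ (fun q : ℝ × ℝ => f q.1 q.2) (w, x) (1, 0)) w :=
    hd.hasFDerivAt.comp_hasDerivAt (f := fun s => (s, x)) w ((hasDerivAt_id w).prodMk (hasDerivAt_const w x))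
  have h2 : HasDerivAt (fun s => f w s) (fderiv ℝ (fun q : ℝ × ℝ => f q.1 q.2) (w, x) (0, 1)) x :=
    hd.hasFDerivAt.comp_hasDerivAt (f := fun s => (w, s)) x ((hasDerivAt_const x w).prodMk (hasDerivAt_id x))
  ext <;> simp [hw.unique h1, hx.unique h2]

/-- The region of values of `(1 - ⟪q, y⟫, ⟪q, p⟫)` for `q` in a geodesic ball of radius `arccos a`
about `p` and `y` on its boundary. -/
def region (a : ℝ) : Set (ℝ × ℝ) := {q | 0 ≤ q.1 ∧ q.1 ≤ 2 * (1 - a ^ 2) ∧ a ≤ q.2 ∧ q.2 ≤ 1}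

/-- The coefficients `A / w ^ κ` and `B / w ^ κ` of a vector field `A y + B p` in the ball, as
functions of `w = 1 - ⟪q, y⟫` and `x = ⟪q, p⟫`, whose divergence along any minimal submanifold of
dimension `2 κ` is at most `D`. The numbers `Y`, `Z` and `P` stand for the inner products of the
normal parts of `y` and `p`. -/
structure IsCalibration (κ : ℕ) (a D : ℝ) (A B Aw Ax Bw Bx : ℝ → ℝ → ℝ) : Prop where
  hasFDerivAt_left : ∀ w x, 0 ≤ x → HasFDerivAt (fun q : ℝ × ℝ => A q.1 q.2)
    (Aw w x • ContinuousLinearMap.fst ℝ ℝ ℝ + Ax w x • ContinuousLinearMap.snd ℝ ℝ ℝ) (w, x)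
  hasFDerivAt_right : ∀ w x, 0 ≤ x → HasFDerivAt (fun q : ℝ × ℝ => B q.1 q.2)
    (Bw w x • ContinuousLinearMap.fst ℝ ℝ ℝ + Bx w x • ContinuousLinearMap.snd ℝ ℝ ℝ) (w, x)
  continuousOn_Aw : ContinuousOn (fun q : ℝ × ℝ => Aw q.1 q.2) {q | 0 ≤ q.2}
  continuousOn_Ax : ContinuousOn (fun q : ℝ × ℝ => Ax q.1 q.2) {q | 0 ≤ q.2}
  continuousOn_Bw : ContinuousOn (fun q : ℝ × ℝ => Bw q.1 q.2) {q | 0 ≤ q.2}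
  continuousOn_Bx : ContinuousOn (fun q : ℝ × ℝ => Bx q.1 q.2) {q | 0 ≤ q.2}
  -- Tangency to the geodesic sphere: where ⟨q, p⟩ = a, one has ⟨A y + B p, a q − p⟩ = −(a w A + (1
  -- − a²) B).
  boundary : ∀ w, B w a = -(a / (1 - a ^ 2) * w * A w a)
  -- The left side is w^(κ+1) times the divergence in the absence of normal parts, when |yᵀ|² = 1 −
  -- (1 − w)², ⟨yᵀ, pᵀ⟩ = a − (1 − w) x and |pᵀ|² = 1 − x². Restoring Y, Z and P subtracts the form
  -- below.
  divergence : ∀ w x, 0 ≤ x →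
    w * (-Aw w x * (1 - (1 - w) ^ 2) + (Ax w x - Bw w x) * (a - (1 - w) * x) +
      Bx w x * (1 - x ^ 2) - 2 * κ * (A w x * (1 - w) + B w x * x)) +
      κ * (A w x * (1 - (1 - w) ^ 2) + B w x * (a - (1 - w) * x)) = w ^ (κ + 1) * D
  form_nonneg : ∀ w x, (w, x) ∈ region a → ∀ Y Z P, 0 ≤ Y → 0 ≤ P → Z ^ 2 ≤ Y * P →
    0 ≤ (κ * A w x - w * Aw w x) * Y + (κ * B w x + w * (Ax w x - Bw w x)) * Z +
      w * Bx w x * P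
  -- For a = 0 nothing is asked of P: the fields constructed below then have B = 0, and their form
  -- does not involve P.
  form_eq_zero : ∀ w x, (w, x) ∈ region a → 0 < w → ∀ Y Z P, 0 ≤ Y → 0 ≤ P → Z ^ 2 ≤ Y * P →
    (κ * A w x - w * Aw w x) * Y + (κ * B w x + w * (Ax w x - Bw w x)) * Z +
      w * Bx w x * P = 0 → Y = 0 ∧ (a ≠ 0 → P = 0)
  one_le : ∀ w x, (w, x) ∈ region a → 1 ≤ A w x
  left_zero : A 0 a = 1
  right_le : ∃ C, 0 ≤ C ∧ ∀ w x, (w, x) ∈ region a → |B w x| ≤ C * w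

/-- (βZ)² ≤ 4 (αY)(γP) ≤ (αY + γP)² by the arithmetic-geometric inequality. -/
theorem form_nonneg_of_discrim {α β γ : ℝ} (hα : 0 < α) (hγ : 0 ≤ γ) (h : β ^ 2 ≤ 4 * α * γ)
    {Y Z P : ℝ} (hY : 0 ≤ Y) (hP : 0 ≤ P) (hZ : Z ^ 2 ≤ Y * P) : 0 ≤ α * Y + β * Z + γ * P := by
  have h1 : (β * Z) ^ 2 ≤ (α * Y + γ * P) ^ 2 := by
    have h2 : (β * Z) ^ 2 ≤ (4 * α * γ) * (Y * P) := by
      rw [mul_pow]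
      exact mul_le_mul h hZ (sq_nonneg _) (by positivity)
    nlinarith [sq_nonneg (α * Y - γ * P)]
  have h3 := abs_le_of_sq_le_sq' h1 (by positivity)
  linarith [h3.1]

/-- If YP were positive, the strict discriminant bound would make the form positive. So YP = 0,
hence Z = 0, and two nonnegative terms sum to zero. -/
theorem form_eq_zero_of_discrim {α β γ : ℝ} (hα : 0 < α) (hγ : 0 < γ) (h : β ^ 2 < 4 * α * γ)
    {Y Z P : ℝ} (hY : 0 ≤ Y) (hP : 0 ≤ P) (hZ : Z ^ 2 ≤ Y * P) (h0 : α * Y + β * Z + γ * P = 0) :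
    Y = 0 ∧ P = 0 := by
  have hYP : Y * P = 0 := by
    have h1 : (β * Z) ^ 2 = (α * Y + γ * P) ^ 2 := by
      rw [show β * Z = -(α * Y + γ * P) by linarith]; ring
    have h2 : (β * Z) ^ 2 ≤ β ^ 2 * (Y * P) := by
      rw [mul_pow]
      exact mul_le_mul_of_nonneg_left hZ (sq_nonneg _)
    have h3 : 0 ≤ Y * P := mul_nonneg hY hP
    by_contra hne
    have h4 : 0 < Y * P := lt_of_le_of_ne h3 (Ne.symm hne)
    nlinarith [sq_nonneg (α * Y - γ * P), mul_pos (sub_pos.2 h) h4]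
  have hZ0 : Z = 0 := by
    rw [hYP] at hZ
    exact pow_eq_zero_iff (two_ne_zero) |>.1 (le_antisymm hZ (sq_nonneg _))
  rw [hZ0] at h0
  have h5 : 0 ≤ α * Y := by positivity
  have h6 : 0 ≤ γ * P := by positivity
  constructor
  · exact (mul_eq_zero.1 (show α * Y = 0 by linarith)).resolve_left hα.ne'
  · exact (mul_eq_zero.1 (show γ * P = 0 by linarith)).resolve_left hγ.ne'

theorem one_sub_sq_pos {a : ℝ} (ha : 0 ≤ a) (ha1 : a < 1) : 0 < 1 - a ^ 2 := by nlinarith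

theorem exists_bound_of_continuousOn {a : ℝ} (ha : 0 ≤ a) {b : ℝ → ℝ → ℝ}
    (hb : ContinuousOn (fun q : ℝ × ℝ => b q.1 q.2) {q | 0 ≤ q.2}) :
    ∃ C, 0 ≤ C ∧ ∀ w x, (w, x) ∈ region a → |b w x| ≤ C := by
  obtain ⟨C, hC⟩ := (isCompact_Icc.prod isCompact_Icc :
    IsCompact (Set.Icc (0 : ℝ) (2 * (1 - a ^ 2)) ×ˢ Set.Icc a 1)).exists_bound_of_continuousOn
    (hb.mono fun q hq => ha.trans hq.2.1)
  refine ⟨max C 0, le_max_right _ _, fun w x h => (hC (w, x) ?_).trans (le_max_left _ _)⟩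
  exact ⟨⟨h.1, h.2.1⟩, h.2.2⟩

/-- A and B/w are affine in w with coefficients depending on x, and the divergence identity is
solved power by power of w. The top coefficient b of B enters the highest power through (1 − x²) b′
− 4x b. The weight h = (2 + x)/(3(1 + x)²) is (1 − x²)⁻² ∫ₓ¹ (1 − s²) ds, a solution of (1 − x²) h′
− 4x h = −1 that is regular at x = 1. The multiple E of it is dictated by the boundary condition at
x = a, and the divergence constant is 3 + E. -/
theorem exists_calibration_two {a : ℝ} (ha : 0 ≤ a) (ha1 : a < 1) :
    ∃ A B Aw Ax Bw Bx, IsCalibration 2 a (6 / ((1 - a) ^ 2 * (2 + a))) A B Aw Ax Bw Bx := by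
  have hb := one_sub_sq_pos ha ha1
  have h1a : (1 - a) ≠ 0 := by linarith
  have h2a : (2 + a) ≠ 0 := by linarith
  obtain ⟨c, hc⟩ : ∃ c, c = a / (1 - a ^ 2) := ⟨_, rfl⟩
  obtain ⟨E, hE⟩ : ∃ E, E = c * (3 + 2 * c * a) * (3 * (1 + a) ^ 2) / (2 + a) := ⟨_, rfl⟩
  have hc0 : 0 ≤ c := by rw [hc]; positivity
  have hE0 : 0 ≤ E := by rw [hE]; positivity
  have hbd : ∀ x : ℝ, 0 ≤ x → 1 + x ≠ 0 := fun x hx => by positivity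
  have hcoef : ∀ w x, 0 < w → (w, x) ∈ region a → c ≠ 0 →
      (2 * c * w ^ 2) ^ 2 < 4 * (2 * (1 + c * (x - a)) + (1 + 2 * c * x) * w) *
        (w ^ 3 * (E * (3 + x) / (3 * (1 + x) ^ 3))) := by
    rintro w x hw ⟨-, -, hx, hx1⟩ hcne
    simp only at hx hx1
    have hcp : 0 < c := lt_of_le_of_ne hc0 (Ne.symm hcne)
    have hx0 : 0 ≤ x := ha.trans hx
    have hEp : 0 < E := by rw [hE]; positivity
    -- The weight −h′ = (3 + x)/(3(1 + x)³) is decreasing on [0, 1] and equals 1/6 at x = 1.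
    have h1 : E / 6 ≤ E * (3 + x) / (3 * (1 + x) ^ 3) := by
      rw [div_le_div_iff₀ (by norm_num) (by positivity)]
      have : 3 * (1 + x) ^ 3 ≤ 6 * (3 + x) := by
        nlinarith [pow_le_one₀ hx0 hx1 (n := 2),
        pow_le_one₀ hx0 hx1 (n := 3)]
      nlinarith
    have h2 : c ^ 2 ≤ (1 + 2 * c * a) * (E / 6) := by
      have h3 : (1 + 2 * c * a) * (E / 6) =
          c * ((1 + a ^ 2) * (3 - a ^ 2) * (1 + a) ^ 2 / (2 * (2 + a) * (1 - a ^ 2) ^ 2)) := by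
        rw [hE, hc]; field_simp; ring
      rw [h3, sq]
      refine mul_le_mul_of_nonneg_left ?_ hc0
      rw [hc, div_le_div_iff₀ hb (by positivity)]
      have h4 : a * (2 * (2 + a) * (1 - a ^ 2)) ≤ (1 + a ^ 2) * (3 - a ^ 2) * (1 + a) ^ 2 := by
        nlinarith [pow_nonneg ha 2, pow_nonneg ha 3, pow_nonneg ha 4, pow_nonneg ha 5,
          mul_nonneg (pow_nonneg ha 2) (sub_nonneg.2 ha1.le), mul_nonneg (pow_nonneg ha 3) (sub_nonneg.2 ha1.le), mul_nonneg (pow_nonneg ha 4) (sub_nonneg.2 ha1.le), mul_nonneg (pow_nonneg ha 5) (sub_nonneg.2 ha1.le)]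
      nlinarith
    have h5 : 2 * w ^ 3 * (E / 6) + w ^ 4 * c ^ 2 ≤
        (2 * (1 + c * (x - a)) + (1 + 2 * c * x) * w) *
        (w ^ 3 * (E * (3 + x) / (3 * (1 + x) ^ 3))) := by
      have h6 : 2 + (1 + 2 * c * a) * w ≤ 2 * (1 + c * (x - a)) + (1 + 2 * c * x) * w := by
        nlinarith [mul_nonneg hc0 (sub_nonneg.2 hx), mul_nonneg (mul_nonneg hc0 (sub_nonneg.2 hx)) hw.le]
      calc 2 * w ^ 3 * (E / 6) + w ^ 4 * c ^ 2
          ≤ 2 * w ^ 3 * (E / 6) + w ^ 4 * ((1 + 2 * c * a) * (E / 6)) := by gcongr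
        _ = (2 + (1 + 2 * c * a) * w) * (w ^ 3 * (E / 6)) := by ring
        _ ≤ _ := by gcongr
    have h7 : 0 < 2 * w ^ 3 * (E / 6) := by positivity
    nlinarith
  have hAt : ∀ w x, (w, x) ∈ region a → 0 < 2 * (1 + c * (x - a)) + (1 + 2 * c * x) * w := by
    rintro w x ⟨hw, -, hx, hx1⟩
    have hx0 : 0 ≤ x := ha.trans hx
    have := mul_nonneg hc0 (sub_nonneg.2 hx)
    have h2 : 0 ≤ (1 + 2 * c * x) * w := mul_nonneg (by positivity) hw
    linarith
  refine ⟨fun w x => 1 + c * (x - a) + (1 + 2 * c * x) * w,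
    fun w x => w * (-c + w * (2 * c - E * ((2 + x) / (3 * (1 + x) ^ 2)))),
    fun w x => 1 + 2 * c * x, fun w x => c + 2 * c * w,
    fun w x => -c + 2 * w * (2 * c - E * ((2 + x) / (3 * (1 + x) ^ 2))),
    fun w x => w ^ 2 * (E * (3 + x) / (3 * (1 + x) ^ 3)),
    ?_, ?_, ?_, ?_, ?_, ?_, ?_, ?_, ?_, ?_, ?_, ?_, ?_⟩
  · intro w x hx
    refine hasFDerivAt_of_partial (f := fun w x => 1 + c * (x - a) + (1 + 2 * c * x) * w)
      (by fun_prop) ?_ ?_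
    · exact (((hasDerivAt_id w).const_mul (1 + 2 * c * x)).const_add (1 + c * (x - a))).congr_deriv
        (by simp)
    · have h := ((((hasDerivAt_id x).sub_const a).const_mul c).const_add 1).add
        ((((hasDerivAt_id x).const_mul (2 * c)).const_add 1).mul_const w)
      exact h.congr_deriv (by simp)
  · intro w x hx
    have hx' := hbd x hx
    have h3 : (3 * (1 + x) ^ 2 : ℝ) ≠ 0 := by positivity
    refine hasFDerivAt_of_partial
      (f := fun w x => w * (-c + w * (2 * c - E * ((2 + x) / (3 * (1 + x) ^ 2)))))
      (by fun_prop (disch := assumption)) ?_ ?_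
    · have h := (hasDerivAt_id w).mul (((hasDerivAt_id w).mul_const
        (2 * c - E * ((2 + x) / (3 * (1 + x) ^ 2)))).const_add (-c))
      exact h.congr_deriv (by simp; ring)
    · have h := ((((((hasDerivAt_id x).const_add 2).div
        ((((hasDerivAt_id x).const_add 1).pow 2).const_mul 3) h3).const_mul E).const_sub
        (2 * c)).const_mul w).const_add (-c) |>.const_mul w
      refine h.congr_deriv ?_
      simp
      field_simp
      ring
  · fun_prop
  · fun_prop
  · have : ∀ q ∈ {q : ℝ × ℝ | 0 ≤ q.2}, 3 * (1 + q.2) ^ 2 ≠ 0 := fun q hq => by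
      have : 1 + q.2 ≠ 0 := hbd _ hq
      positivity
    fun_prop (disch := assumption)
  · have : ∀ q ∈ {q : ℝ × ℝ | 0 ≤ q.2}, 3 * (1 + q.2) ^ 3 ≠ 0 := fun q hq => by
      have : 1 + q.2 ≠ 0 := hbd _ hq
      positivity
    fun_prop (disch := assumption)
  · intro w
    have := hbd a ha
    simp only [hE, ← hc]
    field_simp
    ring
  · intro w x hx
    have hx' := hbd x hx
    have h4 : 6 / ((1 - a) ^ 2 * (2 + a)) = 3 + E := by
      rw [hE, hc]; field_simp; ring
    rw [h4]
    push_cast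
    field_simp
    ring
  · intro w x h Y Z P hY hP hZ
    rcases h.1.eq_or_lt with hw | hw
    · change 0 = w at hw
      subst hw
      have := hAt _ _ h
      push_cast
      have h2 := mul_nonneg this.le hY
      linarith
    · rcases eq_or_ne c 0 with hc' | hc'
      · have hE' : E = 0 := by rw [hE, hc']; ring
        have := mul_nonneg (hAt _ _ h).le hY
        simp only [hc', hE'] at this ⊢
        push_cast
        linear_combination this
      · have h0 := form_nonneg_of_discrim (hAt _ _ h) (γ := w ^ 3 * (E * (3 + x) / (3 * (1 + x) ^ 3)))
          (by have := ha.trans h.2.2.1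
              change 0 ≤ x at this
              change 0 < w at hw
              positivity) (hcoef w x hw h hc').le hY hP hZ
        refine h0.trans_eq ?_
        push_cast
        ring
  · intro w x h hw Y Z P hY hP hZ h0
    rcases eq_or_ne c 0 with hc' | hc'
    · have hE' : E = 0 := by rw [hE, hc']; ring
      simp only [hc', hE'] at h0
      push_cast at h0
      have h1 := hAt _ _ h
      rw [hc'] at h1
      refine ⟨(mul_eq_zero.1 (show (2 * (1 + 0 * (x - a)) + (1 + 2 * 0 * x) * w) * Y = 0 from ?_)
        ).resolve_left h1.ne', fun hane => ?_⟩
      · linear_combination h0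
      · exact absurd hc' (by rw [hc]; exact div_ne_zero hane hb.ne')
    · have hcp : 0 < c := lt_of_le_of_ne hc0 (Ne.symm hc')
      have hEp : 0 < E := by rw [hE]; positivity
      have hx0 : 0 ≤ x := ha.trans h.2.2.1
      have := form_eq_zero_of_discrim (hAt _ _ h) (γ := w ^ 3 * (E * (3 + x) / (3 * (1 + x) ^ 3)))
          (by positivity) (hcoef w x hw h hc') hY hP hZ (by rw [← h0]; push_cast; ring)
      exact ⟨this.1, fun _ => this.2⟩
  · rintro w x ⟨hw, -, hx, hx1⟩
    have hx0 : 0 ≤ x := ha.trans hx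
    have := mul_nonneg hc0 (sub_nonneg.2 hx)
    have h2 : 0 ≤ (1 + 2 * c * x) * w := mul_nonneg (by positivity) hw
    linarith
  · simp
  · obtain ⟨C, hC0, hC⟩ := exists_bound_of_continuousOn ha
      (b := fun w x => -c + w * (2 * c - E * ((2 + x) / (3 * (1 + x) ^ 2)))) (by
        have : ∀ q ∈ {q : ℝ × ℝ | 0 ≤ q.2}, 3 * (1 + q.2) ^ 2 ≠ 0 := fun q hq => by
          have : 1 + q.2 ≠ 0 := hbd _ hq
          positivity
        fun_prop (disch := assumption))
    refine ⟨C, hC0, fun w x h => ?_⟩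
    rw [abs_mul, abs_of_nonneg h.1, mul_comm]
    exact mul_le_mul_of_nonneg_right (hC w x h) h.1


end

/-! ### The explicit calibration in dimension six. -/

section

/-- The discriminant estimate of the six-dimensional calibration in the scaled variable v = w (1 +
P), P = a²/(1 − a²). Since 1 + P = 1/(1 − a²), the range w ≤ 2(1 − a²) becomes v ≤ 2 uniformly in a,
and a polynomial inequality in P and v remains. -/
theorem discrim_aux {P v A₁ A₂ A₃ β : ℝ} (hP : 0 ≤ P) (hv : 0 < v) (hv2 : v ≤ 2) (h3 : 1 ≤ A₃)
    (h2 : 3 / 2 + 3 * P ≤ A₂) (h1 : 3 / 2 + 6 * P + 7 / 2 * P ^ 2 ≤ A₁)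
    (hβ : |β| ≤ 3 + 13 / 4 * P + 2 * P ^ 2 + v * (6 + 4 * P + 3 / 2 * P ^ 2)) :
    v * β ^ 2 < 4 * (3 * A₃ * (1 + P) ^ 2 + 2 * A₂ * v * (1 + P) + A₁ * v ^ 2) *
      (P * (1 + P) + 6 * v) := by
  have h4 : β ^ 2 ≤ (3 + 13 / 4 * P + 2 * P ^ 2 + v * (6 + 4 * P + 3 / 2 * P ^ 2)) ^ 2 :=
    sq_le_sq' (by linarith [neg_abs_le β]) ((le_abs_self β).trans hβ)
  calc v * β ^ 2 ≤ v * (3 + 13 / 4 * P + 2 * P ^ 2 + v * (6 + 4 * P + 3 / 2 * P ^ 2)) ^ 2 := by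
        gcongr
    _ < 4 * (3 * 1 * (1 + P) ^ 2 + 2 * (3 / 2 + 3 * P) * v * (1 + P) +
        (3 / 2 + 6 * P + 7 / 2 * P ^ 2) * v ^ 2) * (P * (1 + P) + 6 * v) := by
        have e0 : 0 ≤ 12 * P * (1 + P) ^ 3 := by positivity
        have e1 : 0 < v * (63 + (144 + 12 - 39 / 2) * P + (72 + 48 - 361 / 16 + 2 - 2) * P ^ 2 +
          (60 - 13) * P ^ 3 + 20 * P ^ 4) := by
          have : 0 < 63 + (144 + 12 - 39 / 2) * P + (72 + 48 - 361 / 16 + 2 - 2) * P ^ 2 +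
            (60 - 13) * P ^ 3 + 20 * P ^ 4 := by norm_num; positivity
          positivity
        have e2 : 0 ≤ v ^ 2 * (23 * P ^ 2 - 47 / 4 * P ^ 3 + 7 / 2 * P ^ 4) := by
          have : 0 ≤ 23 * P ^ 2 - 47 / 4 * P ^ 3 + 7 / 2 * P ^ 4 := by
            have : 0 ≤ P ^ 2 * (7 / 2 * (P - 47 / 28) ^ 2 + 23 - 7 / 2 * (47 / 28) ^ 2) := by
              have : (0 : ℝ) ≤ 23 - 7 / 2 * (47 / 28) ^ 2 := by norm_num
              have h := mul_nonneg (by norm_num : (0 : ℝ) ≤ 7 / 2) (sq_nonneg (P - 47 / 28))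
              exact mul_nonneg (sq_nonneg P) (by linarith)
            linarith
          positivity
        have e3 : 0 ≤ v ^ 2 * (36 + 159 * P + 92 * P ^ 2) := by positivity
        -- The cubic terms in v of the difference have negative coefficients −12P³ − (9/4)P⁴; v ≤ 2
        -- trades them for quadratic ones.
        have e4 : 0 ≤ v ^ 2 * (2 - v) * (12 * P ^ 3 + 9 / 4 * P ^ 4) :=
          mul_nonneg (mul_nonneg (sq_nonneg v) (sub_nonneg.2 hv2)) (by positivity)
        have e5 : 0 ≤ v ^ 3 * (96 * P + 50 * P ^ 2) := by positivity
        nlinarith [mul_nonneg hv.le (sq_nonneg P), mul_nonneg hv.le hP]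
    _ ≤ _ := by gcongr

/-- Gives the lower bound 6c² for the coefficient of the normal part of p. The linear function 0.234
+ 0.45a is inserted between the two sides, so that the inequality splits into two of lower degree.
-/
theorem weight_aux {a : ℝ} (ha : 0 ≤ a) (ha1 : a ≤ 1) :
    8 * a * (6 - 19 / 4 * a ^ 2) * (8 + 9 * a + 3 * a ^ 2) ≤
      15 * (1 + a) ^ 3 * (15 / 2 - 5 * a ^ 2 + 3 / 2 * a ^ 4) := by
  have hu : 0 ≤ 1 - a := sub_nonneg.2 ha1
  have h1 : (8 + 9 * a + 3 * a ^ 2) * (0.234 + 0.45 * a) * 8 ≤ 15 * (1 + a) ^ 3 := by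
    nlinarith [mul_nonneg ha hu, mul_nonneg (mul_nonneg ha ha) hu, pow_nonneg ha 3]
  have h2 : a * (6 - 19 / 4 * a ^ 2) ≤
      (0.234 + 0.45 * a) * (15 / 2 - 5 * a ^ 2 + 3 / 2 * a ^ 4) := by
    nlinarith [mul_nonneg ha (sq_nonneg (a - 0.77)), sq_nonneg (a - 0.77), pow_nonneg ha 4,
      pow_nonneg ha 5]
  have h3 : 0 ≤ 15 / 2 - 5 * a ^ 2 + 3 / 2 * a ^ 4 := by nlinarith [pow_nonneg ha 4]
  calc 8 * a * (6 - 19 / 4 * a ^ 2) * (8 + 9 * a + 3 * a ^ 2)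
      = 8 * (8 + 9 * a + 3 * a ^ 2) * (a * (6 - 19 / 4 * a ^ 2)) := by ring
    _ ≤ 8 * (8 + 9 * a + 3 * a ^ 2) *
        ((0.234 + 0.45 * a) * (15 / 2 - 5 * a ^ 2 + 3 / 2 * a ^ 4)) := by gcongr
    _ = ((8 + 9 * a + 3 * a ^ 2) * (0.234 + 0.45 * a) * 8) *
        (15 / 2 - 5 * a ^ 2 + 3 / 2 * a ^ 4) := by ring
    _ ≤ _ := by gcongr

-- The same ansatz with A and B/w quadratic in w. The weight h = (8 + 9x + 3x²)/(15(1 + x)³) is (1 −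
-- x²)⁻³ ∫ₓ¹ (1 − s²)² ds, regular at x = 1 with (1 − x²) h′ − 6x h = −1. Its multiple E is again
-- fixed by the top coefficient of the boundary condition at x = a.
set_option maxHeartbeats 1000000 in
theorem exists_calibration_three {a : ℝ} (ha : 0 ≤ a) (ha1 : a < 1) :
    ∃ A B Aw Ax Bw Bx,
      IsCalibration 3 a (60 / ((1 - a) ^ 3 * (8 + 9 * a + 3 * a ^ 2))) A B Aw Ax Bw Bx := by
  have hb := one_sub_sq_pos ha ha1
  have h1a : (1 - a) ≠ 0 := by linarith
  have h2a : 8 + 9 * a + 3 * a ^ 2 ≠ 0 := by positivity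
  obtain ⟨c, hc⟩ : ∃ c, c = a / (1 - a ^ 2) := ⟨_, rfl⟩
  obtain ⟨P, hP⟩ : ∃ P, P = c * a := ⟨_, rfl⟩
  obtain ⟨E, hE⟩ : ∃ E, E = c * (15 / 2 + 10 * P + 4 * P ^ 2) * (15 * (1 + a) ^ 3) /
    (8 + 9 * a + 3 * a ^ 2) := ⟨_, rfl⟩
  have hc0 : 0 ≤ c := by rw [hc]; positivity
  have hP0 : 0 ≤ P := by rw [hP]; positivity
  have hE0 : 0 ≤ E := by rw [hE]; positivity
  have hbd : ∀ x : ℝ, 0 ≤ x → 1 + x ≠ 0 := fun x hx => by positivity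
  have hPb : (1 + P) * (1 - a ^ 2) = 1 := by rw [hP, hc]; field_simp; ring
  -- the coefficients of the powers of `w`
  obtain ⟨A₂, hA₂⟩ : ∃ A₂ : ℝ → ℝ, A₂ = fun x => 3 / 2 + 3 * P + (9 / 2 + P) * (c * (x - a)) -
    P * (c * (x - a)) ^ 2 / 4 := ⟨_, rfl⟩
  obtain ⟨A₁, hA₁⟩ : ∃ A₁ : ℝ → ℝ, A₁ = fun x => 3 / 2 + 6 * P + 17 / 4 * P ^ 2 +
    (6 + 4 * P - 3 / 2 * P ^ 2) * (c * (x - a)) - 5 / 4 * P * (c * (x - a)) ^ 2 := ⟨_, rfl⟩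
  obtain ⟨B₁, hB₁⟩ : ∃ B₁ : ℝ → ℝ, B₁ = fun x => -c * (3 / 2 + 3 * P) + c * P * (c * (x - a)) :=
    ⟨_, rfl⟩
  obtain ⟨B₀, hB₀⟩ : ∃ B₀ : ℝ → ℝ, B₀ = fun x => c * (6 + 4 * P - 3 / 2 * P ^ 2) +
    5 / 2 * c * P ^ 2 - 5 / 4 * c ^ 2 * P * x -
    E * ((8 + 9 * x + 3 * x ^ 2) / (15 * (1 + x) ^ 3)) := ⟨_, rfl⟩
  obtain ⟨e, he⟩ : ∃ e : ℝ → ℝ, e = fun x => -(5 / 4) * c ^ 2 * P +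
    E * ((5 + 4 * x + x ^ 2) / (5 * (1 + x) ^ 4)) := ⟨_, rfl⟩
  have hA₂d : ∀ x, HasDerivAt A₂ (c * (9 / 2 + P - P * (c * (x - a)) / 2)) x := by
    intro x
    have h := ((hasDerivAt_id x).sub_const a).const_mul c
    rw [hA₂]
    refine (((h.const_mul (9 / 2 + P)).const_add (3 / 2 + 3 * P)).sub
      (((h.pow 2).const_mul P).div_const 4)).congr_deriv ?_
    simp; ring
  have hA₁d : ∀ x, HasDerivAt A₁
      (c * (6 + 4 * P - 3 / 2 * P ^ 2 - 5 / 2 * P * (c * (x - a)))) x := by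
    intro x
    have h := ((hasDerivAt_id x).sub_const a).const_mul c
    rw [hA₁]
    refine (((h.const_mul (6 + 4 * P - 3 / 2 * P ^ 2)).const_add
      (3 / 2 + 6 * P + 17 / 4 * P ^ 2)).sub ((h.pow 2).const_mul (5 / 4 * P))).congr_deriv ?_
    simp; ring
  have hB₁d : ∀ x, HasDerivAt B₁ (c ^ 2 * P) x := by
    intro x
    have h := ((hasDerivAt_id x).sub_const a).const_mul c
    rw [hB₁]
    refine ((h.const_mul (c * P)).const_add (-c * (3 / 2 + 3 * P))).congr_deriv ?_
    ring
  have hB₀d : ∀ x, 0 ≤ x → HasDerivAt B₀ (e x) x := by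
    intro x hx
    have hx' := hbd x hx
    have h3 : (15 * (1 + x) ^ 3 : ℝ) ≠ 0 := by positivity
    have h := ((((((hasDerivAt_id x).const_mul 9).const_add 8).add
      (((hasDerivAt_id x).pow 2).const_mul 3)).div
      ((((hasDerivAt_id x).const_add 1).pow 3).const_mul 15) h3).const_mul E)
    rw [hB₀]
    refine ((((hasDerivAt_id x).const_mul (5 / 4 * c ^ 2 * P)).const_sub
      (c * (6 + 4 * P - 3 / 2 * P ^ 2) + 5 / 2 * c * P ^ 2)).sub h).congr_deriv ?_
    rw [he]
    simp
    field_simp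
    ring
  have hA₂c : Continuous A₂ := by rw [hA₂]; fun_prop
  have hA₁c : Continuous A₁ := by rw [hA₁]; fun_prop
  have hB₁c : Continuous B₁ := by rw [hB₁]; fun_prop
  have hB₀c : ContinuousOn (fun q : ℝ × ℝ => B₀ q.2) {q | 0 ≤ q.2} := fun q hq =>
    ((hB₀d q.2 hq).continuousAt.comp continuousAt_snd).continuousWithinAt
  have hec : ContinuousOn (fun q : ℝ × ℝ => e q.2) {q | 0 ≤ q.2} := by
    have : ∀ q ∈ {q : ℝ × ℝ | 0 ≤ q.2}, 5 * (1 + q.2) ^ 4 ≠ 0 := fun q hq => by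
      have : 1 + q.2 ≠ 0 := hbd _ hq
      positivity
    rw [he]
    fun_prop (disch := assumption)
  have hζ : ∀ x, a ≤ x → x ≤ 1 → 0 ≤ c * (x - a) ∧ c * (x - a) ≤ 1 / 2 := by
    intro x hx hx1
    refine ⟨mul_nonneg hc0 (sub_nonneg.2 hx), ?_⟩
    calc c * (x - a) ≤ c * (1 - a) := by gcongr
      _ = a / (1 + a) := by
        rw [hc, show 1 - a ^ 2 = (1 - a) * (1 + a) by ring]; field_simp
      _ ≤ 1 / 2 := by rw [div_le_div_iff₀ (by linarith) (by norm_num)]; linarith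
  have hA₂ge : ∀ x, a ≤ x → x ≤ 1 → 3 / 2 + 3 * P ≤ A₂ x := by
    intro x hx hx1
    obtain ⟨h0, h1⟩ := hζ x hx hx1
    rw [hA₂]
    nlinarith [mul_nonneg hP0 h0, mul_nonneg (mul_nonneg hP0 h0) (sub_nonneg.2 h1)]
  have hA₁ge : ∀ x, a ≤ x → x ≤ 1 → 3 / 2 + 6 * P + 7 / 2 * P ^ 2 ≤ A₁ x := by
    intro x hx hx1
    obtain ⟨h0, h1⟩ := hζ x hx hx1
    rw [hA₁]
    nlinarith [mul_nonneg hP0 h0, mul_nonneg (mul_nonneg hP0 h0) (sub_nonneg.2 h1),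
      mul_nonneg (sq_nonneg P) (sub_nonneg.2 h1)]
  have hAt : ∀ w x, (w, x) ∈ region a →
      0 < 3 * (1 + 2 * (c * (x - a))) + 2 * A₂ x * w + A₁ x * w ^ 2 := by
    rintro w x ⟨hw, -, hx, hx1⟩
    change 0 ≤ w at hw
    have h0 := (hζ x hx hx1).1
    have h2 : 0 ≤ A₂ x := le_trans (by positivity) (hA₂ge x hx hx1)
    have h1 : 0 ≤ A₁ x := le_trans (by positivity) (hA₁ge x hx hx1)
    positivity
  have he6 : ∀ x, a ≤ x → x ≤ 1 → 6 * c ^ 2 ≤ e x := by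
    intro x hx hx1
    have hx0 := ha.trans hx
    have h1 : 1 / 8 ≤ (5 + 4 * x + x ^ 2) / (5 * (1 + x) ^ 4) := by
      rw [div_le_div_iff₀ (by norm_num) (by positivity)]
      nlinarith [pow_le_one₀ hx0 hx1 (n := 2), pow_le_one₀ hx0 hx1 (n := 3),
        mul_nonneg hx0 (sub_nonneg.2 hx1), mul_nonneg (pow_nonneg hx0 2) (sub_nonneg.2 hx1),
        mul_nonneg (pow_nonneg hx0 3) (sub_nonneg.2 hx1)]
    -- The summand (5/4)P pays for the negative term of `e`; 1/8 is the value at x = 1 of the weight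
    -- in `e`.
    have h2 : c ^ 2 * (6 + 5 / 4 * P) ≤ E * (1 / 8) := by
      have h3 : E * (1 / 8) = c * (15 * (1 + a) ^ 3 * (15 / 2 - 5 * a ^ 2 + 3 / 2 * a ^ 4) /
          (8 * (8 + 9 * a + 3 * a ^ 2) * (1 - a ^ 2) ^ 2)) := by
        rw [hE, hP, hc]; field_simp; ring
      rw [h3, sq, mul_assoc]
      refine mul_le_mul_of_nonneg_left ?_ hc0
      have h4 : c * (6 + 5 / 4 * P) = a * (6 - 19 / 4 * a ^ 2) / (1 - a ^ 2) ^ 2 := by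
        rw [hP, hc]; field_simp; ring
      rw [h4, div_le_div_iff₀ (by positivity) (by positivity)]
      nlinarith [mul_le_mul_of_nonneg_right (weight_aux ha ha1.le) (sq_nonneg (1 - a ^ 2))]
    rw [he]
    nlinarith [mul_le_mul_of_nonneg_left h1 hE0]
  have hcoef : ∀ w x, 0 < w → (w, x) ∈ region a → c ≠ 0 →
      (w ^ 2 * (c * (3 - 2 * P + P * (c * (x - a)) / 2)) +
        w ^ 3 * (c * (6 + 4 * P - 3 / 2 * P ^ 2 - 5 / 2 * P * (c * (x - a))))) ^ 2 <
      4 * (3 * (1 + 2 * (c * (x - a))) + 2 * A₂ x * w + A₁ x * w ^ 2) *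
        (w ^ 3 * (c ^ 2 * P + w * e x)) := by
    rintro w x hw hwx hc'
    obtain ⟨-, hw2, hx, hx1⟩ := id hwx
    change w ≤ 2 * (1 - a ^ 2) at hw2
    obtain ⟨h0, h1⟩ := hζ x hx hx1
    obtain ⟨ζ, hζx⟩ : ∃ ζ, ζ = c * (x - a) := ⟨_, rfl⟩
    rw [← hζx] at h0 h1 ⊢
    have hcp : 0 < c := lt_of_le_of_ne hc0 (Ne.symm hc')
    have hAt0 := hAt w x hwx
    rw [← hζx] at hAt0
    obtain ⟨β, hβ⟩ : ∃ β, β = 3 - 2 * P + P * ζ / 2 +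
      w * (6 + 4 * P - 3 / 2 * P ^ 2 - 5 / 2 * P * ζ) := ⟨_, rfl⟩
    have hPζ := mul_nonneg hP0 h0
    have hPζ' := mul_nonneg hP0 (sub_nonneg.2 h1)
    have h2 := discrim_aux (v := w * (1 + P)) (A₁ := A₁ x) (A₂ := A₂ x) (A₃ := 1 + 2 * ζ)
      (β := (1 + P) * β) hP0 (by positivity)
      (by nlinarith [mul_le_mul_of_nonneg_right hw2 (by positivity : 0 ≤ 1 + P)]) (by linarith)
      (hA₂ge x hx hx1) (hA₁ge x hx hx1) (by
        have h3 : |3 - 2 * P + P * ζ / 2| * (1 + P) ≤ 3 + 13 / 4 * P + 2 * P ^ 2 := by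
          have h5 : 0 ≤ P * ζ * P := mul_nonneg hPζ hP0
          have h6 : 0 ≤ P * (1 / 2 - ζ) * P := mul_nonneg hPζ' hP0
          rcases abs_cases (3 - 2 * P + P * ζ / 2) with h | h <;> rw [h.1] <;> nlinarith
        have h4 : |6 + 4 * P - 3 / 2 * P ^ 2 - 5 / 2 * P * ζ| ≤ 6 + 4 * P + 3 / 2 * P ^ 2 := by
          rw [abs_le]; constructor <;> nlinarith
        calc |(1 + P) * β| = |(3 - 2 * P + P * ζ / 2) * (1 + P) +
              w * (1 + P) * (6 + 4 * P - 3 / 2 * P ^ 2 - 5 / 2 * P * ζ)| := by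
              rw [hβ]; congr 1; ring
          _ ≤ _ := (abs_add_le _ _).trans (by
              rw [abs_mul, abs_mul _ (6 + 4 * P - 3 / 2 * P ^ 2 - 5 / 2 * P * ζ),
                abs_of_pos (by positivity : 0 < 1 + P), abs_of_pos (by positivity : 0 < w * (1 + P))]
              gcongr))
    have h7 : w * β ^ 2 < 4 * (3 * (1 + 2 * ζ) + 2 * A₂ x * w + A₁ x * w ^ 2) * (P + 6 * w) := by
      have h8 : (1 + P) ^ 3 * (w * β ^ 2) < (1 + P) ^ 3 *
          (4 * (3 * (1 + 2 * ζ) + 2 * A₂ x * w + A₁ x * w ^ 2) * (P + 6 * w)) := by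
        convert h2 using 1 <;> ring
      exact lt_of_mul_lt_mul_left h8 (by positivity)
    calc _ = w ^ 3 * c ^ 2 * (w * β ^ 2) := by rw [hβ]; ring
      _ < w ^ 3 * c ^ 2 *
          (4 * (3 * (1 + 2 * ζ) + 2 * A₂ x * w + A₁ x * w ^ 2) * (P + 6 * w)) :=
        mul_lt_mul_of_pos_left h7 (by positivity)
      _ = 4 * (3 * (1 + 2 * ζ) + 2 * A₂ x * w + A₁ x * w ^ 2) *
          (w ^ 3 * (c ^ 2 * P + w * (6 * c ^ 2))) := by ring
      _ ≤ _ := by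
        have := he6 x hx hx1
        gcongr
  refine ⟨fun w x => 1 + 2 * (c * (x - a)) + A₂ x * w + A₁ x * w ^ 2,
    fun w x => w * (-c + w * B₁ x + w ^ 2 * B₀ x),
    fun w x => A₂ x + 2 * A₁ x * w,
    fun w x => 2 * c + c * (9 / 2 + P - P * (c * (x - a)) / 2) * w +
      c * (6 + 4 * P - 3 / 2 * P ^ 2 - 5 / 2 * P * (c * (x - a))) * w ^ 2,
    fun w x => -c + 2 * w * B₁ x + 3 * w ^ 2 * B₀ x,
    fun w x => w ^ 2 * (c ^ 2 * P + w * e x),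
    ?_, ?_, ?_, ?_, ?_, ?_, ?_, ?_, ?_, ?_, ?_, ?_, ?_⟩
  · intro w x hx
    refine hasFDerivAt_of_partial
      (f := fun w x => 1 + 2 * (c * (x - a)) + A₂ x * w + A₁ x * w ^ 2) ?_ ?_ ?_
    · have h2 : DifferentiableAt ℝ A₂ x := (hA₂d x).differentiableAt
      have h1 : DifferentiableAt ℝ A₁ x := (hA₁d x).differentiableAt
      fun_prop
    · have h := (((hasDerivAt_id w).const_mul (A₂ x)).const_add (1 + 2 * (c * (x - a)))).add
        (((hasDerivAt_id w).pow 2).const_mul (A₁ x))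
      refine h.congr_deriv ?_
      simp; ring
    · have h := ((((((hasDerivAt_id x).sub_const a).const_mul c).const_mul 2).const_add 1).add
        ((hA₂d x).mul_const w)).add ((hA₁d x).mul_const (w ^ 2))
      refine h.congr_deriv ?_
      ring
  · intro w x hx
    refine hasFDerivAt_of_partial
      (f := fun w x => w * (-c + w * B₁ x + w ^ 2 * B₀ x)) ?_ ?_ ?_
    · have h2 : DifferentiableAt ℝ B₁ x := (hB₁d x).differentiableAt
      have h1 : DifferentiableAt ℝ B₀ x := (hB₀d x hx).differentiableAt
      fun_prop
    · have h := (hasDerivAt_id w).mul ((((hasDerivAt_id w).mul_const (B₁ x)).const_add (-c)).add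
        (((hasDerivAt_id w).pow 2).mul_const (B₀ x)))
      refine h.congr_deriv ?_
      simp; ring
    · have h := ((((hB₁d x).const_mul w).const_add (-c)).add
        ((hB₀d x hx).const_mul (w ^ 2))).const_mul w
      refine h.congr_deriv ?_
      ring
  · fun_prop
  · fun_prop
  · exact (by fun_prop : Continuous fun q : ℝ × ℝ => -c + 2 * q.1 * B₁ q.2).continuousOn.add
      ((by fun_prop : Continuous fun q : ℝ × ℝ => 3 * q.1 ^ 2).continuousOn.mul hB₀c)
  · exact (by fun_prop : Continuous fun q : ℝ × ℝ => q.1 ^ 2).continuousOn.mul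
      (continuousOn_const.add (continuousOn_fst.mul hec))
  · intro w
    have := hbd a ha
    simp only [hA₂, hA₁, hB₁, hB₀, hE, ← hc]
    rw [show 5 / 4 * c ^ 2 * P * a = 5 / 4 * c * P ^ 2 by rw [hP]; ring]
    field_simp
    ring
  · intro w x hx
    have hx' := hbd x hx
    have h4 : 60 / ((1 - a) ^ 3 * (8 + 9 * a + 3 * a ^ 2)) =
        5 * (3 / 2 + 6 * P + 17 / 4 * P ^ 2 - (6 + 4 * P - 3 / 2 * P ^ 2) * P -
        5 / 4 * P ^ 3) - 5 / 4 * c ^ 2 * P + E := by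
      rw [hE, hP, hc]; field_simp; ring
    rw [h4]
    simp only [hA₂, hA₁, hB₁, hB₀, he]
    push_cast
    rw [hP, hc]
    field_simp
    ring
  · intro w x h Y Z T hY hT hZ
    rcases h.1.eq_or_lt with hw | hw
    · change 0 = w at hw
      subst hw
      have := mul_nonneg (hAt _ _ h).le hY
      push_cast
      linear_combination this
    · rcases eq_or_ne c 0 with hc' | hc'
      · have hE' : E = 0 := by rw [hE, hc']; ring
        have := mul_nonneg (hAt _ _ h).le hY
        simp only [hB₁, hB₀, he, hc', hE'] at this ⊢
        push_cast
        linear_combination this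
      · have h0 := form_nonneg_of_discrim (hAt _ _ h) (γ := w ^ 3 * (c ^ 2 * P + w * e x))
          (by have := le_trans (by positivity) (he6 x h.2.2.1 h.2.2.2)
              change 0 < w at hw
              positivity) (hcoef w x hw h hc').le hY hT hZ
        refine h0.trans_eq ?_
        simp only [hA₂, hA₁, hB₁]
        push_cast
        ring
  · intro w x h hw Y Z T hY hT hZ h0
    rcases eq_or_ne c 0 with hc' | hc'
    · have hE' : E = 0 := by rw [hE, hc']; ring
      have h1 := hAt _ _ h
      refine ⟨(mul_eq_zero.1 (show (3 * (1 + 2 * (c * (x - a))) + 2 * A₂ x * w + A₁ x * w ^ 2) * Y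
        = 0 from ?_)).resolve_left h1.ne', fun hane => ?_⟩
      · simp only [hB₁, hB₀, he, hc', hE'] at h0 ⊢
        push_cast at h0
        linear_combination h0
      · exact absurd hc' (by rw [hc]; exact div_ne_zero hane hb.ne')
    · have hep : 0 < e x := lt_of_lt_of_le (by positivity) (he6 x h.2.2.1 h.2.2.2)
      have := form_eq_zero_of_discrim (hAt _ _ h) (γ := w ^ 3 * (c ^ 2 * P + w * e x))
          (by positivity) (hcoef w x hw h hc') hY hT hZ
          (by rw [← h0]; simp only [hA₂, hA₁, hB₁]; push_cast; ring)
      exact ⟨this.1, fun _ => this.2⟩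
  · rintro w x ⟨hw, -, hx, hx1⟩
    change 0 ≤ w at hw
    have h0 := (hζ x hx hx1).1
    have h2 : 0 ≤ A₂ x * w := mul_nonneg (le_trans (by positivity) (hA₂ge x hx hx1)) hw
    have h1 : 0 ≤ A₁ x * w ^ 2 := mul_nonneg (le_trans (by positivity) (hA₁ge x hx hx1)) (sq_nonneg w)
    linarith
  · simp
  · obtain ⟨C, hC0, hC⟩ := exists_bound_of_continuousOn ha
      (b := fun w x => -c + w * B₁ x + w ^ 2 * B₀ x)
      ((by fun_prop : Continuous fun q : ℝ × ℝ => -c + q.1 * B₁ q.2).continuousOn.add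
        ((by fun_prop : Continuous fun q : ℝ × ℝ => q.1 ^ 2).continuousOn.mul hB₀c))
    refine ⟨C, hC0, fun w x h => ?_⟩
    rw [abs_mul, abs_of_nonneg h.1, mul_comm]
    exact mul_le_mul_of_nonneg_right (hC w x h) h.1


end

/-! ### Tangential and normal parts of y and p; integrability of negative powers of w. -/

section

open Filter Topology Set

variable {k n : ℕ} [NeZero k] {M : Type*} [TopologicalSpace M]
  [ChartedSpace (EuclideanHalfSpace k) M]
  {F : M → Ambient n} {p y : Ambient n} {R : ℝ}

variable (k) in
/-- The inner product of the tangential parts of two ambient vectors. -/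
def tau (F : M → Ambient n) (u v : Ambient n) (x : M) : ℝ := inner ℝ (tangentProj k F x u) v

variable (k) in
/-- The part of an ambient vector that is tangent to the sphere and normal to the submanifold. -/
def normalPart (F : M → Ambient n) (u : Ambient n) (x : M) : Ambient n :=
  u - inner ℝ (F x) u • F x - tangentProj k F x u

/-- The function `1 - ⟪q, y⟫`, half of the squared chordal distance from `y`. -/
def defect (F : M → Ambient n) (y : Ambient n) (x : M) : ℝ := 1 - inner ℝ (F x) y

theorem tau_comm (u v : Ambient n) (x : M) : tau k F u v x = tau k F v u x := by
  rw [tau, tau, tangentProj, Submodule.inner_starProjection_left_eq_right, real_inner_comm]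

theorem tau_eq_inner (u v : Ambient n) (x : M) :
    tau k F u v x = inner ℝ (tangentProj k F x u) (tangentProj k F x v) := by
  rw [tau, tangentProj, ← Submodule.inner_starProjection_left_eq_right,
    Submodule.starProjection_eq_self_iff.2 (Submodule.starProjection_apply_mem _ _)]

theorem tau_self_nonneg (u : Ambient n) (x : M) : 0 ≤ tau k F u u x := by
  rw [tau_eq_inner]
  exact real_inner_self_nonneg

theorem tau_sq_le (u v : Ambient n) (x : M) :
    tau k F u v x ^ 2 ≤ tau k F u u x * tau k F v v x := by
  simp only [tau_eq_inner, sq]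
  exact real_inner_mul_inner_self_le _ _

theorem tau_self_le (u : Ambient n) (x : M) : tau k F u u x ≤ ‖u‖ ^ 2 := by
  rw [tau_eq_inner, real_inner_self_eq_norm_sq]
  gcongr
  exact Submodule.norm_starProjection_apply_le _ _

namespace IsFreeBoundaryMinimal

variable [IsManifold (𝓡∂ k) ∞ M] [CompactSpace M] [T2Space M]

theorem inner_diff_self (hF : IsFreeBoundaryMinimal (k := k) F p R) (x : M)
    (v : EuclideanSpace ℝ (Fin k)) : inner ℝ (F x) (diff k F x v) = 0 := by
  have h1 : HasMFDerivAt (𝓡∂ k) 𝓘(ℝ, Ambient n) F x (diff k F x) :=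
    (hF.smooth.mdifferentiable (by simp) x).hasMFDerivAt
  have h2 : HasFDerivAt (fun q : Ambient n => ‖q‖ ^ 2) (2 • innerSL ℝ (F x)) (F x) :=
    (hasStrictFDerivAt_norm_sq (F x)).hasFDerivAt
  have h3 := h2.hasMFDerivAt.comp x h1
  have h4 : (fun q : Ambient n => ‖q‖ ^ 2) ∘ F = fun _ => (1 : ℝ) := by
    funext z
    simp [hF.norm_eq_one z]
  rw [h4] at h3
  have h5 := hasMFDerivAt_unique h3 (hasMFDerivAt_const 1 x)
  have h6 := DFunLike.congr_fun h5 v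
  change (2 • innerSL ℝ (F x)) (diff k F x v) = 0 at h6
  simpa using h6

theorem inner_tangentProj_self (hF : IsFreeBoundaryMinimal (k := k) F p R) (u : Ambient n) (x : M) :
    inner ℝ (F x) (tangentProj k F x u) = 0 := by
  rw [← diff_tangentLift]
  exact hF.inner_diff_self x _

theorem tangentProj_self (hF : IsFreeBoundaryMinimal (k := k) F p R) (x : M) :
    tangentProj k F x (F x) = 0 := by
  rw [← inner_self_eq_zero (𝕜 := ℝ), ← tau_eq_inner, tau, real_inner_comm]
  exact hF.inner_tangentProj_self _ x

theorem inner_normalPart (hF : IsFreeBoundaryMinimal (k := k) F p R) (u v : Ambient n) (x : M) :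
    inner ℝ (normalPart k F u x) (normalPart k F v x) =
      inner ℝ u v - inner ℝ (F x) u * inner ℝ (F x) v - tau k F u v x := by
  have h1 := hF.inner_tangentProj_self u x
  have h2 := hF.inner_tangentProj_self v x
  have h3 := tau_eq_inner (k := k) (F := F) u v x
  have h4 := tau_comm (k := k) (F := F) u v x
  have h5 : inner ℝ (F x) (F x) = (1 : ℝ) := by
    rw [real_inner_self_eq_norm_sq, hF.norm_eq_one]; norm_num
  unfold tau at h3 h4 ⊢
  simp only [normalPart, inner_sub_left, inner_sub_right, inner_smul_left, inner_smul_right,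
    conj_trivial, h2, h5, h3]
  rw [real_inner_comm (F x) (tangentProj k F x u), h1, real_inner_comm (F x) u,
    real_inner_comm (tangentProj k F x v) u, ← h4, h3]
  ring

theorem tau_eq (hF : IsFreeBoundaryMinimal (k := k) F p R) (u v : Ambient n) (x : M) :
    tau k F u v x = inner ℝ u v - inner ℝ (F x) u * inner ℝ (F x) v -
      inner ℝ (normalPart k F u x) (normalPart k F v x) := by
  rw [hF.inner_normalPart]; ring

theorem continuous_tau (hF : IsFreeBoundaryMinimal (k := k) F p R) (u v : Ambient n) :
    Continuous (tau k F u v) :=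
  (hF.continuous_tangentProj u).inner continuous_const

theorem continuous_defect (hF : IsFreeBoundaryMinimal (k := k) F p R) (y : Ambient n) :
    Continuous (defect F y) :=
  continuous_const.sub (hF.smooth.continuous.inner continuous_const)

theorem defect_eq (hF : IsFreeBoundaryMinimal (k := k) F p R) (hy : ‖y‖ = 1) (x : M) :
    defect F y x = ‖F x - y‖ ^ 2 / 2 := by
  rw [@norm_sub_sq_real, hF.norm_eq_one, hy, defect]
  ring

theorem defect_nonneg (hF : IsFreeBoundaryMinimal (k := k) F p R) (hy : ‖y‖ = 1) (x : M) :
    0 ≤ defect F y x := by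
  rw [hF.defect_eq hy]; positivity

theorem defect_eq_zero_iff (hF : IsFreeBoundaryMinimal (k := k) F p R) (hy : ‖y‖ = 1) {x : M} :
    defect F y x = 0 ↔ F x = y := by
  rw [hF.defect_eq hy, div_eq_zero_iff]
  simp [sub_eq_zero]

theorem cos_le_inner (hF : IsFreeBoundaryMinimal (k := k) F p R) (hp : ‖p‖ = 1) (hR0 : 0 < R)
    (hR : R ≤ Real.pi / 2) (x : M) : Real.cos R ≤ inner ℝ (F x) p := by
  have h1 := (hF.mem_ball x).2
  have h2 : inner ℝ (F x) p = Real.cos (geodesicDist p (F x)) := by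
    rw [geodesicDist, InnerProductGeometry.cos_angle, hp, hF.norm_eq_one, real_inner_comm]
    simp
  rw [h2]
  exact Real.cos_le_cos_of_nonneg_of_le_pi (InnerProductGeometry.angle_nonneg _ _)
    (by linarith [Real.pi_pos]) h1

theorem inner_le_one (hF : IsFreeBoundaryMinimal (k := k) F p R) {q : Ambient n} (hq : ‖q‖ = 1)
    (x : M) : inner ℝ (F x) q ≤ 1 := by
  simpa [hF.norm_eq_one, hq] using real_inner_le_norm (F x) q

/-- The upper bound for w is the Cauchy–Schwarz inequality for the components of F x and y
orthogonal to p, whose squared norms are 1 − X² ≤ 1 − a² and 1 − a², together with X ≥ a. -/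
theorem mem_region (hF : IsFreeBoundaryMinimal (k := k) F p R) (hp : ‖p‖ = 1) (hR0 : 0 < R)
    (hR : R ≤ Real.pi / 2) (hy : ‖y‖ = 1) (hyp : inner ℝ y p = Real.cos R) (x : M) :
    (defect F y x, inner ℝ (F x) p) ∈ region (Real.cos R) := by
  have ha : 0 ≤ Real.cos R := Real.cos_nonneg_of_neg_pi_div_two_le_of_le (by linarith) hR
  have hX := hF.cos_le_inner hp hR0 hR x
  have hX1 := hF.inner_le_one hp x
  refine ⟨hF.defect_nonneg hy x, ?_, hX, hX1⟩
  set a := Real.cos R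
  set X : ℝ := inner ℝ (F x) p with hXd
  have hpp : inner ℝ p p = (1 : ℝ) := by rw [real_inner_self_eq_norm_sq, hp]; norm_num
  have hyy : inner ℝ y y = (1 : ℝ) := by rw [real_inner_self_eq_norm_sq, hy]; norm_num
  have hFF : inner ℝ (F x) (F x) = (1 : ℝ) := by
    rw [real_inner_self_eq_norm_sq, hF.norm_eq_one]; norm_num
  have h1 := real_inner_mul_inner_self_le (F x - X • p) (y - a • p)
  have h2 : inner ℝ (F x - X • p) (y - a • p) = inner ℝ (F x) y - a * X := by
    simp only [inner_sub_left, inner_sub_right, inner_smul_left, inner_smul_right, conj_trivial,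
      hpp, real_inner_comm y p, hyp]
    ring
  have h3 : inner ℝ (F x - X • p) (F x - X • p) = 1 - X ^ 2 := by
    simp only [inner_sub_left, inner_sub_right, inner_smul_left, inner_smul_right, conj_trivial,
      hpp, hFF, real_inner_comm (F x) p, ← hXd]
    ring
  have h4 : inner ℝ (y - a • p) (y - a • p) = 1 - a ^ 2 := by
    simp only [inner_sub_left, inner_sub_right, inner_smul_left, inner_smul_right, conj_trivial,
      hpp, hyy, real_inner_comm y p, hyp]
    ring
  rw [h2, h3, h4] at h1
  have ha1 : 0 ≤ 1 - a ^ 2 := by nlinarith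
  have h5 : (inner ℝ (F x) y - a * X) ^ 2 ≤ (1 - a ^ 2) ^ 2 := by
    rw [sq, sq (1 - a ^ 2)]
    exact h1.trans (by gcongr)
  have h6 := (abs_le_of_sq_le_sq' h5 ha1).1
  change 1 - inner ℝ (F x) y ≤ 2 * (1 - a ^ 2)
  nlinarith

variable [MeasurableSpace M] [BorelSpace M]

theorem integrable_of_continuous (hF : IsFreeBoundaryMinimal (k := k) F p R) {f : M → ℝ}
    (hf : Continuous f) : Integrable f (volumeMeasure k F) := by
  have := hF.isFiniteMeasure
  exact hf.integrable_of_hasCompactSupport (HasCompactSupport.of_compactSpace _)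

/-- The divergence theorem for the tangential part of the field
`(w + ε)^(-j) (A y + B p)` with `w = 1 - ⟪q, y⟫`. -/
theorem integral_weighted_divergence (hF : IsFreeBoundaryMinimal (k := k) F p R) (hp : ‖p‖ = 1)
    (hR0 : 0 < R) (hR : R ≤ Real.pi / 2) (hy : ‖y‖ = 1) (hyp : inner ℝ y p = Real.cos R)
    {A B : Ambient n → ℝ} {A' B' : M → Ambient n →L[ℝ] ℝ}
    (hA : ∀ x, HasFDerivAt A (A' x) (F x)) (hB : ∀ x, HasFDerivAt B (B' x) (F x))
    (hA' : Continuous A') (hB' : Continuous B')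
    (hbd : ∀ x ∈ (𝓡∂ k).boundary M,
      Real.cos R * defect F y x * A (F x) + (1 - Real.cos R ^ 2) * B (F x) = 0)
    (j : ℕ) {ε : ℝ} (hε : 0 < ε) :
    Continuous (fun x => ((defect F y x + ε) ^ j)⁻¹ *
        (A' x (tangentProj k F x y) + B' x (tangentProj k F x p) -
        k * (A (F x) * (1 - defect F y x) + B (F x) * inner ℝ (F x) p)) +
      j * ((defect F y x + ε) ^ (j + 1))⁻¹ *
        (A (F x) * tau k F y y x + B (F x) * tau k F y p x)) ∧
    ∫ x, (((defect F y x + ε) ^ j)⁻¹ * (A' x (tangentProj k F x y) + B' x (tangentProj k F x p) -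
        k * (A (F x) * (1 - defect F y x) + B (F x) * inner ℝ (F x) p)) +
      j * ((defect F y x + ε) ^ (j + 1))⁻¹ * (A (F x) * tau k F y y x + B (F x) * tau k F y p x))
      ∂(volumeMeasure k F) = 0 := by
  have hpos : ∀ x, 0 < defect F y x + ε := fun x => by linarith [hF.defect_nonneg hy x]
  set N : Ambient n → ℝ := fun q => ((1 - inner ℝ q y + ε) ^ j)⁻¹ with hN
  set N' : M → Ambient n →L[ℝ] ℝ := fun x =>
    (j * ((defect F y x + ε) ^ (j + 1))⁻¹) • innerSL ℝ y with hN'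
  have hNd : ∀ x, HasFDerivAt N (N' x) (F x) := by
    intro x
    have h0 : HasFDerivAt (fun q : Ambient n => 1 - inner ℝ q y + ε) (-(innerSL ℝ y)) (F x) := by
      have : HasFDerivAt (fun q : Ambient n => inner ℝ y q) (innerSL ℝ y) (F x) :=
        (innerSL ℝ y).hasFDerivAt
      simpa only [real_inner_comm] using (this.const_sub 1).add_const ε
    have h1 : HasDerivAt (fun s : ℝ => (s ^ j)⁻¹)
        (-(j * ((defect F y x + ε) ^ (j + 1))⁻¹)) (defect F y x + ε) := by
      have hne := (hpos x).ne'
      have h := (hasDerivAt_pow j (defect F y x + ε)).inv (pow_ne_zero _ hne)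
      refine h.congr_deriv ?_
      rcases j with _ | j
      · simp
      · have e1 : (defect F y x + ε) ^ (j + 1) ≠ 0 := pow_ne_zero _ hne
        simp only [Nat.add_sub_cancel, Nat.cast_add, Nat.cast_one]
        field_simp
        ring
    have h2 := h1.comp_hasFDerivAt (F x) h0
    refine h2.congr_fderiv ?_
    simp only [hN', smul_neg, neg_smul, neg_neg]
  have hdc := hF.continuous_defect y
  have hFc := hF.smooth.continuous
  have hNc : Continuous fun x => N (F x) :=
    Continuous.inv₀ ((hdc.add continuous_const).pow j) fun x => pow_ne_zero _ (hpos x).ne'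
  have hN'c : Continuous N' :=
    (continuous_const.mul (Continuous.inv₀ ((hdc.add continuous_const).pow (j + 1))
      fun x => pow_ne_zero _ (hpos x).ne')).smul continuous_const
  have hN''c : Continuous fun x => ((defect F y x + ε) ^ (j + 1))⁻¹ :=
    Continuous.inv₀ ((hdc.add continuous_const).pow (j + 1)) fun x => pow_ne_zero _ (hpos x).ne'
  have hcomp : ∀ {G : Ambient n → ℝ} {G' : M → Ambient n →L[ℝ] ℝ},
      (∀ x, HasFDerivAt G (G' x) (F x)) → Continuous fun x => G (F x) := fun hG =>
    continuous_iff_continuousAt.2 fun x =>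
      ContinuousAt.comp (g := _) (hG x).continuousAt hFc.continuousAt
  refine ⟨?_, ?_⟩
  · exact (hNc.mul (((hA'.clm_apply (hF.continuous_tangentProj y)).add
      (hB'.clm_apply (hF.continuous_tangentProj p))).sub (continuous_const.mul
      (((hcomp hA).mul (continuous_const.sub hdc)).add
        ((hcomp hB).mul (hFc.inner continuous_const)))))).add
      ((continuous_const.mul hN''c).mul (((hcomp hA).mul (hF.continuous_tau y y)).add
        ((hcomp hB).mul (hF.continuous_tau y p))))
  have key := hF.integral_divergence (ι := Fin 2) hp hR0 hR
    (φ := ![fun q => A q * N q, fun q => B q * N q])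
    (φ' := ![fun x => A (F x) • N' x + N (F x) • A' x, fun x => B (F x) • N' x + N (F x) • B' x])
    ![y, p] (by
      rw [Fin.forall_fin_two]
      exact ⟨fun x => (hA x).mul (hNd x), fun x => (hB x).mul (hNd x)⟩)
    (by
      rw [Fin.forall_fin_two]
      exact ⟨((hcomp hA).smul hN'c).add (hNc.smul hA'), ((hcomp hB).smul hN'c).add (hNc.smul hB')⟩)
    (by
      intro x hx
      have h1 := hbd x hx
      have h2 := hF.cos_eq_inner hp hx
      have hpp : inner ℝ p p = (1 : ℝ) := by rw [real_inner_self_eq_norm_sq, hp]; norm_num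
      have h3 : inner ℝ p (F x) = Real.cos R := by rw [real_inner_comm, h2]
      have h4 : inner ℝ y (F x) = 1 - defect F y x := by rw [defect, real_inner_comm]; ring
      simp only [Fin.sum_univ_two, Matrix.cons_val_zero, Matrix.cons_val_one,
        inner_add_left, inner_sub_right, inner_smul_left, inner_smul_right, conj_trivial, hpp, h3,
        h4, hyp]
      linear_combination (-N (F x)) * h1)
  rw [← key]
  refine integral_congr_ae (Eventually.of_forall fun x => ?_)
  simp only [Fin.sum_univ_two, Matrix.cons_val_zero, Matrix.cons_val_one]
  have h4 : inner ℝ y (F x) = 1 - defect F y x := by rw [defect, real_inner_comm]; ring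
  have e1 : inner ℝ y (tangentProj k F x y) = tau k F y y x := by rw [tau, real_inner_comm]
  have e2 : inner ℝ y (tangentProj k F x p) = tau k F y p x := by
    rw [tau_comm, tau, real_inner_comm]
  have e3 : N (F x) = ((defect F y x + ε) ^ j)⁻¹ := rfl
  simp only [add_apply, smul_apply, smul_eq_mul, hN', innerSL_apply_apply, e1, e2, e3, h4,
    real_inner_comm (F x) p]
  ring

theorem tau_self_le_defect (hF : IsFreeBoundaryMinimal (k := k) F p R) (hy : ‖y‖ = 1)
    (x : M) : tau k F y y x ≤ 2 * defect F y x := by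
  have h := hF.tau_eq y y x
  rw [real_inner_self_eq_norm_sq, hy, real_inner_self_eq_norm_sq] at h
  rw [h, defect]
  nlinarith [sq_nonneg (1 - inner ℝ (F x) y), sq_nonneg ‖normalPart k F y x‖]

theorem tau_sq_le_defect (hF : IsFreeBoundaryMinimal (k := k) F p R) (hp : ‖p‖ = 1)
    (hy : ‖y‖ = 1) (x : M) : tau k F y p x ^ 2 ≤ 2 * defect F y x := by
  refine (tau_sq_le y p x).trans ?_
  have h1 := tau_self_le (k := k) (F := F) p x
  rw [hp] at h1
  have h2 := hF.tau_self_le_defect hy x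
  nlinarith [tau_self_nonneg (k := k) (F := F) y x, tau_self_nonneg (k := k) (F := F) p x]

/-- The leading coefficient is −k + 2(j + 1) ≤ −2. One unit of it absorbs the cross terms c|s|,
which are O(√w), by the arithmetic-geometric inequality; all other terms carry a factor w and lower
the power by one. -/
theorem _root_.SphereFreeBoundary.divergence_pow_le {k j : ℕ} (hj : 2 * (j + 1) + 2 ≤ k)
    {c w ε X s t : ℝ} (hc0 : 0 ≤ c)
    (hw : 0 ≤ w) (hε : 0 < ε) (hX1 : X ≤ 1) (hs2 : s ^ 2 ≤ 2 * w) (ht2 : t ≤ 2 * w) :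
    ((w + ε) ^ (j + 1))⁻¹ * (0 + c * s - k * (1 * (1 - w) + -c * w * X)) +
      (j + 1 : ℕ) * ((w + ε) ^ (j + 1 + 1))⁻¹ * (1 * t + -c * w * s) ≤
      -((w + ε) ^ (j + 1))⁻¹ + (k + k * c + c ^ 2 * (j + 2) ^ 2) * ((w + ε) ^ j)⁻¹ := by
  have hwe : 0 < w + ε := by linarith
  have e5 : ((w + ε) ^ (j + 1 + 1))⁻¹ * w ≤ ((w + ε) ^ (j + 1))⁻¹ := by
    rw [pow_succ (w + ε) (j + 1), mul_inv, mul_assoc]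
    refine mul_le_of_le_one_right (by positivity) ?_
    rw [inv_mul_le_iff₀ hwe]; linarith
  have e6 : ((w + ε) ^ (j + 1))⁻¹ * w ≤ ((w + ε) ^ j)⁻¹ := by
    rw [pow_succ (w + ε) j, mul_inv, mul_assoc]
    refine mul_le_of_le_one_right (by positivity) ?_
    rw [inv_mul_le_iff₀ hwe]; linarith
  have hn2' : 0 ≤ ((w + ε) ^ (j + 1 + 1))⁻¹ := by positivity
  have hn1' : 0 ≤ ((w + ε) ^ (j + 1))⁻¹ := by positivity
  generalize ((w + ε) ^ (j + 1 + 1))⁻¹ = n2 at *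
  generalize ((w + ε) ^ (j + 1))⁻¹ = n1 at *
  generalize ((w + ε) ^ j)⁻¹ = n0 at *
  have hcs : c * |s| * (j + 2) ≤ 1 + c ^ 2 * (j + 2) ^ 2 * w := by
    have h1 := mul_le_mul_of_nonneg_left hs2 (sq_nonneg (c * (j + 2 : ℝ)))
    have h2 := sq_nonneg (c * |s| * (j + 2) - 1)
    have h3 : (c * |s| * (j + 2)) ^ 2 = (c * (j + 2)) ^ 2 * s ^ 2 := by rw [← sq_abs s]; ring
    linarith
  have hk : (2 * (j + 1) + 2 : ℝ) ≤ k := by exact_mod_cast hj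
  have hj1 : (0 : ℝ) ≤ j + 1 := by positivity
  have t1 : (j + 1 : ℝ) * (n2 * t) ≤ (j + 1) * (2 * n1) := by
    have : n2 * t ≤ n2 * (2 * w) := by gcongr
    exact mul_le_mul_of_nonneg_left (by linarith) hj1
  have t2 : (j + 1 : ℝ) * n2 * (-c * w * s) ≤ (j + 1) * n1 * (c * |s|) := by
    calc (j + 1 : ℝ) * n2 * (-c * w * s) = (j + 1) * (n2 * w) * (c * (-s)) := by ring
      _ ≤ (j + 1) * (n2 * w) * (c * |s|) := by
          gcongr; exact neg_le_abs s
      _ ≤ _ := by gcongr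
  have t3 : n1 * (c * s) ≤ n1 * (c * |s|) := by gcongr; exact le_abs_self s
  have t4 := mul_le_mul_of_nonneg_left hcs hn1'
  have t5 : (k * c : ℝ) * (n1 * w * X) ≤ k * c * (n1 * w * 1) := by gcongr
  have t6 : (k + k * c + c ^ 2 * (j + 2) ^ 2) * (n1 * w) ≤
      (k + k * c + c ^ 2 * (j + 2) ^ 2) * n0 := by gcongr
  have t7 : n1 * (2 * (j + 1) + 2) ≤ n1 * k := by gcongr
  push_cast
  linarith

section Integrability

variable (hF : IsFreeBoundaryMinimal (k := k) F p R) (hp : ‖p‖ = 1)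
  (hR0 : 0 < R) (hR : R ≤ Real.pi / 2) (hy : ‖y‖ = 1) (hyp : inner ℝ y p = Real.cos R)
include hF hp hR0 hR hy hyp

/-- Induction on the power, testing with (w + ε)^(−j−1) (y − c w p); the value c = a/(1 − a²) makes
the field tangent to the geodesic sphere. For k = 2κ the induction reaches the power κ − 1. This
takes the place of an area growth bound near y. -/
theorem exists_integral_pow_le (j : ℕ) (hj : 2 * j + 2 ≤ k) :
    ∃ C, ∀ ε : ℝ, 0 < ε → ε ≤ 1 →
      ∫ x, ((defect F y x + ε) ^ j)⁻¹ ∂(volumeMeasure k F) ≤ C := by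
  have := hF.isFiniteMeasure
  induction j with
  | zero => exact ⟨∫ _, ((1 : ℝ))⁻¹ ∂(volumeMeasure k F), fun ε _ _ => by simp only [pow_zero]; exact le_rfl⟩
  | succ j ih => 
    obtain ⟨C, hC⟩ := ih (by omega)
    set a := Real.cos R with ha
    have ha0 : 0 ≤ a := Real.cos_nonneg_of_neg_pi_div_two_le_of_le (by linarith) hR
    have ha1 : a < 1 := by
      rw [ha, ← Real.cos_zero]
      exact Real.cos_lt_cos_of_nonneg_of_le_pi le_rfl (by linarith [Real.pi_pos]) hR0
    have hb := one_sub_sq_pos ha0 ha1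
    set c := a / (1 - a ^ 2) with hc
    have hc0 : 0 ≤ c := by positivity
    have hcb : c * (1 - a ^ 2) = a := by rw [hc]; field_simp
    have hpos : ∀ x, 0 ≤ defect F y x := hF.defect_nonneg hy
    have hdc := hF.continuous_defect y
    set K : ℝ := k + k * c + c ^ 2 * (j + 2) ^ 2 with hK
    have hK0 : 0 ≤ K := by positivity
    refine ⟨K * C, fun ε hε hε1 => ?_⟩
    have hint : ∀ i : ℕ, Integrable (fun x => ((defect F y x + ε) ^ i)⁻¹) (volumeMeasure k F) :=
      fun i => hF.integrable_of_continuous (Continuous.inv₀ ((hdc.add continuous_const).pow i)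
        fun x => pow_ne_zero _ (add_pos_of_nonneg_of_pos (hpos x) hε).ne')
    have key := hF.integral_weighted_divergence hp hR0 hR hy hyp
      (A := fun _ => 1) (A' := fun _ => 0) (B := fun q => -c * (1 - inner ℝ q y))
      (B' := fun _ => c • innerSL ℝ y) (fun x => hasFDerivAt_const _ _)
      (fun x => by
        have : HasFDerivAt (fun q : Ambient n => inner ℝ y q) (innerSL ℝ y) (F x) :=
          (innerSL ℝ y).hasFDerivAt
        have h2 := (this.const_sub 1).const_mul (-c)
        simp only [real_inner_comm _ y] at h2
        exact h2.congr_fderiv (by simp))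
      continuous_const continuous_const
      (fun x _ => by
        change a * defect F y x * 1 + (1 - a ^ 2) * (-c * defect F y x) = 0
        linear_combination (-defect F y x) * hcb) (j + 1) hε
    have hle : ∀ x, ((defect F y x + ε) ^ (j + 1))⁻¹ * ((0 : Ambient n →L[ℝ] ℝ)
        (tangentProj k F x y) + (c • innerSL ℝ y) (tangentProj k F x p) -
        k * (1 * (1 - defect F y x) + -c * (1 - inner ℝ (F x) y) * inner ℝ (F x) p)) +
      (j + 1 : ℕ) * ((defect F y x + ε) ^ (j + 1 + 1))⁻¹ * (1 * tau k F y y x +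
        -c * (1 - inner ℝ (F x) y) * tau k F y p x) ≤
        -((defect F y x + ε) ^ (j + 1))⁻¹ + K * ((defect F y x + ε) ^ j)⁻¹ := by
      intro x
      have e2 : inner ℝ y (tangentProj k F x p) = tau k F y p x := by
        rw [tau_comm, tau, real_inner_comm]
      have e4 : 1 - inner ℝ (F x) y = defect F y x := rfl
      simp only [smul_apply, zero_apply, innerSL_apply_apply, e2, e4, smul_eq_mul]
      exact divergence_pow_le hj hc0 (hpos x) hε
        (hF.inner_le_one hp x) (hF.tau_sq_le_defect hp hy x) (hF.tau_self_le_defect hy x)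
    have h1 := integral_mono (hF.integrable_of_continuous key.1)
      ((hint (j + 1)).neg.add ((hint j).const_mul K)) hle
    rw [key.2] at h1
    change 0 ≤ ∫ x, (-((defect F y x + ε) ^ (j + 1))⁻¹ + K * ((defect F y x + ε) ^ j)⁻¹) ∂_ at h1
    have h3 : ∫ x, (-((defect F y x + ε) ^ (j + 1))⁻¹ + K * ((defect F y x + ε) ^ j)⁻¹)
        ∂(volumeMeasure k F) = -∫ x, ((defect F y x + ε) ^ (j + 1))⁻¹ ∂(volumeMeasure k F) +
        K * ∫ x, ((defect F y x + ε) ^ j)⁻¹ ∂(volumeMeasure k F) := by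
      rw [← integral_const_mul, ← integral_neg]
      exact integral_add (hint (j + 1)).neg ((hint j).const_mul K)
    rw [h3] at h1
    have h2 := mul_le_mul_of_nonneg_left (hC ε hε hε1) hK0
    linarith

/-- The preimage of y contributes ε⁻¹ times its measure to the integral of (w + ε)⁻¹, which stays
bounded as ε → 0. -/
theorem ae_defect_pos (hk : 4 ≤ k) : ∀ᵐ x ∂(volumeMeasure k F), 0 < defect F y x := by
  have := hF.isFiniteMeasure
  obtain ⟨C, hC⟩ := hF.exists_integral_pow_le hp hR0 hR hy hyp 1 (by omega)
  have hdc := hF.continuous_defect y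
  have hpos : ∀ x, 0 ≤ defect F y x := hF.defect_nonneg hy
  set s : Set M := {x | defect F y x = 0} with hs
  have hsm : MeasurableSet s := (isClosed_eq hdc continuous_const).measurableSet
  have h1 : ∀ ε : ℝ, 0 < ε → ε ≤ 1 → (volumeMeasure k F).real s ≤ C * ε := by
    intro ε hε hε1
    have hint := hF.integrable_of_continuous (f := fun x => ((defect F y x + ε) ^ 1)⁻¹)
      (Continuous.inv₀ ((hdc.add continuous_const).pow 1)
        fun x => pow_ne_zero _ (add_pos_of_nonneg_of_pos (hpos x) hε).ne')
    have h2 := setIntegral_le_integral (s := s) hint (Eventually.of_forall fun x => by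
      have := hpos x
      change 0 ≤ ((defect F y x + ε) ^ 1)⁻¹
      positivity)
    rw [setIntegral_congr_fun (g := fun _ => ε⁻¹) hsm fun x hx => by
      simp only [show defect F y x = 0 from hx, zero_add, pow_one], setIntegral_const,
      smul_eq_mul] at h2
    have h3 := h2.trans (hC ε hε hε1)
    rwa [← div_eq_mul_inv, div_le_iff₀ hε] at h3
  have h2 : (volumeMeasure k F).real s ≤ 0 := by
    have h3 : Tendsto (fun ε : ℝ => C * ε) (𝓝[>] 0) (𝓝 0) := by
      have : Tendsto (fun ε : ℝ => C * ε) (𝓝 0) (𝓝 (C * 0)) :=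
        (continuous_const.mul continuous_id).tendsto 0
      rw [mul_zero] at this
      exact this.mono_left nhdsWithin_le_nhds
    refine ge_of_tendsto h3 ?_
    filter_upwards [Ioc_mem_nhdsGT (zero_lt_one (α := ℝ))] with ε hε using h1 ε hε.1 hε.2
  have h3 : volumeMeasure k F s = 0 := by
    rw [← measureReal_eq_zero_iff]
    exact le_antisymm h2 measureReal_nonneg
  filter_upwards [compl_mem_ae_iff.2 h3] with x hx
  exact lt_of_le_of_ne (hpos x) (Ne.symm hx)

theorem integrable_defect_pow_inv (hk : 4 ≤ k) (j : ℕ) (hj : 2 * j + 2 ≤ k) :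
    Integrable (fun x => ((defect F y x) ^ j)⁻¹) (volumeMeasure k F) := by
  obtain ⟨C, hC⟩ := hF.exists_integral_pow_le hp hR0 hR hy hyp j hj
  have hdc := hF.continuous_defect y
  have hpos : ∀ x, 0 ≤ defect F y x := hF.defect_nonneg hy
  have hm : Measurable fun x => ((defect F y x) ^ j)⁻¹ := (hdc.measurable.pow_const j).inv
  refine ⟨hm.aestronglyMeasurable, ?_⟩
  rw [hasFiniteIntegral_iff_ofReal (Eventually.of_forall fun x =>
    inv_nonneg.2 (pow_nonneg (hpos x) j))]
  set f : ℕ → M → ℝ≥0∞ := fun m x =>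
    ENNReal.ofReal ((defect F y x + 1 / ((m : ℝ) + 1)) ^ j)⁻¹ with hf
  have hfm : ∀ m, Measurable (f m) := fun m =>
    (((hdc.measurable.add_const _).pow_const j).inv).ennreal_ofReal
  have hlim : ∀ᵐ x ∂(volumeMeasure k F),
      liminf (fun m => f m x) atTop = ENNReal.ofReal ((defect F y x) ^ j)⁻¹ := by
    filter_upwards [hF.ae_defect_pos hp hR0 hR hy hyp hk] with x hx
    refine Tendsto.liminf_eq (ENNReal.tendsto_ofReal ?_)
    have h1 : Tendsto (fun m : ℕ => defect F y x + 1 / ((m : ℝ) + 1)) atTop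
        (𝓝 (defect F y x + 0)) := tendsto_const_nhds.add tendsto_one_div_add_atTop_nhds_zero_nat
    rw [add_zero] at h1
    exact (h1.pow j).inv₀ (pow_ne_zero _ hx.ne')
  calc ∫⁻ x, ENNReal.ofReal ((defect F y x) ^ j)⁻¹ ∂(volumeMeasure k F)
      = ∫⁻ x, liminf (fun m => f m x) atTop ∂(volumeMeasure k F) :=
        lintegral_congr_ae (hlim.mono fun x hx => hx.symm)
    _ ≤ liminf (fun m => ∫⁻ x, f m x ∂(volumeMeasure k F)) atTop := lintegral_liminf_le hfm
    _ ≤ ENNReal.ofReal C := by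
        refine liminf_le_of_le (by isBoundedDefault) fun b hb => ?_
        obtain ⟨m, hm⟩ := hb.exists
        refine hm.trans ?_
        have hε : (0 : ℝ) < 1 / ((m : ℝ) + 1) := by positivity
        have hint := hF.integrable_of_continuous
          (f := fun x => ((defect F y x + 1 / ((m : ℝ) + 1)) ^ j)⁻¹)
          (Continuous.inv₀ ((hdc.add continuous_const).pow j)
          fun x => pow_ne_zero _ (add_pos_of_nonneg_of_pos (hpos x) hε).ne')
        rw [← ofReal_integral_eq_lintegral_ofReal hint (Eventually.of_forall fun x => by
          have := hpos x
          change 0 ≤ ((defect F y x + 1 / ((m : ℝ) + 1)) ^ j)⁻¹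
          positivity)]
        refine ENNReal.ofReal_le_ofReal (hC _ hε ?_)
        rw [div_le_one (by positivity)]
        linarith [(Nat.cast_nonneg m : (0 : ℝ) ≤ m)]
    _ < ⊤ := ENNReal.ofReal_lt_top

end Integrability

end IsFreeBoundaryMinimal


end

/-! ### The volume of a geodesic ball of the model sphere. -/

section

open Filter Topology Set Metric

section Model

variable {k : ℕ}

/-- The decomposition `ℝ × ℝᵏ → ℝ^{k+1}`. -/
def consMap (k : ℕ) (q : ℝ × EuclideanSpace ℝ (Fin k)) : EuclideanSpace ℝ (Fin (k + 1)) :=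
  WithLp.toLp 2 ((MeasurableEquiv.piFinSuccAbove (fun _ => ℝ) 0).symm (q.1, WithLp.ofLp q.2))

theorem measurePreserving_consMap : MeasurePreserving (consMap k) := by
  have hA : MeasurePreserving (Prod.map id WithLp.ofLp :
      ℝ × EuclideanSpace ℝ (Fin k) → ℝ × (Fin k → ℝ)) :=
    (MeasurePreserving.id volume).prod (PiLp.volume_preserving_ofLp (Fin k))
  exact (PiLp.volume_preserving_toLp (Fin (k + 1))).comp
    ((volume_preserving_piFinSuccAbove (fun _ => ℝ) 0).symm.comp hA)

theorem consMap_zero (q : ℝ × EuclideanSpace ℝ (Fin k)) : consMap k q 0 = q.1 := by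
  simp [consMap]

theorem norm_consMap_sq (q : ℝ × EuclideanSpace ℝ (Fin k)) :
    ‖consMap k q‖ ^ 2 = q.1 ^ 2 + ‖q.2‖ ^ 2 := by
  rw [EuclideanSpace.norm_sq_eq, EuclideanSpace.norm_sq_eq, Fin.sum_univ_succ]
  simp [consMap]

theorem mem_sector_iff {a : ℝ} (ha : 0 ≤ a) {q : ℝ × EuclideanSpace ℝ (Fin k)}
    (hq : 0 < q.1) : (0 < ‖consMap k q‖ ∧ ‖consMap k q‖ < 1 ∧ a * ‖consMap k q‖ ≤ consMap k q 0) ↔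
      ‖q.2‖ ^ 2 < 1 - q.1 ^ 2 ∧ a ^ 2 * ‖q.2‖ ^ 2 ≤ q.1 ^ 2 * (1 - a ^ 2) := by
  have h := norm_consMap_sq q
  rw [consMap_zero]
  have hn := norm_nonneg (consMap k q)
  constructor
  · rintro ⟨-, h2, h3⟩
    constructor
    · nlinarith
    · have := pow_le_pow_left₀ (by positivity) h3 2
      rw [mul_pow, h] at this
      linarith
  · rintro ⟨h2, h3⟩
    refine ⟨?_, ?_, ?_⟩
    · refine lt_of_le_of_ne hn fun h0 => ?_
      rw [← h0] at h
      nlinarith [sq_nonneg ‖q.2‖, mul_pos hq hq]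
    · refine lt_of_pow_lt_pow_left₀ 2 zero_le_one ?_
      rw [h]; linarith
    · refine le_of_pow_le_pow_left₀ two_ne_zero hq.le ?_
      rw [mul_pow, h]; linarith

/-- The cap has k + 1 times the volume of the solid sector over it, and the sector is sliced
orthogonally to its axis. Below height a the slices are bounded by the cone, above it by the unit
sphere; the conical part integrates to a (1 − a²)^κ/(2κ + 1) times the volume of the unit ball. -/
theorem ballVolume_eq {κ : ℕ} (hκ : 0 < κ) {R : ℝ} (hR0 : 0 < R) (hR : R ≤ Real.pi / 2) :
    ballVolume (2 * κ) R = ENNReal.ofReal (Real.cos R * (1 - Real.cos R ^ 2) ^ κ +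
      (2 * κ + 1) * ∫ s in Real.cos R..1, (1 - s ^ 2) ^ κ) *
      volume (ball (0 : EuclideanSpace ℝ (Fin (2 * κ))) 1) := by
  set a := Real.cos R with ha
  have ha0 : 0 ≤ a := Real.cos_nonneg_of_neg_pi_div_two_le_of_le (by linarith) hR
  have ha1 : a < 1 := by
    rw [ha, ← Real.cos_zero]
    exact Real.cos_lt_cos_of_nonneg_of_le_pi le_rfl (by linarith [Real.pi_pos]) hR0
  have hb := one_sub_sq_pos ha0 ha1
  set k := 2 * κ with hk
  have : NeZero k := ⟨by omega⟩
  set C : Set (Ambient k) := {z | 0 < ‖z‖ ∧ ‖z‖ < 1 ∧ a * ‖z‖ ≤ z 0} with hC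
  have hCm : MeasurableSet C := by
    have h1 : Measurable fun z : Ambient k => z 0 :=
      (EuclideanSpace.proj (𝕜 := ℝ) (0 : Fin (k + 1))).continuous.measurable
    exact (measurableSet_lt measurable_const measurable_norm).inter
      ((measurableSet_lt measurable_norm measurable_const).inter
        (measurableSet_le (measurable_norm.const_mul a) h1))
  have hcap : ∀ q : Ambient k, ‖q‖ = 1 →
      (geodesicDist (EuclideanSpace.single 0 1 : Ambient k) q ≤ R ↔ a ≤ q 0) := by
    intro q hq
    have h1 : Real.cos (geodesicDist (EuclideanSpace.single 0 1 : Ambient k) q) = q 0 := by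
      rw [geodesicDist, InnerProductGeometry.cos_angle, hq, EuclideanSpace.inner_single_left]
      simp
    rw [← h1, ha]
    exact (Real.strictAntiOn_cos.le_iff_ge ⟨hR0.le, by linarith [Real.pi_pos]⟩
      ⟨InnerProductGeometry.angle_nonneg _ _, InnerProductGeometry.angle_le_pi _ _⟩).symm
  have h1 : ballVolume k R = (k + 1 : ℕ) * volume C := by
    rw [ballVolume, Measure.toSphere_apply', finrank_euclideanSpace_fin]
    · congr 2
      ext z
      rw [Set.mem_smul]
      constructor
      · rintro ⟨r, hr, _, ⟨⟨q, hq⟩, hqR, rfl⟩, rfl⟩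
        have hq1 : ‖q‖ = 1 := by simpa using hq
        have hn : ‖r • q‖ = r := by rw [norm_smul, hq1, Real.norm_of_nonneg hr.1.le, mul_one]
        refine ⟨by rw [hn]; exact hr.1, by rw [hn]; exact hr.2, ?_⟩
        change a * ‖r • q‖ ≤ (r • q) 0
        rw [hn, PiLp.smul_apply, smul_eq_mul, mul_comm]
        exact mul_le_mul_of_nonneg_left ((hcap q hq1).1 hqR) hr.1.le
      · rintro ⟨h1, h2, h3⟩
        have hn : ‖‖z‖⁻¹ • z‖ = 1 := by
          rw [norm_smul, norm_inv, norm_norm, inv_mul_cancel₀ h1.ne']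
        refine ⟨‖z‖, ⟨h1, h2⟩, ‖z‖⁻¹ • z, ⟨⟨‖z‖⁻¹ • z, by simpa using hn⟩, ?_, rfl⟩, ?_⟩
        · refine (hcap _ hn).2 ?_
          rw [PiLp.smul_apply, smul_eq_mul, ← div_eq_inv_mul, le_div_iff₀ h1]
          exact h3
        · exact smul_inv_smul₀ h1.ne' z
    · have h1 : Measurable fun z : Ambient k => z 0 :=
        (EuclideanSpace.proj (𝕜 := ℝ) (0 : Fin (k + 1))).continuous.measurable
      have : {q : sphere (0 : Ambient k) 1 | geodesicDist (EuclideanSpace.single 0 1 : Ambient k)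
          (q : Ambient k) ≤ R} = {q : sphere (0 : Ambient k) 1 | a ≤ (q : Ambient k) 0} := by
        ext q
        exact hcap q (by simp)
      rw [this]
      exact measurableSet_le measurable_const (h1.comp measurable_subtype_coe)
  set vB := volume (ball (0 : EuclideanSpace ℝ (Fin k)) 1) with hvB
  have hvB' : vB < ⊤ := measure_ball_lt_top
  set g₁ : ℝ → ℝ := fun s => (s ^ 2 * ((1 - a ^ 2) / a ^ 2)) ^ κ with hg₁
  set g₂ : ℝ → ℝ := fun s => (1 - s ^ 2) ^ κ with hg₂
  have hball : ∀ r, 0 ≤ r → volume (ball (0 : EuclideanSpace ℝ (Fin k)) (Real.sqrt r)) =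
      ENNReal.ofReal (r ^ κ) * vB := by
    intro r hr
    rw [Measure.addHaar_ball _ _ (Real.sqrt_nonneg _), finrank_euclideanSpace_fin, hk, pow_mul,
      Real.sq_sqrt hr]
  have hslice : ∀ s : ℝ, s ≠ 0 → s ≠ a → volume (Prod.mk s ⁻¹' (consMap k ⁻¹' C)) =
      (Ioo 0 a).indicator (fun s => ENNReal.ofReal (g₁ s) * vB) s +
      (Ioo a 1).indicator (fun s => ENNReal.ofReal (g₂ s) * vB) s := by
    intro s hs0 hsa
    rcases lt_or_gt_of_ne hs0 with hneg | hpos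
    · have : Prod.mk s ⁻¹' (consMap k ⁻¹' C) = ∅ := by
        ext v
        simp only [mem_preimage, hC, mem_ofPred_eq, mem_empty_iff_false, iff_false, consMap_zero]
        rintro ⟨-, -, h⟩
        nlinarith [mul_nonneg ha0 (norm_nonneg (consMap k (s, v)))]
      rw [this, measure_empty, indicator_of_notMem fun h => by linarith [h.1],
        indicator_of_notMem fun h => by linarith [h.1], add_zero]
    · have hset : Prod.mk s ⁻¹' (consMap k ⁻¹' C) =
          {v | ‖v‖ ^ 2 < 1 - s ^ 2 ∧ a ^ 2 * ‖v‖ ^ 2 ≤ s ^ 2 * (1 - a ^ 2)} := by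
        ext v
        exact mem_sector_iff ha0 (q := (s, v)) hpos
      rw [hset]
      rcases lt_or_gt_of_ne hsa with hlt | hgt
      · have hap : 0 < a := hpos.trans hlt
        rw [indicator_of_mem (show s ∈ Ioo 0 a from ⟨hpos, hlt⟩),
          indicator_of_notMem (fun h => by linarith [h.1]), add_zero]
        have : {v : EuclideanSpace ℝ (Fin k) | ‖v‖ ^ 2 < 1 - s ^ 2 ∧
            a ^ 2 * ‖v‖ ^ 2 ≤ s ^ 2 * (1 - a ^ 2)} =
            closedBall 0 (Real.sqrt (s ^ 2 * ((1 - a ^ 2) / a ^ 2))) := by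
          ext v
          rw [mem_closedBall_zero_iff, Real.le_sqrt (norm_nonneg v), ← mul_div_assoc,
            le_div_iff₀ (by positivity), mul_comm (‖v‖ ^ 2)]
          refine ⟨fun h => h.2, fun h => ⟨?_, h⟩⟩
          have h2 : s ^ 2 < a ^ 2 := by gcongr
          have h3 : a ^ 2 * ‖v‖ ^ 2 < a ^ 2 * (1 - s ^ 2) := by nlinarith
          exact lt_of_mul_lt_mul_left h3 (by positivity)
          positivity
        rw [this, Measure.addHaar_closedBall_eq_addHaar_ball, hball _ (by positivity)]
      · rw [indicator_of_notMem (fun h => by linarith [h.2] : s ∉ Ioo 0 a), zero_add]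
        have hset2 : {v : EuclideanSpace ℝ (Fin k) | ‖v‖ ^ 2 < 1 - s ^ 2 ∧
            a ^ 2 * ‖v‖ ^ 2 ≤ s ^ 2 * (1 - a ^ 2)} = ball 0 (Real.sqrt (1 - s ^ 2)) := by
          ext v
          rw [mem_ball_zero_iff, Real.lt_sqrt (norm_nonneg v)]
          refine ⟨fun h => h.1, fun h => ⟨h, ?_⟩⟩
          have h2 : a ^ 2 ≤ s ^ 2 := by gcongr
          nlinarith [mul_le_mul_of_nonneg_left h.le (sq_nonneg a)]
        rw [hset2]
        by_cases hs1 : s < 1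
        · rw [indicator_of_mem (show s ∈ Ioo a 1 from ⟨hgt, hs1⟩), hball _ (by nlinarith)]
        · rw [indicator_of_notMem (fun h => hs1 h.2), Real.sqrt_eq_zero_of_nonpos (by nlinarith),
            ball_zero, measure_empty]
  have hm₁ : Measurable fun s => ENNReal.ofReal (g₁ s) * vB := by
    have : Measurable g₁ := by fun_prop
    exact this.ennreal_ofReal.mul_const _
  have h2 : volume C = ENNReal.ofReal (∫ s in (0 : ℝ)..a, g₁ s) * vB +
      ENNReal.ofReal (∫ s in a..1, g₂ s) * vB := by
    rw [← measurePreserving_consMap.measure_preimage hCm.nullMeasurableSet]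
    change (volume.prod volume) _ = _
    rw [Measure.prod_apply (measurePreserving_consMap.measurable hCm)]
    have hae : ∀ᵐ s : ℝ, s ≠ 0 ∧ s ≠ a :=
      (Measure.ae_ne volume 0).and (Measure.ae_ne volume a)
    rw [lintegral_congr_ae (hae.mono fun s hs => hslice s hs.1 hs.2),
      lintegral_add_left (hm₁.indicator measurableSet_Ioo), lintegral_indicator measurableSet_Ioo,
      lintegral_indicator measurableSet_Ioo]
    have hI : ∀ (c d : ℝ) (g : ℝ → ℝ), c ≤ d → Continuous g → (∀ s ∈ Ioo c d, 0 ≤ g s) →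
        ∫⁻ s in Ioo c d, ENNReal.ofReal (g s) * vB = ENNReal.ofReal (∫ s in c..d, g s) * vB := by
      intro c d g hcd hg hg0
      rw [lintegral_mul_const _ hg.measurable.ennreal_ofReal, intervalIntegral.integral_of_le hcd,
        integral_Ioc_eq_integral_Ioo, ofReal_integral_eq_lintegral_ofReal]
      · exact (hg.integrableOn_Icc).mono_set Ioo_subset_Icc_self
      · exact (ae_restrict_mem measurableSet_Ioo).mono hg0
    rw [hI 0 a g₁ ha0 (by fun_prop) (fun s _ => by positivity), hI a 1 g₂ ha1.le (by fun_prop)]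
    intro s hs
    have : 0 ≤ 1 - s ^ 2 := by nlinarith [hs.1, hs.2]
    positivity
  have h3 : ∫ s in (0 : ℝ)..a, g₁ s = a * (1 - a ^ 2) ^ κ / (2 * κ + 1) := by
    have : ∀ s, g₁ s = ((1 - a ^ 2) / a ^ 2) ^ κ * s ^ (2 * κ) := fun s => by
      simp only [hg₁]; rw [mul_pow, pow_mul]; ring
    simp only [this]
    rw [intervalIntegral.integral_const_mul, integral_pow]
    rcases ha0.eq_or_lt with h0 | h0
    · rw [← h0]; simp
    · rw [div_pow, ← pow_mul]
      push_cast
      field_simp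
      ring
  have h4 : 0 ≤ ∫ s in a..1, g₂ s := by
    refine intervalIntegral.integral_nonneg ha1.le fun s hs => ?_
    have : 0 ≤ 1 - s ^ 2 := by nlinarith [hs.1, hs.2]
    positivity
  rw [h1, h2, ← add_mul, ← ENNReal.ofReal_add (by rw [h3]; positivity) h4, ← mul_assoc,
    ← ENNReal.ofReal_natCast, ← ENNReal.ofReal_mul (by positivity), h3]
  congr 2
  push_cast
  rw [hk]
  push_cast
  field_simp

theorem integral_one_sub_sq_pow_two (a : ℝ) :
    ∫ s in a..1, (1 - s ^ 2) ^ 2 = 8 / 15 - a + 2 / 3 * a ^ 3 - a ^ 5 / 5 := by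
  have h : ∀ s ∈ uIcc a 1, HasDerivAt (fun s : ℝ => s - 2 / 3 * s ^ 3 + s ^ 5 / 5)
      ((1 - s ^ 2) ^ 2) s := by
    intro s _
    have := ((hasDerivAt_id s).sub ((hasDerivAt_pow 3 s).const_mul (2 / 3))).add
      ((hasDerivAt_pow 5 s).div_const 5)
    refine this.congr_deriv ?_
    norm_num; ring
  rw [intervalIntegral.integral_eq_sub_of_hasDerivAt h
    ((by fun_prop : Continuous fun s : ℝ => (1 - s ^ 2) ^ 2).intervalIntegrable _ _)]
  ring

theorem integral_one_sub_sq_pow_three (a : ℝ) :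
    ∫ s in a..1, (1 - s ^ 2) ^ 3 = 16 / 35 - a + a ^ 3 - 3 / 5 * a ^ 5 + a ^ 7 / 7 := by
  have h : ∀ s ∈ uIcc a 1, HasDerivAt (fun s : ℝ => s - s ^ 3 + 3 / 5 * s ^ 5 - s ^ 7 / 7)
      ((1 - s ^ 2) ^ 3) s := by
    intro s _
    have := (((hasDerivAt_id s).sub (hasDerivAt_pow 3 s)).add
      ((hasDerivAt_pow 5 s).const_mul (3 / 5))).sub ((hasDerivAt_pow 7 s).div_const 7)
    refine this.congr_deriv ?_
    norm_num; ring
  rw [intervalIntegral.integral_eq_sub_of_hasDerivAt h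
    ((by fun_prop : Continuous fun s : ℝ => (1 - s ^ 2) ^ 3).intervalIntegrable _ _)]
  ring

/-- A calibration whose divergence constant is the one of the totally geodesic ball. -/
theorem exists_calibration {κ : ℕ} (hκ : κ = 2 ∨ κ = 3) {a : ℝ} (ha : 0 ≤ a) (ha1 : a < 1) :
    ∃ D, 0 < D ∧ D * (a * (1 - a ^ 2) ^ κ + (2 * κ + 1) * ∫ s in a..1, (1 - s ^ 2) ^ κ) = κ * 2 ^ κ ∧
      ∃ A B Aw Ax Bw Bx, IsCalibration κ a D A B Aw Ax Bw Bx := by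
  have h1 : 0 < 1 - a := by linarith
  rcases hκ with rfl | rfl
  · refine ⟨_, ?_, ?_, exists_calibration_two ha ha1⟩
    · positivity
    · rw [integral_one_sub_sq_pow_two]
      push_cast
      field_simp
      ring
  · refine ⟨_, ?_, ?_, exists_calibration_three ha ha1⟩
    · positivity
    · rw [integral_one_sub_sq_pow_three]
      push_cast
      field_simp
      ring

end Model


end

/-! ### The bubble, and the limit of the concentrating functions. -/

section

open Filter Topology Set Metric

section Bubble

variable {k κ n : ℕ}

/-- The limit of the rescaled concentrating functions, as a function of half of the square of the
norm. -/
def bubble (κ : ℕ) (s : ℝ) : ℝ := 2 * κ / (1 + s) ^ (κ + 1)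

theorem measurable_bubble : Measurable (bubble κ) := by
  unfold bubble
  fun_prop

theorem bubble_nonneg {s : ℝ} (hs : 0 ≤ s) : 0 ≤ bubble κ s := by
  unfold bubble
  positivity

/-- In polar coordinates the radial integrand has the primitive (r²/(1 + r²/2))^κ, which tends to
2^κ. -/
theorem lintegral_bubble (hk : k = 2 * κ) (hκ : 0 < κ) :
    ∫⁻ z : EuclideanSpace ℝ (Fin k), ENNReal.ofReal (bubble κ (‖z‖ ^ 2 / 2)) =
      ENNReal.ofReal (2 * (κ * 2 ^ κ)) * volume (ball (0 : EuclideanSpace ℝ (Fin k)) 1) := by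
  have : NeZero k := ⟨by omega⟩
  set f : ℝ → ℝ := fun r => bubble κ (r ^ 2 / 2) with hf
  set G : ℝ → ℝ := fun r => (r ^ 2 / (1 + r ^ 2 / 2)) ^ κ with hG
  have hd : ∀ r ∈ Ici (0 : ℝ), HasDerivAt G (r ^ (k - 1) • f r) r := by
    intro r _
    have h1 : (1 + r ^ 2 / 2) ≠ 0 := by positivity
    have h := (((hasDerivAt_pow 2 r).div (((hasDerivAt_pow 2 r).div_const 2).const_add 1) h1).pow κ)
    refine h.congr_deriv ?_
    obtain ⟨m, rfl⟩ : ∃ m, κ = m + 1 := Nat.exists_eq_succ_of_ne_zero hκ.ne'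
    rw [hk, show 2 * (m + 1) - 1 = 2 * m + 1 by omega]
    simp only [hf, bubble, smul_eq_mul, Nat.add_sub_cancel, Pi.div_apply, div_pow]
    push_cast
    have h2 : (1 + r ^ 2 / 2) ^ m ≠ 0 := pow_ne_zero _ h1
    rw [pow_succ (1 + r ^ 2 / 2) (m + 1), pow_succ (1 + r ^ 2 / 2) m, pow_succ r (2 * m), pow_mul]
    generalize hA : (1 + r ^ 2 / 2) = A at *
    have hr2 : r ^ 2 = 2 * (A - 1) := by rw [← hA]; ring
    rw [hr2]
    field_simp
    ring
  have hpos : ∀ r ∈ Ioi (0 : ℝ), 0 ≤ r ^ (k - 1) • f r := fun r hr =>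
    smul_nonneg (pow_nonneg (le_of_lt hr) _) (bubble_nonneg (by positivity))
  have hlim : Tendsto G atTop (𝓝 (2 ^ κ)) := by
    refine Tendsto.pow ?_ κ
    have h1 : Tendsto (fun r : ℝ => 2 - 2 / (1 + r ^ 2 / 2)) atTop (𝓝 (2 - 0)) := by
      refine tendsto_const_nhds.sub (tendsto_const_nhds.div_atTop ?_)
      exact tendsto_atTop_add_const_left _ _
        ((tendsto_pow_atTop two_ne_zero).atTop_div_const two_pos)
    rw [sub_zero] at h1
    refine h1.congr fun r => ?_
    have h1 : (1 + r ^ 2 / 2) ≠ 0 := by positivity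
    field_simp
    ring
  have h1 := integral_Ioi_of_hasDerivAt_of_nonneg' hd hpos hlim
  have h2 := integrableOn_Ioi_deriv_of_nonneg' hd hpos hlim
  have h3 : Integrable (fun z : EuclideanSpace ℝ (Fin k) => f ‖z‖) := by
    rw [integrable_fun_norm_addHaar volume, finrank_euclideanSpace_fin]
    exact h2
  have h4 := integral_fun_norm_addHaar (volume : Measure (EuclideanSpace ℝ (Fin k))) f
  rw [finrank_euclideanSpace_fin, h1] at h4
  change ∫⁻ z : EuclideanSpace ℝ (Fin k), ENNReal.ofReal (f ‖z‖) = _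
  rw [← ofReal_integral_eq_lintegral_ofReal h3
    (Eventually.of_forall fun z => bubble_nonneg (by positivity)), h4]
  have h5 : G 0 = 0 := by simp [hG, hκ.ne']
  rw [h5, sub_zero, nsmul_eq_mul, smul_eq_mul, mul_left_comm, mul_comm,
    ENNReal.ofReal_mul (by positivity), Measure.real, ENNReal.ofReal_toReal measure_ball_lt_top.ne, hk]
  congr 2
  push_cast
  ring

variable {L : EuclideanSpace ℝ (Fin k) →L[ℝ] Ambient n}

/-- An isometry from the range of `L` to ℝᵏ turns `L` into an endomorphism with |det| = √det g. So
the limiting mass depends neither on the chart nor on the immersion. -/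
theorem lintegral_comp_norm (hL : Function.Injective L) {h : ℝ → ℝ≥0∞} (hh : Measurable h) :
    ENNReal.ofReal (Real.sqrt (Matrix.gram ℝ (coordFrame L)).det) *
      ∫⁻ v : EuclideanSpace ℝ (Fin k), h ‖L v‖ = ∫⁻ z : EuclideanSpace ℝ (Fin k), h ‖z‖ := by
  set V := LinearMap.range (L : EuclideanSpace ℝ (Fin k) →ₗ[ℝ] Ambient n) with hV
  have hfin : Module.finrank ℝ V = k := by
    rw [hV, LinearMap.finrank_range_of_inj hL, finrank_euclideanSpace_fin]
  set φ : V ≃ₗᵢ[ℝ] EuclideanSpace ℝ (Fin k) :=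
    (stdOrthonormalBasis ℝ V).repr.trans
      (LinearIsometryEquiv.piLpCongrLeft 2 ℝ ℝ (finCongr hfin)) with hφ
  set S : EuclideanSpace ℝ (Fin k) →ₗ[ℝ] EuclideanSpace ℝ (Fin k) :=
    φ.toLinearEquiv.toLinearMap.comp (L : EuclideanSpace ℝ (Fin k) →ₗ[ℝ] Ambient n).rangeRestrict
    with hS
  have hSi : ∀ u v, inner ℝ (S u) (S v) = inner ℝ (L u) (L v) := by
    intro u v
    exact φ.inner_map_map _ _
  have hSn : ∀ v, ‖S v‖ = ‖L v‖ := fun v => φ.norm_map _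
  set S' : EuclideanSpace ℝ (Fin k) →L[ℝ] EuclideanSpace ℝ (Fin k) := S.toContinuousLinearMap
    with hS'
  have hgram : (Matrix.gram ℝ (coordFrame L)).det = (LinearMap.det S) ^ 2 := by
    have h1 := gram_det_comp (ContinuousLinearMap.id ℝ (EuclideanSpace ℝ (Fin k))) S'
    have h2 : Matrix.gram ℝ (coordFrame (ContinuousLinearMap.id ℝ (EuclideanSpace ℝ (Fin k)))) = 1 := by
      ext i j
      simp [Matrix.gram, coordFrame, Matrix.one_apply, EuclideanSpace.inner_single_left]
    rw [h2, Matrix.det_one, mul_one] at h1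
    have h3 : Matrix.gram ℝ (coordFrame ((ContinuousLinearMap.id ℝ (EuclideanSpace ℝ (Fin k))).comp
        S')) = Matrix.gram ℝ (coordFrame L) := by
      ext i j
      exact hSi _ _
    rw [← h3, h1]
    rfl
  have hdet : LinearMap.det S ≠ 0 := by
    intro h0
    have h1 := gram_det_pos (linearIndependent_coordFrame hL)
    rw [hgram, h0] at h1
    simp at h1
  have hmap := Measure.map_linearMap_addHaar_eq_smul_addHaar
    (volume : Measure (EuclideanSpace ℝ (Fin k))) hdet
  have hSm : Measurable S := S'.continuous.measurable
  have h1 : ∫⁻ v : EuclideanSpace ℝ (Fin k), h ‖L v‖ =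
      ENNReal.ofReal |(LinearMap.det S)⁻¹| * ∫⁻ z : EuclideanSpace ℝ (Fin k), h ‖z‖ := by
    simp only [← hSn]
    rw [← lintegral_map (f := fun z => h ‖z‖) (hh.comp measurable_norm) hSm, hmap,
      lintegral_smul_measure, smul_eq_mul]
  rw [h1, hgram, Real.sqrt_sq_eq_abs, ← mul_assoc, ← ENNReal.ofReal_mul (abs_nonneg _), ← abs_mul,
    mul_inv_cancel₀ hdet]
  simp

/-- Accounts for the factor two between interior and boundary preimages. -/
theorem lintegral_halfSpace_of_even [NeZero k] {f : EuclideanSpace ℝ (Fin k) → ℝ≥0∞}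
    (hev : ∀ v, f (-v) = f v) : 2 * ∫⁻ v in {v | 0 < v 0}, f v = ∫⁻ v, f v := by
  have hm : Measurable fun v : EuclideanSpace ℝ (Fin k) => v 0 :=
    (EuclideanSpace.proj (𝕜 := ℝ) (0 : Fin k)).continuous.measurable
  set T : Set (EuclideanSpace ℝ (Fin k)) := {v | 0 < v 0} with hT
  have hTm : MeasurableSet T := measurableSet_lt measurable_const hm
  set T' : Set (EuclideanSpace ℝ (Fin k)) := {v | v 0 < 0} with hT'
  have h1 : ∫⁻ v in T', f v = ∫⁻ v in T, f v := by
    have hmp : MeasurePreserving (Neg.neg : EuclideanSpace ℝ (Fin k) → _) :=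
      Measure.measurePreserving_neg volume
    have h := hmp.setLIntegral_comp_preimage_emb (MeasurableEquiv.neg _).measurableEmbedding f T
    rw [← h]
    simp only [hev]
    congr 2
    ext v
    simp [hT, hT']
  have h2 : Tᶜ =ᵐ[volume] T' := by
    have h3 : ∀ᵐ v ∂(volume : Measure (EuclideanSpace ℝ (Fin k))), v 0 ≠ 0 :=
      compl_mem_ae_iff.2 volume_hyperplane
    filter_upwards [h3] with v hv
    apply propext
    change ¬ (0 < v 0) ↔ v 0 < 0
    rw [not_lt]
    exact ⟨fun h => lt_of_le_of_ne h hv, le_of_lt⟩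
  have h3 : ∫⁻ v in Tᶜ, f v = ∫⁻ v in T, f v := (setLIntegral_congr h2).trans h1
  conv_rhs => rw [← lintegral_add_compl f hTm, h3]
  rw [two_mul]

end Bubble

namespace IsFreeBoundaryMinimal

variable {k n : ℕ} [NeZero k] {M : Type*} [TopologicalSpace M]
  [ChartedSpace (EuclideanHalfSpace k) M] [IsManifold (𝓡∂ k) ∞ M] [CompactSpace M] [T2Space M]
  {F : M → Ambient n} {p y : Ambient n} {R : ℝ}

theorem tendsto_slope (hF : IsFreeBoundaryMinimal (k := k) F p R) (x₀ : M)
    {v : EuclideanSpace ℝ (Fin k)} (hv : ∀ᶠ δ : ℝ in 𝓝[>] 0,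
      extChartAt (𝓡∂ k) x₀ x₀ + δ • v ∈ (extChartAt (𝓡∂ k) x₀).target) :
    Tendsto (fun δ : ℝ => δ⁻¹ • (localRep F x₀ (extChartAt (𝓡∂ k) x₀ x₀ + δ • v) - F x₀)) (𝓝[>] 0)
      (𝓝 (localDeriv F x₀ (extChartAt (𝓡∂ k) x₀ x₀) v)) := by
  have hu := mem_extChartAt_target (I := 𝓡∂ k) x₀
  have h := hasFDerivWithinAt_comp_symm hF.smooth hu
  rw [← hF.localDeriv_eq hu] at h
  have h2 := h.lim (l := 𝓝[>] (0 : ℝ)) (c := fun δ => δ⁻¹) (d := fun δ => δ • v) (v := v)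
    (by
      have : Tendsto (fun δ : ℝ => δ • v) (𝓝 0) (𝓝 ((0 : ℝ) • v)) :=
        (continuous_id.smul continuous_const).tendsto 0
      rw [zero_smul] at this
      exact this.mono_left nhdsWithin_le_nhds)
    (hv.mono fun δ hδ => extChartAt_target_subset_range x₀ hδ)
    (by
      refine (tendsto_const_nhds (x := v)).congr' ?_
      filter_upwards [self_mem_nhdsWithin] with δ hδ
      rw [inv_smul_smul₀ (ne_of_gt hδ)])
  have h3 : localRep F x₀ (extChartAt (𝓡∂ k) x₀ x₀) = F x₀ := by
    simp only [localRep, Function.comp_apply, extChartAt_to_inv]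
  rw [← h3]
  exact h2

theorem tendsto_symm (x₀ : M) (v : EuclideanSpace ℝ (Fin k)) (hv : ∀ᶠ δ : ℝ in 𝓝[>] 0,
      extChartAt (𝓡∂ k) x₀ x₀ + δ • v ∈ (extChartAt (𝓡∂ k) x₀).target) :
    Tendsto (fun δ : ℝ => (extChartAt (𝓡∂ k) x₀).symm (extChartAt (𝓡∂ k) x₀ x₀ + δ • v)) (𝓝[>] 0)
      (𝓝 x₀) := by
  have hu := mem_extChartAt_target (I := 𝓡∂ k) x₀
  have hc := continuousOn_extChartAt_symm (I := 𝓡∂ k) x₀ _ hu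
  have h1 : Tendsto (fun δ : ℝ => extChartAt (𝓡∂ k) x₀ x₀ + δ • v) (𝓝[>] 0)
      (𝓝[(extChartAt (𝓡∂ k) x₀).target] (extChartAt (𝓡∂ k) x₀ x₀)) := by
    refine tendsto_nhdsWithin_iff.2 ⟨?_, hv⟩
    have : Tendsto (fun δ : ℝ => extChartAt (𝓡∂ k) x₀ x₀ + δ • v) (𝓝 0)
        (𝓝 (extChartAt (𝓡∂ k) x₀ x₀ + (0 : ℝ) • v)) :=
      (continuous_const.add (continuous_id.smul continuous_const)).tendsto 0
    rw [zero_smul, add_zero] at this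
    exact this.mono_left nhdsWithin_le_nhds
  have h2 := hc.tendsto.comp h1
  rwa [extChartAt_to_inv] at h2

theorem tendsto_defect_div_sq (hF : IsFreeBoundaryMinimal (k := k) F p R) (x₀ : M)
    {v : EuclideanSpace ℝ (Fin k)} (hv : ∀ᶠ δ : ℝ in 𝓝[>] 0,
      extChartAt (𝓡∂ k) x₀ x₀ + δ • v ∈ (extChartAt (𝓡∂ k) x₀).target) :
    Tendsto (fun δ : ℝ => defect F (F x₀)
      ((extChartAt (𝓡∂ k) x₀).symm (extChartAt (𝓡∂ k) x₀ x₀ + δ • v)) / δ ^ 2) (𝓝[>] 0)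
      (𝓝 (‖localDeriv F x₀ (extChartAt (𝓡∂ k) x₀ x₀) v‖ ^ 2 / 2)) := by
  refine (((hF.tendsto_slope x₀ hv).norm.pow 2).div_const 2).congr' ?_
  filter_upwards [self_mem_nhdsWithin] with δ hδ
  rw [hF.defect_eq (hF.norm_eq_one x₀), norm_smul, mul_pow, norm_inv, inv_pow, Real.norm_eq_abs,
    sq_abs]
  simp only [localRep, Function.comp_apply]
  ring

/-- Since F x is orthogonal to its tangent plane, yᵀ = −(F x − y)ᵀ at x. To first order F x − y is δ
times the tangent vector `Lv`, which the projection at x₀ fixes, and the projections vary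
continuously. -/
theorem tendsto_tau_div_sq (hF : IsFreeBoundaryMinimal (k := k) F p R) (x₀ : M)
    {v : EuclideanSpace ℝ (Fin k)} (hv : ∀ᶠ δ : ℝ in 𝓝[>] 0,
      extChartAt (𝓡∂ k) x₀ x₀ + δ • v ∈ (extChartAt (𝓡∂ k) x₀).target) :
    Tendsto (fun δ : ℝ => tau k F (F x₀) (F x₀)
      ((extChartAt (𝓡∂ k) x₀).symm (extChartAt (𝓡∂ k) x₀ x₀ + δ • v)) / δ ^ 2) (𝓝[>] 0)
      (𝓝 (‖localDeriv F x₀ (extChartAt (𝓡∂ k) x₀ x₀) v‖ ^ 2)) := by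
  set u₀ := extChartAt (𝓡∂ k) x₀ x₀ with hu₀
  set Lv := localDeriv F x₀ u₀ v with hLv
  set x : ℝ → M := fun δ => (extChartAt (𝓡∂ k) x₀).symm (u₀ + δ • v) with hx
  have hs := hF.tendsto_slope x₀ hv
  have hxt : Tendsto x (𝓝[>] 0) (𝓝 x₀) := tendsto_symm x₀ v hv
  have hproj : tangentProj k F x₀ Lv = Lv := by
    refine Submodule.starProjection_eq_self_iff.2 ?_
    have hu := mem_extChartAt_target (I := 𝓡∂ k) x₀
    rw [hLv, hF.localDeriv_eq hu, extChartAt_to_inv]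
    exact ⟨_, rfl⟩
  have h1 : Tendsto (fun δ => tangentProj k F (x δ) (δ⁻¹ • (F (x δ) - F x₀))) (𝓝[>] 0) (𝓝 Lv) := by
    have h2 : Tendsto (fun δ => tangentProj k F (x δ) Lv) (𝓝[>] 0) (𝓝 Lv) := by
      have := ((hF.continuous_tangentProj Lv).tendsto x₀).comp hxt
      rwa [hproj] at this
    have h3 : Tendsto (fun δ => tangentProj k F (x δ) (δ⁻¹ • (F (x δ) - F x₀) - Lv)) (𝓝[>] 0)
        (𝓝 0) := by
      refine squeeze_zero_norm (fun δ => Submodule.norm_starProjection_apply_le _ _) ?_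
      have := (hs.sub_const Lv).norm
      rw [sub_self, norm_zero] at this
      exact this
    have h4 := h2.add h3
    rw [add_zero] at h4
    refine h4.congr fun δ => ?_
    rw [← map_add]
    congr 1
    abel
  refine (h1.norm.pow 2).congr fun δ => ?_
  rw [tau_eq_inner, real_inner_self_eq_norm_sq, map_smul, map_sub, hF.tangentProj_self, zero_sub,
    norm_smul, norm_neg, mul_pow, norm_inv, inv_pow, Real.norm_eq_abs, sq_abs]
  simp only [hx]
  ring

variable [MeasurableSpace M] [BorelSpace M] {κ : ℕ}

/-- The concentrating functions, which come from cutting off the calibration near `y`. -/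
def concentration (κ : ℕ) (F : M → Ambient n) (y : Ambient n) (H : M → ℝ) (ε : ℝ) (x : M) : ℝ :=
  κ * ε * H x / (defect F y x * (defect F y x + ε) ^ (κ + 1))

/-- Lower bound for the limit of concentrating functions near a preimage of `y`. -/
theorem lintegral_bubble_le_liminf (hF : IsFreeBoundaryMinimal (k := k) F p R) (hk : k = 2 * κ)
    (x₀ : M) {U : Set M} (hU : IsOpen U) (hxU : x₀ ∈ U) {T : Set (EuclideanSpace ℝ (Fin k))}
    (hT : MeasurableSet T) (hTv : ∀ v ∈ T, ∀ᶠ δ : ℝ in 𝓝[>] 0,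
      extChartAt (𝓡∂ k) x₀ x₀ + δ • v ∈ (extChartAt (𝓡∂ k) x₀).target)
    {H : M → ℝ} (hH : Continuous H)
    (hHt : ∀ v ∈ T, Tendsto (fun δ : ℝ => H
      ((extChartAt (𝓡∂ k) x₀).symm (extChartAt (𝓡∂ k) x₀ x₀ + δ • v)) / δ ^ 2) (𝓝[>] 0)
      (𝓝 (‖localDeriv F x₀ (extChartAt (𝓡∂ k) x₀ x₀) v‖ ^ 2)))
    {δ : ℕ → ℝ} (hδ : Tendsto δ atTop (𝓝[>] 0)) (hδ0 : ∀ m, 0 < δ m) :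
    ENNReal.ofReal (volumeDensity F x₀ (extChartAt (𝓡∂ k) x₀ x₀)) *
      ∫⁻ v in T, ENNReal.ofReal
        (bubble κ (‖localDeriv F x₀ (extChartAt (𝓡∂ k) x₀ x₀) v‖ ^ 2 / 2)) ≤
      liminf (fun m => ∫⁻ x in U, ENNReal.ofReal (concentration κ F (F x₀) H (δ m ^ 2) x)
        ∂(volumeMeasure k F)) atTop := by
  set u₀ := extChartAt (𝓡∂ k) x₀ x₀ with hu₀
  set tgt := (extChartAt (𝓡∂ k) x₀).target with htgt
  set L := localDeriv F x₀ u₀ with hL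
  have hu₀t : u₀ ∈ tgt := mem_extChartAt_target x₀
  have hdm : Measurable (defect F (F x₀)) := (hF.continuous_defect _).measurable
  have hcm : ∀ m, Measurable (concentration κ F (F x₀) H (δ m ^ 2)) := fun m =>
    (hH.measurable.const_mul _).div (hdm.mul ((hdm.add_const _).pow_const _))
  set Φ : ℕ → M → ℝ≥0∞ := fun m =>
    U.indicator fun x => ENNReal.ofReal (concentration κ F (F x₀) H (δ m ^ 2) x) with hΦ
  have hΦm : ∀ m, Measurable (Φ m) := fun m => (hcm m).ennreal_ofReal.indicator hU.measurableSet
  set Ψ : ℕ → EuclideanSpace ℝ (Fin k) → ℝ≥0∞ := fun m => tgt.indicator fun u =>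
    Φ m ((extChartAt (𝓡∂ k) x₀).symm u) * ENNReal.ofReal (volumeDensity F x₀ u) with hΨ
  have hΨm : ∀ m, AEMeasurable (Ψ m) := fun m => by
    refine (aemeasurable_indicator_iff (measurableSet_target x₀)).2 ?_
    exact ((hΦm m).comp_aemeasurable (aemeasurable_symm x₀)).mul (hF.aemeasurable_density x₀)
  -- Rescaling u = u₀ + δv with ε = δ²: the Jacobian δᵏ = δ^(2κ) balances the homogeneity of the
  -- concentrating functions, so the integrands converge pointwise to the bubble and Fatou's lemma
  -- applies.
  set G : ℕ → EuclideanSpace ℝ (Fin k) → ℝ≥0∞ := fun m v =>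
    ENNReal.ofReal (δ m ^ k) * Ψ m (u₀ + δ m • v) with hG
  have hqmp : ∀ m, Measure.QuasiMeasurePreserving (fun v => u₀ + δ m • v) := fun m =>
    (measurePreserving_add_left volume u₀).quasiMeasurePreserving.comp
      (Measure.quasiMeasurePreserving_smul volume (hδ0 m).ne')
  have hscale : ∀ m, ∫⁻ v, G m v = ∫⁻ u, Ψ m u := by
    intro m
    have hmap := Measure.map_addHaar_smul (volume : Measure (EuclideanSpace ℝ (Fin k))) (hδ0 m).ne'
    have h1 : ∫⁻ v, Ψ m (u₀ + δ m • v) = ENNReal.ofReal |(δ m ^ k)⁻¹| * ∫⁻ u, Ψ m u := by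
      have h2 : ∫⁻ v, Ψ m (u₀ + δ m • v) =
          ∫⁻ z, Ψ m (u₀ + z) ∂(Measure.map (fun v => δ m • v) volume) := by
        rw [lintegral_map' _ (measurable_const_smul _).aemeasurable]
        rw [hmap]
        exact ((hΨm m).comp_quasiMeasurePreserving
          (measurePreserving_add_left volume u₀).quasiMeasurePreserving).smul_measure _
      rw [h2, hmap, lintegral_smul_measure, finrank_euclideanSpace_fin, lintegral_add_left_eq_self,
        smul_eq_mul]
    have hpos : 0 < δ m ^ k := pow_pos (hδ0 m) k
    have h3 : AEMeasurable (fun v => Ψ m (u₀ + δ m • v)) volume :=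
      (hΨm m).comp_quasiMeasurePreserving (hqmp m)
    change ∫⁻ v, ENNReal.ofReal (δ m ^ k) * Ψ m (u₀ + δ m • v) = _
    rw [lintegral_const_mul'' _ h3, h1, ← mul_assoc,
      ← ENNReal.ofReal_mul hpos.le, abs_of_pos (by positivity), mul_inv_cancel₀ hpos.ne',
      ENNReal.ofReal_one, one_mul]
  have hle : ∀ m, ∫⁻ v in T, G m v ≤
      ∫⁻ x in U, ENNReal.ofReal (concentration κ F (F x₀) H (δ m ^ 2) x) ∂(volumeMeasure k F) := by
    intro m
    calc ∫⁻ v in T, G m v ≤ ∫⁻ v, G m v := setLIntegral_le_lintegral _ _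
      _ = ∫⁻ u, Ψ m u := hscale m
      _ = ∫⁻ x in (extChartAt (𝓡∂ k) x₀).source, Φ m x ∂(volumeMeasure k F) := by
          rw [hF.setLIntegral_source x₀ (hΦm m), hΨ, lintegral_indicator (measurableSet_target x₀)]
      _ ≤ ∫⁻ x, Φ m x ∂(volumeMeasure k F) := setLIntegral_le_lintegral _ _
      _ = _ := by rw [hΦ, lintegral_indicator hU.measurableSet]
  have hlim : ∀ v ∈ T, v ≠ 0 → Tendsto (fun m => G m v) atTop
      (𝓝 (ENNReal.ofReal (volumeDensity F x₀ u₀) * ENNReal.ofReal (bubble κ (‖L v‖ ^ 2 / 2)))) := by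
    intro v hv hv0
    have hLv : 0 < ‖L v‖ ^ 2 / 2 := by
      have : L v ≠ 0 := fun h => hv0 (hF.injective_localDeriv hu₀t (by rw [← hL, h, map_zero]))
      have := norm_pos_iff.2 this
      positivity
    set x : ℝ → M := fun d => (extChartAt (𝓡∂ k) x₀).symm (u₀ + d • v) with hx
    have hxt : Tendsto x (𝓝[>] 0) (𝓝 x₀) := tendsto_symm x₀ v (hTv v hv)
    have hw := hF.tendsto_defect_div_sq x₀ (hTv v hv)
    have hden : Tendsto (fun d : ℝ => volumeDensity F x₀ (u₀ + d • v)) (𝓝[>] 0)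
        (𝓝 (volumeDensity F x₀ u₀)) := by
      refine (hF.continuousOn_volumeDensity x₀ u₀ hu₀t).tendsto.comp
        (tendsto_nhdsWithin_iff.2 ⟨?_, hTv v hv⟩)
      have : Tendsto (fun d : ℝ => u₀ + d • v) (𝓝 0) (𝓝 (u₀ + (0 : ℝ) • v)) :=
        (continuous_const.add (continuous_id.smul continuous_const)).tendsto 0
      rw [zero_smul, add_zero] at this
      exact this.mono_left nhdsWithin_le_nhds
    have h1 : Tendsto (fun d : ℝ => volumeDensity F x₀ (u₀ + d • v) *
        (κ * (H (x d) / d ^ 2) / ((defect F (F x₀) (x d) / d ^ 2) *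
          (defect F (F x₀) (x d) / d ^ 2 + 1) ^ (κ + 1)))) (𝓝[>] 0)
        (𝓝 (volumeDensity F x₀ u₀ * (κ * (‖L v‖ ^ 2) / ((‖L v‖ ^ 2 / 2) *
          (‖L v‖ ^ 2 / 2 + 1) ^ (κ + 1))))) :=
      hden.mul (((hHt v hv).const_mul _).div (hw.mul ((hw.add_const 1).pow _)) (by positivity))
    have h2 : κ * (‖L v‖ ^ 2) / ((‖L v‖ ^ 2 / 2) * (‖L v‖ ^ 2 / 2 + 1) ^ (κ + 1)) =
        bubble κ (‖L v‖ ^ 2 / 2) := by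
      obtain ⟨s, hs⟩ : ∃ s, s = ‖L v‖ ^ 2 / 2 := ⟨_, rfl⟩
      have hs' : ‖L v‖ ^ 2 = 2 * s := by rw [hs]; ring
      rw [← hs] at hLv ⊢
      have hW : (1 + s) ^ (κ + 1) ≠ 0 := by positivity
      rw [bubble, hs', add_comm s 1]
      generalize (1 + s) ^ (κ + 1) = W at hW ⊢
      field_simp
    rw [h2] at h1
    rw [← ENNReal.ofReal_mul (hF.volumeDensity_pos hu₀t).le]
    have h3 := (ENNReal.tendsto_ofReal h1).comp hδ
    refine h3.congr' ?_
    filter_upwards [hδ.eventually (hTv v hv), hδ.eventually (hxt.eventually (hU.mem_nhds hxU))]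
      with m hm1 hm2
    have hm2' : (extChartAt (𝓡∂ k) x₀).symm (u₀ + δ m • v) ∈ U := hm2
    simp only [hG, hΨ, hΦ, Function.comp_apply, indicator_of_mem hm1, indicator_of_mem hm2']
    rw [mul_comm (ENNReal.ofReal (concentration _ _ _ _ _ _)), ← mul_assoc,
      ← ENNReal.ofReal_mul (pow_pos (hδ0 m) k).le,
      ← ENNReal.ofReal_mul (mul_nonneg (pow_pos (hδ0 m) k).le (hF.volumeDensity_pos hm1).le)]
    congr 1
    change _ = δ m ^ k * volumeDensity F x₀ (u₀ + δ m • v) *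
      (κ * δ m ^ 2 * H (x (δ m)) / (defect F (F x₀) (x (δ m)) *
        (defect F (F x₀) (x (δ m)) + δ m ^ 2) ^ (κ + 1)))
    generalize defect F (F x₀) (x (δ m)) = w
    generalize H (x (δ m)) = h
    generalize volumeDensity F x₀ (u₀ + δ m • v) = g
    have hd := (hδ0 m).ne'
    have e1 : w / δ m ^ 2 + 1 = (w + δ m ^ 2) / δ m ^ 2 := by field_simp
    rw [e1, hk, pow_mul, div_pow]
    generalize (w + δ m ^ 2) ^ (κ + 1) = W
    rcases eq_or_ne w 0 with rfl | hw0
    · simp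
    rcases eq_or_ne W 0 with rfl | hW0
    · simp
    rw [pow_succ (δ m ^ 2) κ]
    have hd2 : (δ m ^ 2) ^ κ ≠ 0 := pow_ne_zero _ (pow_ne_zero _ hd)
    generalize (δ m ^ 2) ^ κ = d at hd2 ⊢
    field_simp
  have hae : ∀ᵐ v ∂(volume.restrict T), liminf (fun m => G m v) atTop =
      ENNReal.ofReal (volumeDensity F x₀ u₀) * ENNReal.ofReal (bubble κ (‖L v‖ ^ 2 / 2)) := by
    have h1 : ∀ᵐ v ∂(volume : Measure (EuclideanSpace ℝ (Fin k))), v ≠ 0 := Measure.ae_ne volume 0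
    filter_upwards [ae_restrict_mem hT, ae_restrict_of_ae h1] with v hv hv0
    exact (hlim v hv hv0).liminf_eq
  calc _ = ∫⁻ v in T, liminf (fun m => G m v) atTop := by
        rw [lintegral_congr_ae hae, lintegral_const_mul]
        exact (measurable_bubble.comp
          ((L.continuous.norm.pow 2).div_const 2).measurable).ennreal_ofReal
    _ ≤ liminf (fun m => ∫⁻ v in T, G m v) atTop :=
        lintegral_liminf_le' fun m => (((hΨm m).comp_quasiMeasurePreserving
          (hqmp m)).const_mul _).restrict
    _ ≤ _ := liminf_le_liminf (Eventually.of_forall hle)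

end IsFreeBoundaryMinimal


end

/-! ### The calibrating field on Σ: flux, shortfall and the regularised divergence. -/

section

open Filter Topology Set Metric

variable {k n : ℕ} [NeZero k] {M : Type*} [TopologicalSpace M]
  [ChartedSpace (EuclideanHalfSpace k) M]
  {F : M → Ambient n} {p y : Ambient n} {R : ℝ} {κ : ℕ} {D C : ℝ}
  {A B Aw Ax Bw Bx : ℝ → ℝ → ℝ}

variable (k) in
/-- The pairing of the calibrating field with the gradient of the defect, up to a correction that
makes it nonnegative. -/
def flux (A B : ℝ → ℝ → ℝ) (C : ℝ) (F : M → Ambient n) (y p : Ambient n) (x : M) : ℝ :=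
  A (defect F y x) (inner ℝ (F x) p) * tau k F y y x +
    B (defect F y x) (inner ℝ (F x) p) * tau k F y p x + C ^ 2 * defect F y x ^ 2

variable (k) in
/-- The quadratic form in the normal parts of `y` and `p` by which the divergence of the calibrating
field falls short of its maximum. -/
def shortfall (κ : ℕ) (A B Aw Ax Bw Bx : ℝ → ℝ → ℝ) (F : M → Ambient n) (y p : Ambient n) (x : M) :
    ℝ :=
  (κ * A (defect F y x) (inner ℝ (F x) p) - defect F y x *
      Aw (defect F y x) (inner ℝ (F x) p)) * ‖normalPart k F y x‖ ^ 2 +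
    (κ * B (defect F y x) (inner ℝ (F x) p) + defect F y x *
      (Ax (defect F y x) (inner ℝ (F x) p) - Bw (defect F y x) (inner ℝ (F x) p))) *
        inner ℝ (normalPart k F y x) (normalPart k F p x) +
    defect F y x * Bx (defect F y x) (inner ℝ (F x) p) * ‖normalPart k F p x‖ ^ 2

theorem eventually_add_smul_mem_target (x₀ : M) {v : EuclideanSpace ℝ (Fin k)} (hv : 0 < v 0) :
    ∀ᶠ δ : ℝ in 𝓝[>] 0,
      extChartAt (𝓡∂ k) x₀ x₀ + δ • v ∈ (extChartAt (𝓡∂ k) x₀).target := by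
  set u₀ := extChartAt (𝓡∂ k) x₀ x₀ with hu₀
  have hu : u₀ ∈ (extChartAt (𝓡∂ k) x₀).target := mem_extChartAt_target x₀
  have h1 := extChartAt_target_mem_nhdsWithin_of_mem (I := 𝓡∂ k) hu
  have h0 : 0 ≤ u₀ 0 := by
    have := extChartAt_target_subset_range x₀ hu
    rwa [range_modelWithCornersEuclideanHalfSpace] at this
  refine (tendsto_nhdsWithin_iff.2 ⟨?_, ?_⟩ : Tendsto (fun δ : ℝ => u₀ + δ • v) (𝓝[>] 0)
    (𝓝[range (𝓡∂ k)] u₀)).eventually h1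
  · have : Tendsto (fun d : ℝ => u₀ + d • v) (𝓝 0) (𝓝 (u₀ + (0 : ℝ) • v)) :=
      (continuous_const.add (continuous_id.smul continuous_const)).tendsto 0
    rw [zero_smul, add_zero] at this
    exact this.mono_left nhdsWithin_le_nhds
  · filter_upwards [self_mem_nhdsWithin] with δ hδ
    rw [range_modelWithCornersEuclideanHalfSpace]
    have hδ' : (0 : ℝ) < δ := hδ
    have : 0 ≤ u₀ 0 + δ * v 0 := by positivity
    simpa using this

theorem eventually_add_smul_mem_target_of_interior (x₀ : M)
    (hx : x₀ ∉ (𝓡∂ k).boundary M) (v : EuclideanSpace ℝ (Fin k)) :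
    ∀ᶠ δ : ℝ in 𝓝[>] 0,
      extChartAt (𝓡∂ k) x₀ x₀ + δ • v ∈ (extChartAt (𝓡∂ k) x₀).target := by
  set u₀ := extChartAt (𝓡∂ k) x₀ x₀ with hu₀
  have hu : u₀ ∈ (extChartAt (𝓡∂ k) x₀).target := mem_extChartAt_target x₀
  have h1 : (extChartAt (𝓡∂ k) x₀).target ∈ 𝓝 u₀ := by
    rw [← ModelWithCorners.compl_interior, notMem_compl_iff] at hx
    have h2 := extChartAt_target_mem_nhdsWithin_of_mem (I := 𝓡∂ k) hu
    rwa [nhdsWithin_eq_nhds.2 (mem_interior_iff_mem_nhds.1 hx)] at h2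
  have : Tendsto (fun d : ℝ => u₀ + d • v) (𝓝 0) (𝓝 (u₀ + (0 : ℝ) • v)) :=
    (continuous_const.add (continuous_id.smul continuous_const)).tendsto 0
  rw [zero_smul, add_zero] at this
  exact (this.mono_left nhdsWithin_le_nhds).eventually h1

namespace IsFreeBoundaryMinimal

variable [IsManifold (𝓡∂ k) ∞ M] [CompactSpace M] [T2Space M]

theorem cos_nonneg' (hR0 : 0 < R) (hR : R ≤ Real.pi / 2) : 0 ≤ Real.cos R :=
  Real.cos_nonneg_of_neg_pi_div_two_le_of_le (by linarith) hR

theorem cos_lt_one' (hR0 : 0 < R) (hR : R ≤ Real.pi / 2) : Real.cos R < 1 := by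
  rw [← Real.cos_zero]
  exact Real.cos_lt_cos_of_nonneg_of_le_pi le_rfl (by linarith [Real.pi_pos]) hR0

section Main

variable (hF : IsFreeBoundaryMinimal (k := k) F p R) (hp : ‖p‖ = 1)
  (hR0 : 0 < R) (hR : R ≤ Real.pi / 2) (hy : ‖y‖ = 1) (hyp : inner ℝ y p = Real.cos R)
  (hcal : IsCalibration κ (Real.cos R) D A B Aw Ax Bw Bx)
include hF hp hR0 hR

theorem continuous_comp_pair {f : ℝ → ℝ → ℝ}
    (hf : ContinuousOn (fun q : ℝ × ℝ => f q.1 q.2) {q | 0 ≤ q.2}) (y : Ambient n) :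
    Continuous fun x => f (defect F y x) (inner ℝ (F x) p) :=
  hf.comp_continuous ((hF.continuous_defect y).prodMk (hF.smooth.continuous.inner continuous_const))
    fun x => (cos_nonneg' hR0 hR).trans (hF.cos_le_inner hp hR0 hR x)

include hcal

theorem continuous_left (y : Ambient n) :
    Continuous fun x => A (defect F y x) (inner ℝ (F x) p) :=
  hF.continuous_comp_pair hp hR0 hR
    (fun q hq => (hcal.hasFDerivAt_left q.1 q.2 hq).continuousAt.continuousWithinAt) y

theorem continuous_right (y : Ambient n) :
    Continuous fun x => B (defect F y x) (inner ℝ (F x) p) :=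
  hF.continuous_comp_pair hp hR0 hR
    (fun q hq => (hcal.hasFDerivAt_right q.1 q.2 hq).continuousAt.continuousWithinAt) y

theorem continuous_flux : Continuous (flux k A B C F y p) :=
  (((hF.continuous_left hp hR0 hR hcal y).mul (hF.continuous_tau y y)).add
    ((hF.continuous_right hp hR0 hR hcal y).mul (hF.continuous_tau y p))).add
    (continuous_const.mul ((hF.continuous_defect y).pow 2))

theorem continuous_shortfall : Continuous (shortfall k κ A B Aw Ax Bw Bx F y p) := by
  have hA := hF.continuous_left hp hR0 hR hcal y
  have hB := hF.continuous_right hp hR0 hR hcal y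
  have hAw := hF.continuous_comp_pair hp hR0 hR hcal.continuousOn_Aw y
  have hAx := hF.continuous_comp_pair hp hR0 hR hcal.continuousOn_Ax y
  have hBw := hF.continuous_comp_pair hp hR0 hR hcal.continuousOn_Bw y
  have hBx := hF.continuous_comp_pair hp hR0 hR hcal.continuousOn_Bx y
  have hw := hF.continuous_defect y
  have hN : ∀ u, Continuous (normalPart k F u) := fun u => by
    have h1 : Continuous fun x => (inner ℝ (F x) u : ℝ) := hF.smooth.continuous.inner continuous_const
    exact (continuous_const.sub (h1.smul hF.smooth.continuous)).sub (hF.continuous_tangentProj u)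
  have hY : Continuous fun x => ‖normalPart k F y x‖ ^ 2 := (hN y).norm.pow 2
  have hP : Continuous fun x => ‖normalPart k F p x‖ ^ 2 := (hN p).norm.pow 2
  have hZ : Continuous fun x => (inner ℝ (normalPart k F y x) (normalPart k F p x) : ℝ) :=
    (hN y).inner (hN p)
  unfold shortfall
  exact ((((continuous_const.mul hA).sub (hw.mul hAw)).mul hY).add
    (((continuous_const.mul hB).add (hw.mul (hAx.sub hBw))).mul hZ)).add ((hw.mul hBx).mul hP)

include hy hyp

/-- With t = |yᵀ|² and s = ⟨yᵀ, pᵀ⟩ one has s² ≤ t, A ≥ 1 and |B| ≤ Cw, so the flux is at least t −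
Cw√t + C²w² ≥ 0. Fatou's lemma requires this sign. -/
theorem flux_nonneg (hC : ∀ w x, (w, x) ∈ region (Real.cos R) → |B w x| ≤ C * w) (x : M) :
    0 ≤ flux k A B C F y p x := by
  have hreg := hF.mem_region hp hR0 hR hy hyp x
  have h1 := hcal.one_le _ _ hreg
  have h2 := hC _ _ hreg
  have h3 := tau_sq_le (k := k) (F := F) y p x
  have h4 := tau_self_le (k := k) (F := F) p x
  have h5 := tau_self_nonneg (k := k) (F := F) y x
  rw [hp] at h4
  unfold flux
  generalize A (defect F y x) (inner ℝ (F x) p) = α at *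
  generalize B (defect F y x) (inner ℝ (F x) p) = β at *
  generalize defect F y x = w at *
  generalize tau k F y p x = s at *
  generalize tau k F y y x = t at *
  have h6 : s ^ 2 ≤ t := by nlinarith
  have h7 : β ^ 2 ≤ C ^ 2 * w ^ 2 := by
    rw [← mul_pow, ← sq_abs β]
    gcongr
  have h8 : (β * s) ^ 2 ≤ C ^ 2 * w ^ 2 * t := by
    rw [mul_pow]
    gcongr
  have h9 : t ≤ α * t := by nlinarith
  have h10 : 0 ≤ C ^ 2 * w ^ 2 := by positivity
  generalize C ^ 2 * w ^ 2 = E at *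
  generalize β * s = z at *
  by_contra hneg
  nlinarith

theorem shortfall_nonneg (x : M) : 0 ≤ shortfall k κ A B Aw Ax Bw Bx F y p x := by
  refine hcal.form_nonneg _ _ (hF.mem_region hp hR0 hR hy hyp x) _ _ _ (by positivity)
    (by positivity) ?_
  rw [← mul_pow, ← sq_abs]
  gcongr
  exact abs_real_inner_le_norm _ _

theorem normalPart_eq_zero_of_shortfall {x : M}
    (h0 : shortfall k κ A B Aw Ax Bw Bx F y p x = 0) (hw : 0 < defect F y x) :
    normalPart k F y x = 0 ∧ (Real.cos R ≠ 0 → normalPart k F p x = 0) := by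
  have h := hcal.form_eq_zero _ _ (hF.mem_region hp hR0 hR hy hyp x) hw
    (‖normalPart k F y x‖ ^ 2) (inner ℝ (normalPart k F y x) (normalPart k F p x))
    (‖normalPart k F p x‖ ^ 2) (by positivity) (by positivity) (by
      rw [← mul_pow, ← sq_abs]
      gcongr
      exact abs_real_inner_le_norm _ _) h0
  simpa using h

variable [MeasurableSpace M] [BorelSpace M]

/-- Inserting the divergence identity of the calibration into the field with (w + ε)^(−κ) leaves the
mismatch of two weights, 1/(w (w + ε)^κ) − 1/(w + ε)^(κ+1) = ε/(w (w + ε)^(κ+1)), multiplied by κ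
times the flux. That is the concentrating function. -/
theorem exists_divergence_eq (hk : k = 2 * κ) {ε : ℝ} (hε : 0 < ε) :
    ∃ f : M → ℝ, Continuous f ∧ ∫ x, f x ∂(volumeMeasure k F) = 0 ∧
      ∀ x, 0 < defect F y x → f x = (defect F y x / (defect F y x + ε)) ^ κ * D -
        shortfall k κ A B Aw Ax Bw Bx F y p x / (defect F y x * (defect F y x + ε) ^ κ) -
        concentration κ F y (flux k A B 0 F y p) ε x := by
  have ha0 := cos_nonneg' hR0 hR
  have ha1 := cos_lt_one' hR0 hR
  have hb := one_sub_sq_pos ha0 ha1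
  have hx0 : ∀ x, 0 ≤ inner ℝ (F x) p := fun x => ha0.trans (hF.cos_le_inner hp hR0 hR x)
  have hpair : ∀ x, HasFDerivAt (fun q : Ambient n => ((1 - inner ℝ q y, inner ℝ q p) : ℝ × ℝ))
      ((-innerSL ℝ y).prod (innerSL ℝ p)) (F x) := by
    intro x
    have h1 : HasFDerivAt (fun q : Ambient n => inner ℝ y q) (innerSL ℝ y) (F x) :=
      (innerSL ℝ y).hasFDerivAt
    have h2 : HasFDerivAt (fun q : Ambient n => inner ℝ p q) (innerSL ℝ p) (F x) :=
      (innerSL ℝ p).hasFDerivAt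
    simpa only [real_inner_comm] using (h1.const_sub 1).prodMk h2
  have hcomp : ∀ {f fw fx : ℝ → ℝ → ℝ}, (∀ w x, 0 ≤ x → HasFDerivAt (fun q : ℝ × ℝ => f q.1 q.2)
      (fw w x • ContinuousLinearMap.fst ℝ ℝ ℝ + fx w x • ContinuousLinearMap.snd ℝ ℝ ℝ) (w, x)) →
      ∀ x, HasFDerivAt (fun q : Ambient n => f (1 - inner ℝ q y) (inner ℝ q p))
        (fw (defect F y x) (inner ℝ (F x) p) • (-innerSL ℝ y) +
          fx (defect F y x) (inner ℝ (F x) p) • innerSL ℝ p) (F x) := by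
    intro f fw fx hf x
    have h := HasFDerivAt.comp (g := fun q : ℝ × ℝ => f q.1 q.2) (F x)
      (hf (defect F y x) (inner ℝ (F x) p) (hx0 x)) (hpair x)
    refine h.congr_fderiv ?_
    ext v
    simp
  have key := hF.integral_weighted_divergence hp hR0 hR hy hyp
    (A := fun q => A (1 - inner ℝ q y) (inner ℝ q p))
    (B := fun q => B (1 - inner ℝ q y) (inner ℝ q p))
    (A' := fun x => Aw (defect F y x) (inner ℝ (F x) p) • (-innerSL ℝ y) +
      Ax (defect F y x) (inner ℝ (F x) p) • innerSL ℝ p)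
    (B' := fun x => Bw (defect F y x) (inner ℝ (F x) p) • (-innerSL ℝ y) +
      Bx (defect F y x) (inner ℝ (F x) p) • innerSL ℝ p)
    (hcomp hcal.hasFDerivAt_left)
    (hcomp hcal.hasFDerivAt_right)
    (((hF.continuous_comp_pair hp hR0 hR hcal.continuousOn_Aw y).smul continuous_const).add
      ((hF.continuous_comp_pair hp hR0 hR hcal.continuousOn_Ax y).smul continuous_const))
    (((hF.continuous_comp_pair hp hR0 hR hcal.continuousOn_Bw y).smul continuous_const).add
      ((hF.continuous_comp_pair hp hR0 hR hcal.continuousOn_Bx y).smul continuous_const))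
    (by
      intro x hx
      have h1 := hF.cos_eq_inner hp hx
      change Real.cos R * defect F y x * A (defect F y x) (inner ℝ (F x) p) +
        (1 - Real.cos R ^ 2) * B (defect F y x) (inner ℝ (F x) p) = 0
      rw [h1, hcal.boundary]
      field_simp
      ring) κ hε
  refine ⟨_, key.1, key.2, fun x hw => ?_⟩
  have e1 : inner ℝ y (tangentProj k F x y) = tau k F y y x := by rw [tau, real_inner_comm]
  have e2 : inner ℝ y (tangentProj k F x p) = tau k F y p x := by
    rw [tau_comm, tau, real_inner_comm]
  have e3 : inner ℝ p (tangentProj k F x y) = tau k F y p x := by rw [tau, real_inner_comm]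
  have e4 : inner ℝ p (tangentProj k F x p) = tau k F p p x := by rw [tau, real_inner_comm]
  have e5 : 1 - inner ℝ (F x) y = defect F y x := rfl
  have hyy := hF.tau_eq y y x
  have hyp' := hF.tau_eq y p x
  have hpp := hF.tau_eq p p x
  have e6 : inner ℝ (F x) y = 1 - defect F y x := by rw [defect]; ring
  rw [real_inner_self_eq_norm_sq, real_inner_self_eq_norm_sq, hy, e6] at hyy
  rw [hyp, e6] at hyp'
  rw [real_inner_self_eq_norm_sq, real_inner_self_eq_norm_sq, hp] at hpp
  have hdiv := hcal.divergence (defect F y x) (inner ℝ (F x) p) (hx0 x)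
  simp only [concentration, flux, shortfall, add_apply, smul_apply, neg_apply, smul_eq_mul,
    innerSL_apply_apply, e1, e2, e3, e4, e5]
  have hkk : (k : ℝ) = 2 * κ := by rw [hk]; push_cast; ring
  rw [hkk]
  generalize A (defect F y x) (inner ℝ (F x) p) = α at *
  generalize B (defect F y x) (inner ℝ (F x) p) = β at *
  generalize Aw (defect F y x) (inner ℝ (F x) p) = αw at *
  generalize Ax (defect F y x) (inner ℝ (F x) p) = αx at *
  generalize Bw (defect F y x) (inner ℝ (F x) p) = βw at *
  generalize Bx (defect F y x) (inner ℝ (F x) p) = βx at *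
  generalize inner ℝ (normalPart k F y x) (normalPart k F p x) = Z at *
  generalize ‖normalPart k F y x‖ ^ 2 = Y at *
  generalize ‖normalPart k F p x‖ ^ 2 = P at *
  generalize tau k F y p x = s at *
  generalize tau k F y y x = t at *
  generalize tau k F p p x = r at *
  generalize (inner ℝ (F x) p : ℝ) = X at *
  generalize defect F y x = w at *
  have hwe : w + ε ≠ 0 := by positivity
  have hWe : (w + ε) ^ κ ≠ 0 := pow_ne_zero _ hwe
  rw [div_pow, pow_succ (w + ε) κ]
  rw [pow_succ w κ] at hdiv
  generalize (w + ε) ^ κ = W at *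
  generalize w ^ κ = w' at *
  have hw0 := hw.ne'
  subst hyy hyp' hpp
  field_simp
  linear_combination (w + ε) * hdiv

end Main

end IsFreeBoundaryMinimal


end

/-! ### The limit ε → 0. -/

section

open Filter Topology Set Metric

variable {k n : ℕ} [NeZero k] {M : Type*} [TopologicalSpace M]
  [ChartedSpace (EuclideanHalfSpace k) M]
  {F : M → Ambient n} {p y : Ambient n} {R : ℝ} {κ : ℕ} {D C : ℝ}
  {A B Aw Ax Bw Bx : ℝ → ℝ → ℝ}

theorem liminf_add_liminf_le (u v : ℕ → ℝ≥0∞) :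
    liminf u atTop + liminf v atTop ≤ liminf (fun m => u m + v m) atTop := by
  simp only [liminf_eq_iSup_iInf_of_nat]
  rw [ENNReal.iSup_add_iSup_of_monotone]
  · exact iSup_mono fun i => le_iInf₂ fun j hj => add_le_add (iInf₂_le j hj) (iInf₂_le j hj)
  all_goals exact fun a b hab => le_iInf₂ fun j hj => iInf₂_le j (hab.trans hj)

namespace IsFreeBoundaryMinimal

variable [IsManifold (𝓡∂ k) ∞ M] [CompactSpace M] [T2Space M] [MeasurableSpace M] [BorelSpace M]

theorem measurable_concentration (hF : IsFreeBoundaryMinimal (k := k) F p R) {H : M → ℝ}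
    (hH : Continuous H) (ε : ℝ) : Measurable (concentration κ F y H ε) :=
  have hdm : Measurable (defect F y) := (hF.continuous_defect _).measurable
  (hH.measurable.const_mul _).div (hdm.mul ((hdm.add_const _).pow_const _))

section Main

variable (hF : IsFreeBoundaryMinimal (k := k) F p R) (hp : ‖p‖ = 1)
  (hR0 : 0 < R) (hR : R ≤ Real.pi / 2) (hy : ‖y‖ = 1) (hyp : inner ℝ y p = Real.cos R)
include hF hp hR0 hR hy hyp

/-- The correction C²w² that makes the flux nonnegative disappears in the limit: its contribution is
dominated by a multiple of w^(−(κ−1)), which is integrable. -/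
theorem tendsto_correction (hk : k = 2 * κ) (hκ : 2 ≤ κ) (C : ℝ) {ε : ℕ → ℝ}
    (hε : Tendsto ε atTop (𝓝 0)) (hε0 : ∀ m, 0 < ε m) :
    Tendsto (fun m => ∫ x, κ * ε m * C ^ 2 * defect F y x / (defect F y x + ε m) ^ (κ + 1)
      ∂(volumeMeasure k F)) atTop (𝓝 0) := by
  have hint := hF.integrable_defect_pow_inv hp hR0 hR hy hyp (by omega) (κ - 1) (by omega)
  have hpos := hF.ae_defect_pos hp hR0 hR hy hyp (by omega)
  have hdc := hF.continuous_defect y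
  rw [show (0 : ℝ) = ∫ x, (0 : ℝ) ∂(volumeMeasure k F) by simp]
  refine tendsto_integral_of_dominated_convergence
    (fun x => κ * C ^ 2 * (defect F y x ^ (κ - 1))⁻¹) (fun m => ?_) (hint.const_mul _) (fun m => ?_) ?_
  · exact ((hdc.measurable.const_mul _).div
      ((hdc.measurable.add_const _).pow_const _)).aestronglyMeasurable
  · filter_upwards [hpos] with x hx
    have h0 := hε0 m
    rw [Real.norm_of_nonneg (by positivity)]
    obtain ⟨i, rfl⟩ : ∃ i, κ = i + 1 := ⟨κ - 1, by omega⟩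
    rw [Nat.add_sub_cancel]
    generalize defect F y x = w at *
    generalize ε m = e at *
    have h1 : e * w / (w + e) ^ (i + 1 + 1) ≤ (w ^ i)⁻¹ := by
      rw [div_le_iff₀ (by positivity), inv_mul_eq_div, le_div_iff₀ (by positivity), pow_add, pow_add]
      calc e * w * w ^ i ≤ ((w + e) * (w + e)) * (w + e) ^ i := by
            gcongr <;> linarith
        _ = _ := by ring
    calc ((i + 1 : ℕ) : ℝ) * e * C ^ 2 * w / (w + e) ^ (i + 1 + 1) =
        (i + 1 : ℕ) * C ^ 2 * (e * w / (w + e) ^ (i + 1 + 1)) := by ring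
      _ ≤ _ := by gcongr
  · filter_upwards [hpos] with x hx
    have h1 : Tendsto (fun m => κ * ε m * C ^ 2 * defect F y x / (defect F y x + ε m) ^ (κ + 1)) atTop
        (𝓝 (κ * 0 * C ^ 2 * defect F y x / (defect F y x + 0) ^ (κ + 1))) :=
      (((hε.const_mul _).mul_const _).mul_const _).div ((hε.const_add _).pow _) (by
        rw [add_zero]; positivity)
    simpa using h1

variable (hcal : IsCalibration κ (Real.cos R) D A B Aw Ax Bw Bx)
  (hk : k = 2 * κ) (hκ : 2 ≤ κ) (hD : 0 ≤ D)
  (hC : ∀ w x, (w, x) ∈ region (Real.cos R) → |B w x| ≤ C * w)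
include hcal hk hκ

-- The total divergence is zero, and the factor (w/(w + ε))^κ of D is at most one.
include hD hC in
theorem lintegral_concentration_add_le {ε : ℝ} (hε : 0 < ε) :
    ∫⁻ x, ENNReal.ofReal (concentration κ F y (flux k A B C F y p) ε x) ∂(volumeMeasure k F) +
      ∫⁻ x, ENNReal.ofReal (shortfall k κ A B Aw Ax Bw Bx F y p x /
        (defect F y x * (defect F y x + ε) ^ κ)) ∂(volumeMeasure k F) ≤
      ENNReal.ofReal D * volumeMeasure k F univ +
        ENNReal.ofReal (∫ x, κ * ε * C ^ 2 * defect F y x / (defect F y x + ε) ^ (κ + 1)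
          ∂(volumeMeasure k F)) := by
  have := hF.isFiniteMeasure
  obtain ⟨f, hfc, hf0, hf⟩ := hF.exists_divergence_eq hp hR0 hR hy hyp hcal hk hε
  have hdc := hF.continuous_defect y
  have hpos := hF.ae_defect_pos hp hR0 hR hy hyp (by omega)
  have hd0 := hF.defect_nonneg hy
  set c : M → ℝ := fun x => κ * ε * C ^ 2 * defect F y x / (defect F y x + ε) ^ (κ + 1) with hc
  have hcc : Continuous c := (continuous_const.mul hdc).div ((hdc.add continuous_const).pow _)
    fun x => pow_ne_zero _ (add_pos_of_nonneg_of_pos (hd0 x) hε).ne'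
  have hci := hF.integrable_of_continuous hcc
  have hfi := hF.integrable_of_continuous hfc
  have hle : ∀ᵐ x ∂(volumeMeasure k F), concentration κ F y (flux k A B C F y p) ε x +
      shortfall k κ A B Aw Ax Bw Bx F y p x / (defect F y x * (defect F y x + ε) ^ κ) ≤
      D + c x - f x := by
    filter_upwards [hpos] with x hx
    have h1 : concentration κ F y (flux k A B C F y p) ε x =
        concentration κ F y (flux k A B 0 F y p) ε x + c x := by
      simp only [concentration, flux, hc]
      have : (defect F y x + ε) ^ (κ + 1) ≠ 0 := by positivity
      field_simp
      ring
    have h2 : (defect F y x / (defect F y x + ε)) ^ κ * D ≤ D := by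
      refine mul_le_of_le_one_left hD (pow_le_one₀ (by positivity) ?_)
      rw [div_le_one (by positivity)]
      linarith
    rw [h1, hf x hx]
    linarith
  have hcn : ∀ x, 0 ≤ concentration κ F y (flux k A B C F y p) ε x := fun x => by
    have := hF.flux_nonneg hp hR0 hR hy hyp hcal hC x
    have := hd0 x
    unfold concentration
    positivity
  have hsn : ∀ x, 0 ≤ shortfall k κ A B Aw Ax Bw Bx F y p x /
      (defect F y x * (defect F y x + ε) ^ κ) := fun x => by
    have := hF.shortfall_nonneg hp hR0 hR hy hyp hcal x
    have := hd0 x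
    positivity
  have hgi : Integrable (fun x => D + c x - f x) (volumeMeasure k F) :=
    ((integrable_const D).add hci).sub hfi
  have hgn : 0 ≤ᵐ[volumeMeasure k F] fun x => D + c x - f x := by
    filter_upwards [hle] with x hx
    exact (add_nonneg (hcn x) (hsn x)).trans hx
  have hgint : ∫ x, (D + c x - f x) ∂(volumeMeasure k F) =
      D * (volumeMeasure k F).real univ + ∫ x, c x ∂(volumeMeasure k F) := by
    have h1 := integral_sub ((integrable_const D).add hci) hfi
    have h2 := integral_add (integrable_const D) hci
    rw [hf0, sub_zero] at h1
    rw [integral_const, smul_eq_mul, mul_comm] at h2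
    exact h1.trans h2
  rw [← lintegral_add_left (hF.measurable_concentration
    (hF.continuous_flux hp hR0 hR hcal) ε).ennreal_ofReal]
  calc _ ≤ ∫⁻ x, ENNReal.ofReal (D + c x - f x) ∂(volumeMeasure k F) := by
        refine lintegral_mono_ae ?_
        filter_upwards [hle] with x hx
        rw [← ENNReal.ofReal_add (hcn x) (hsn x)]
        exact ENNReal.ofReal_le_ofReal hx
    _ = ENNReal.ofReal (D * (volumeMeasure k F).real univ + ∫ x, c x ∂(volumeMeasure k F)) := by
        rw [← ofReal_integral_eq_lintegral_ofReal hgi hgn, hgint]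
    _ ≤ _ := by
        refine ENNReal.ofReal_add_le.trans (add_le_add_left (le_of_eq ?_) _)
        rw [ENNReal.ofReal_mul hD, Measure.real, ENNReal.ofReal_toReal (measure_ne_top _ _)]

-- For ε ≤ 1 the weight of the shortfall is at least its value at ε = 1. The fixed term thus kept in
-- the limit decides the equality case.
include hD hC in
theorem liminf_add_shortfall_le {δ : ℕ → ℝ} (hδ : Tendsto δ atTop (𝓝 0)) (hδ0 : ∀ m, 0 < δ m)
    (hδ1 : ∀ m, δ m ≤ 1) :
    liminf (fun m => ∫⁻ x, ENNReal.ofReal (concentration κ F y (flux k A B C F y p) (δ m ^ 2) x)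
        ∂(volumeMeasure k F)) atTop +
      ∫⁻ x, ENNReal.ofReal (shortfall k κ A B Aw Ax Bw Bx F y p x /
        (defect F y x * (defect F y x + 1) ^ κ)) ∂(volumeMeasure k F) ≤
      ENNReal.ofReal D * volumeMeasure k F univ := by
  have := hF.isFiniteMeasure
  have hd0 := hF.defect_nonneg hy
  have hcor := hF.tendsto_correction hp hR0 hR hy hyp hk hκ C (ε := fun m => δ m ^ 2)
    (by simpa using hδ.pow 2) (fun m => pow_pos (hδ0 m) 2)
  have hlim := (ENNReal.tendsto_ofReal hcor).const_add (ENNReal.ofReal D * volumeMeasure k F univ)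
  rw [ENNReal.ofReal_zero, add_zero] at hlim
  rw [← hlim.liminf_eq]
  set S := ∫⁻ x, ENNReal.ofReal (shortfall k κ A B Aw Ax Bw Bx F y p x /
        (defect F y x * (defect F y x + 1) ^ κ)) ∂(volumeMeasure k F) with hS
  have h1 : ∀ m, ∫⁻ x, ENNReal.ofReal (concentration κ F y (flux k A B C F y p) (δ m ^ 2) x)
      ∂(volumeMeasure k F) + S ≤ ENNReal.ofReal D * volumeMeasure k F univ +
        ENNReal.ofReal (∫ x, κ * δ m ^ 2 * C ^ 2 * defect F y x / (defect F y x + δ m ^ 2) ^ (κ + 1)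
          ∂(volumeMeasure k F)) := by
    intro m
    refine le_trans ?_ (hF.lintegral_concentration_add_le hp hR0 hR hy hyp hcal hk hκ hD hC
      (pow_pos (hδ0 m) 2))
    refine add_le_add_right (lintegral_mono fun x => ENNReal.ofReal_le_ofReal ?_) _
    have h2 := hF.shortfall_nonneg hp hR0 hR hy hyp hcal x
    have h3 := hd0 x
    have h4 : δ m ^ 2 ≤ 1 := pow_le_one₀ (hδ0 m).le (hδ1 m)
    rcases h3.eq_or_lt with h5 | h5
    · simp [← h5]
    have := hδ0 m
    gcongr
  refine le_trans ?_ (liminf_le_liminf (Eventually.of_forall h1))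
  have h5 : S = liminf (fun _ : ℕ => S) atTop := by simp
  conv_lhs => rw [h5]
  exact liminf_add_liminf_le _ _

-- At y one has A = 1, while B = O(w) and ⟨yᵀ, pᵀ⟩ = O(√w); so only |yᵀ|² survives to second order.
omit hk hκ in
theorem tendsto_flux_div_sq {x₀ : M} (hx₀ : F x₀ = y) (C : ℝ)
    {v : EuclideanSpace ℝ (Fin k)} (hv : ∀ᶠ δ : ℝ in 𝓝[>] 0,
      extChartAt (𝓡∂ k) x₀ x₀ + δ • v ∈ (extChartAt (𝓡∂ k) x₀).target) :
    Tendsto (fun δ : ℝ => flux k A B C F y p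
      ((extChartAt (𝓡∂ k) x₀).symm (extChartAt (𝓡∂ k) x₀ x₀ + δ • v)) / δ ^ 2) (𝓝[>] 0)
      (𝓝 (‖localDeriv F x₀ (extChartAt (𝓡∂ k) x₀ x₀) v‖ ^ 2)) := by
  obtain ⟨C', hC'0, hC'⟩ := hcal.right_le
  subst hx₀
  have hw := hF.tendsto_defect_div_sq x₀ hv
  have ht := hF.tendsto_tau_div_sq x₀ hv
  have hx := tendsto_symm x₀ v hv
  set z : ℝ → M := fun δ => (extChartAt (𝓡∂ k) x₀).symm (extChartAt (𝓡∂ k) x₀ x₀ + δ • v) with hz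
  have hw0 : defect F (F x₀) x₀ = 0 := (hF.defect_eq_zero_iff hy).2 rfl
  have hA : Tendsto (fun δ => A (defect F (F x₀) (z δ)) (inner ℝ (F (z δ)) p)) (𝓝[>] 0) (𝓝 1) := by
    have := ((hF.continuous_left hp hR0 hR hcal (F x₀)).tendsto x₀).comp hx
    rwa [hw0, hyp, hcal.left_zero] at this
  have hd : Tendsto (fun δ => defect F (F x₀) (z δ)) (𝓝[>] 0) (𝓝 0) := by
    have := ((hF.continuous_defect (F x₀)).tendsto x₀).comp hx
    rwa [hw0] at this
  have hB : Tendsto (fun δ : ℝ => B (defect F (F x₀) (z δ)) (inner ℝ (F (z δ)) p) *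
      tau k F (F x₀) p (z δ) / δ ^ 2) (𝓝[>] 0) (𝓝 0) := by
    have h1 : Tendsto (fun δ : ℝ => C' * (defect F (F x₀) (z δ) / δ ^ 2) *
        Real.sqrt (2 * defect F (F x₀) (z δ))) (𝓝[>] 0) (𝓝 0) := by
      have := (hw.const_mul C').mul (hd.const_mul 2).sqrt
      rwa [mul_zero, Real.sqrt_zero, mul_zero] at this
    refine squeeze_zero_norm (fun δ => ?_) h1
    have h2 := hC' _ _ (hF.mem_region hp hR0 hR hy hyp (z δ))
    have h3 := Real.abs_le_sqrt (hF.tau_sq_le_defect hp hy (z δ))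
    have h4 := hF.defect_nonneg hy (z δ)
    rw [norm_div, norm_mul, Real.norm_eq_abs, Real.norm_eq_abs, Real.norm_of_nonneg (sq_nonneg δ)]
    calc _ ≤ C' * defect F (F x₀) (z δ) * Real.sqrt (2 * defect F (F x₀) (z δ)) / δ ^ 2 := by gcongr
      _ = _ := by ring
  have hcor : Tendsto (fun δ : ℝ => C ^ 2 * (defect F (F x₀) (z δ) / δ ^ 2) *
      defect F (F x₀) (z δ)) (𝓝[>] 0) (𝓝 0) := by
    have := (hw.const_mul (C ^ 2)).mul hd
    rwa [mul_zero] at this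
  have h := ((hA.mul ht).add hB).add hcor
  simp only [one_mul, add_zero] at h
  refine h.congr fun δ => ?_
  simp only [flux]
  ring

theorem mass_le_liminf_of_directions {x₀ : M} (hx₀ : F x₀ = y) (C : ℝ) {U : Set M} (hU : IsOpen U)
    (hxU : x₀ ∈ U) {T : Set (EuclideanSpace ℝ (Fin k))} (hT : MeasurableSet T)
    (hTv : ∀ v ∈ T, ∀ᶠ δ : ℝ in 𝓝[>] 0,
      extChartAt (𝓡∂ k) x₀ x₀ + δ • v ∈ (extChartAt (𝓡∂ k) x₀).target)
    {δ : ℕ → ℝ} (hδ : Tendsto δ atTop (𝓝 0)) (hδ0 : ∀ m, 0 < δ m) :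
    ENNReal.ofReal (volumeDensity F x₀ (extChartAt (𝓡∂ k) x₀ x₀)) *
      ∫⁻ v in T, ENNReal.ofReal
        (bubble κ (‖localDeriv F x₀ (extChartAt (𝓡∂ k) x₀ x₀) v‖ ^ 2 / 2)) ≤
      liminf (fun m => ∫⁻ x in U, ENNReal.ofReal
        (concentration κ F y (flux k A B C F y p) (δ m ^ 2) x) ∂(volumeMeasure k F)) atTop := by
  have h := hF.lintegral_bubble_le_liminf hk x₀ hU hxU hT hTv (hF.continuous_flux hp hR0 hR hcal)
    (fun v hv => hF.tendsto_flux_div_sq hp hR0 hR hy hyp hcal hx₀ C (hTv v hv))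
    (tendsto_nhdsWithin_iff.2 ⟨hδ, Eventually.of_forall hδ0⟩) hδ0
  rwa [hx₀] at h

omit hp hR0 hR hy hyp hcal [MeasurableSpace M] [BorelSpace M] in
theorem volumeDensity_mul_lintegral_bubble (x₀ : M) :
    ENNReal.ofReal (volumeDensity F x₀ (extChartAt (𝓡∂ k) x₀ x₀)) *
      ∫⁻ v, ENNReal.ofReal (bubble κ (‖localDeriv F x₀ (extChartAt (𝓡∂ k) x₀ x₀) v‖ ^ 2 / 2)) =
      ENNReal.ofReal (2 * (κ * 2 ^ κ)) * volume (ball (0 : EuclideanSpace ℝ (Fin k)) 1) := by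
  rw [← lintegral_bubble hk (by omega)]
  exact lintegral_comp_norm (h := fun s => ENNReal.ofReal (bubble κ (s ^ 2 / 2)))
    (hF.injective_localDeriv (mem_extChartAt_target x₀))
    (measurable_bubble.comp (by fun_prop)).ennreal_ofReal

/-- At an interior point every direction stays in the chart for short times, so the whole bubble is
collected. -/
theorem two_mul_mass_le_liminf {x₀ : M} (hx₀ : F x₀ = y) (hxb : x₀ ∉ (𝓡∂ k).boundary M) (C : ℝ)
    {δ : ℕ → ℝ} (hδ : Tendsto δ atTop (𝓝 0)) (hδ0 : ∀ m, 0 < δ m) :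
    2 * (ENNReal.ofReal (κ * 2 ^ κ) * volume (ball (0 : EuclideanSpace ℝ (Fin k)) 1)) ≤
      liminf (fun m => ∫⁻ x, ENNReal.ofReal
        (concentration κ F y (flux k A B C F y p) (δ m ^ 2) x) ∂(volumeMeasure k F)) atTop := by
  have h := hF.mass_le_liminf_of_directions hp hR0 hR hy hyp hcal hk hκ hx₀ C isOpen_univ (mem_univ _)
    MeasurableSet.univ (fun v _ => eventually_add_smul_mem_target_of_interior x₀ hxb v) hδ hδ0
  rw [Measure.restrict_univ, Measure.restrict_univ,
    hF.volumeDensity_mul_lintegral_bubble hk hκ x₀, ENNReal.ofReal_mul two_pos.le] at h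
  rw [← mul_assoc]
  simpa using h

/-- Directions with v₀ > 0 stay in the chart at any point, boundary or not, and carry half of the
even bubble. The localisation to `U` serves to add up several preimages. -/
theorem mass_le_liminf {x₀ : M} (hx₀ : F x₀ = y) (C : ℝ) {U : Set M} (hU : IsOpen U)
    (hxU : x₀ ∈ U) {δ : ℕ → ℝ} (hδ : Tendsto δ atTop (𝓝 0)) (hδ0 : ∀ m, 0 < δ m) :
    ENNReal.ofReal (κ * 2 ^ κ) * volume (ball (0 : EuclideanSpace ℝ (Fin k)) 1) ≤
      liminf (fun m => ∫⁻ x in U, ENNReal.ofReal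
        (concentration κ F y (flux k A B C F y p) (δ m ^ 2) x) ∂(volumeMeasure k F)) atTop := by
  have hm : Measurable fun v : EuclideanSpace ℝ (Fin k) => v 0 :=
    (EuclideanSpace.proj (𝕜 := ℝ) (0 : Fin k)).continuous.measurable
  have h := hF.mass_le_liminf_of_directions hp hR0 hR hy hyp hcal hk hκ hx₀ C hU hxU
    (T := {v | 0 < v 0}) (measurableSet_lt measurable_const hm)
    (fun v hv => eventually_add_smul_mem_target x₀ hv) hδ hδ0
  refine le_trans (le_of_eq ?_) h
  have h1 := hF.volumeDensity_mul_lintegral_bubble hk hκ x₀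
  rw [← lintegral_halfSpace_of_even (fun v => by rw [map_neg, norm_neg]), mul_left_comm,
    ENNReal.ofReal_mul two_pos.le, mul_assoc] at h1
  refine ((ENNReal.mul_right_inj (by simp) (by simp)).1 (h1.trans ?_)).symm
  simp

end Main

end IsFreeBoundaryMinimal


end

/-! ### The volume inequality, and first consequences of equality. -/

section

open Filter Topology Set Metric

variable {k n : ℕ} [NeZero k] {M : Type*} [TopologicalSpace M]
  [ChartedSpace (EuclideanHalfSpace k) M]
  {F : M → Ambient n} {p y : Ambient n} {R : ℝ}

theorem exists_pos_forall_ballVolume (hk : k = 4 ∨ k = 6) (hR0 : 0 < R) (hR : R ≤ Real.pi / 2) :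
    ∃ κ : ℕ, k = 2 * κ ∧ 2 ≤ κ ∧ ∃ D, 0 < D ∧
      ENNReal.ofReal (κ * 2 ^ κ) * volume (ball (0 : EuclideanSpace ℝ (Fin k)) 1) =
        ENNReal.ofReal D * ballVolume k R ∧
      ∃ A B Aw Ax Bw Bx, IsCalibration κ (Real.cos R) D A B Aw Ax Bw Bx := by
  obtain ⟨κ, hκ, rfl⟩ : ∃ κ : ℕ, (κ = 2 ∨ κ = 3) ∧ k = 2 * κ := by
    rcases hk with rfl | rfl
    · exact ⟨2, Or.inl rfl, rfl⟩
    · exact ⟨3, Or.inr rfl, rfl⟩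
  obtain ⟨D, hD, hDJ, hcal⟩ := exists_calibration hκ
    (IsFreeBoundaryMinimal.cos_nonneg' hR0 hR) (IsFreeBoundaryMinimal.cos_lt_one' hR0 hR)
  refine ⟨κ, rfl, by omega, D, hD, ?_, hcal⟩
  rw [ballVolume_eq (by omega) hR0 hR, ← mul_assoc, ← ENNReal.ofReal_mul hD.le, hDJ]

theorem ballVolume_pos_and_ne_top (hk : k = 4 ∨ k = 6) (hR0 : 0 < R) (hR : R ≤ Real.pi / 2) :
    ballVolume k R ≠ 0 ∧ ballVolume k R ≠ ⊤ := by
  obtain ⟨κ, -, hκ, D, hD, h, -⟩ := exists_pos_forall_ballVolume hk hR0 hR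
  have h1 : ENNReal.ofReal (κ * 2 ^ κ) * volume (ball (0 : EuclideanSpace ℝ (Fin k)) 1) ≠ 0 := by
    refine mul_ne_zero ?_ (measure_ball_pos volume _ one_pos).ne'
    rw [ENNReal.ofReal_ne_zero_iff]
    positivity
  have h2 : ENNReal.ofReal (κ * 2 ^ κ) * volume (ball (0 : EuclideanSpace ℝ (Fin k)) 1) ≠ ⊤ :=
    ENNReal.mul_ne_top ENNReal.ofReal_ne_top measure_ball_lt_top.ne
  rw [h] at h1 h2
  refine ⟨right_ne_zero_of_mul h1, fun h3 => h2 ?_⟩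
  rw [h3, ENNReal.mul_top]
  rw [ENNReal.ofReal_ne_zero_iff]
  exact hD

theorem not_two_mul_ballVolume_le (hk : k = 4 ∨ k = 6) (hR0 : 0 < R) (hR : R ≤ Real.pi / 2) :
    ¬ 2 * ballVolume k R ≤ ballVolume k R := by
  obtain ⟨h0, h1⟩ := ballVolume_pos_and_ne_top hk hR0 hR
  rw [two_mul, not_le]
  exact ENNReal.lt_add_right h1 h0

theorem exists_seq_tendsto_zero_le_one :
    ∃ δ : ℕ → ℝ, Tendsto δ atTop (𝓝 0) ∧ (∀ m, 0 < δ m) ∧ ∀ m, δ m ≤ 1 := by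
  refine ⟨_, tendsto_one_div_add_atTop_nhds_zero_nat, fun m => by positivity, fun m => ?_⟩
  rw [div_le_one (by positivity)]
  linarith [m.cast_nonneg (α := ℝ)]

namespace IsFreeBoundaryMinimal

variable [IsManifold (𝓡∂ k) ∞ M] [CompactSpace M] [T2Space M] [MeasurableSpace M] [BorelSpace M]

section Volume

variable (hF : IsFreeBoundaryMinimal (k := k) F p R) (hk : k = 4 ∨ k = 6) (hp : ‖p‖ = 1)
  (hR0 : 0 < R) (hR : R ≤ Real.pi / 2)
include hF hk hp hR0 hR

theorem ballVolume_le_of_inner_eq {x₀ : M} (hx₀ : inner ℝ (F x₀) p = Real.cos R) :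
    ballVolume k R ≤ volumeMeasure k F univ := by
  obtain ⟨κ, hk2, hκ, D, hD, hB, A, B, Aw, Ax, Bw, Bx, hcal⟩ :=
    exists_pos_forall_ballVolume hk hR0 hR
  obtain ⟨C, hC0, hC⟩ := hcal.right_le
  obtain ⟨δ, hδ, hδ0, hδ1⟩ := exists_seq_tendsto_zero_le_one
  have h1 := hF.mass_le_liminf hp hR0 hR (hF.norm_eq_one x₀) hx₀ hcal hk2 hκ rfl C isOpen_univ
    (mem_univ x₀) hδ hδ0
  have h2 := hF.liminf_add_shortfall_le hp hR0 hR (hF.norm_eq_one x₀) hx₀ hcal hk2 hκ hD.le hC hδ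
    hδ0 hδ1
  rw [Measure.restrict_univ, hB] at h1
  exact (ENNReal.mul_le_mul_iff_right (by simpa using hD) ENNReal.ofReal_ne_top).1
    ((h1.trans le_self_add).trans h2)

theorem two_mul_ballVolume_le_of_interior {x₀ : M} (hx₀ : inner ℝ (F x₀) p = Real.cos R)
    (hxb : x₀ ∉ (𝓡∂ k).boundary M) :
    2 * ballVolume k R ≤ volumeMeasure k F univ := by
  obtain ⟨κ, hk2, hκ, D, hD, hB, A, B, Aw, Ax, Bw, Bx, hcal⟩ :=
    exists_pos_forall_ballVolume hk hR0 hR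
  obtain ⟨C, hC0, hC⟩ := hcal.right_le
  obtain ⟨δ, hδ, hδ0, hδ1⟩ := exists_seq_tendsto_zero_le_one
  have h1 := hF.two_mul_mass_le_liminf hp hR0 hR (hF.norm_eq_one x₀) hx₀ hcal hk2 hκ rfl hxb C hδ hδ0
  have h2 := hF.liminf_add_shortfall_le hp hR0 hR (hF.norm_eq_one x₀) hx₀ hcal hk2 hκ hD.le hC hδ
    hδ0 hδ1
  rw [hB, mul_left_comm] at h1
  exact (ENNReal.mul_le_mul_iff_right (by simpa using hD) ENNReal.ofReal_ne_top).1
    ((h1.trans le_self_add).trans h2)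

/-- Disjoint neighbourhoods of the two preimages collect half a bubble each. -/
theorem two_mul_ballVolume_le_of_ne {x₀ x₁ : M} (hx₀ : inner ℝ (F x₀) p = Real.cos R)
    (hne : x₀ ≠ x₁) (h01 : F x₁ = F x₀) :
    2 * ballVolume k R ≤ volumeMeasure k F univ := by
  obtain ⟨κ, hk2, hκ, D, hD, hB, A, B, Aw, Ax, Bw, Bx, hcal⟩ :=
    exists_pos_forall_ballVolume hk hR0 hR
  obtain ⟨C, hC0, hC⟩ := hcal.right_le
  obtain ⟨δ, hδ, hδ0, hδ1⟩ := exists_seq_tendsto_zero_le_one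
  obtain ⟨U, U', hU, hU', hxU, hxU', hUU⟩ := t2_separation hne
  have h1 := hF.mass_le_liminf hp hR0 hR (hF.norm_eq_one x₀) hx₀ hcal hk2 hκ rfl C hU hxU hδ hδ0
  have h1' := hF.mass_le_liminf hp hR0 hR (hF.norm_eq_one x₀) hx₀ hcal hk2 hκ h01 C hU' hxU' hδ hδ0
  have h2 := hF.liminf_add_shortfall_le hp hR0 hR (hF.norm_eq_one x₀) hx₀ hcal hk2 hκ hD.le hC hδ
    hδ0 hδ1
  have h3 := (add_le_add h1 h1').trans (liminf_add_liminf_le _ _)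
  rw [hB, ← two_mul, mul_left_comm] at h3
  refine (ENNReal.mul_le_mul_iff_right (by simpa using hD) ENNReal.ofReal_ne_top).1
    (le_trans (h3.trans ?_) (le_self_add.trans h2))
  refine liminf_le_liminf (Eventually.of_forall fun m => ?_)
  rw [← lintegral_union hU'.measurableSet hUU]
  exact setLIntegral_le_lintegral _ _

/-- Half a bubble already uses up D |B^k_R|, which is finite, so the integral of the shortfall is
zero. The strict form of the calibration inequality gives the claim almost everywhere, continuity
everywhere. -/
theorem normalPart_eq_zero_of_volume_eq {x₀ : M} (hx₀ : inner ℝ (F x₀) p = Real.cos R)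
    (heq : volumeMeasure k F univ = ballVolume k R) (x : M) :
    normalPart k F (F x₀) x = 0 ∧ (Real.cos R ≠ 0 → normalPart k F p x = 0) := by
  obtain ⟨κ, hk2, hκ, D, hD, hB, A, B, Aw, Ax, Bw, Bx, hcal⟩ :=
    exists_pos_forall_ballVolume hk hR0 hR
  obtain ⟨C, hC0, hC⟩ := hcal.right_le
  obtain ⟨δ, hδ, hδ0, hδ1⟩ := exists_seq_tendsto_zero_le_one
  have hy := hF.norm_eq_one x₀
  have h1 := hF.mass_le_liminf hp hR0 hR hy hx₀ hcal hk2 hκ rfl C isOpen_univ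
    (mem_univ x₀) hδ hδ0
  have h2 := hF.liminf_add_shortfall_le hp hR0 hR hy hx₀ hcal hk2 hκ hD.le hC hδ hδ0 hδ1
  rw [Measure.restrict_univ, hB] at h1
  rw [heq] at h2
  have hfin : ENNReal.ofReal D * ballVolume k R ≠ ⊤ :=
    ENNReal.mul_ne_top ENNReal.ofReal_ne_top (ballVolume_pos_and_ne_top hk hR0 hR).2
  have h3 := (add_le_add_left h1 _).trans h2
  have h4 := (ENNReal.add_le_add_iff_left hfin).1 (h3.trans_eq (add_zero _).symm)
  have hsc := hF.continuous_shortfall hp hR0 hR hcal (y := F x₀)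
  have hdc := hF.continuous_defect (F x₀)
  have h5 := (lintegral_eq_zero_iff (by
    exact (hsc.measurable.div (hdc.measurable.mul
      ((hdc.measurable.add_const 1).pow_const κ))).ennreal_ofReal)).1 (le_antisymm h4 zero_le)
  have hpos := hF.ae_defect_pos hp hR0 hR hy hx₀ (by omega)
  have := hF.isOpenPosMeasure
  have h6 : ∀ᵐ x ∂(volumeMeasure k F), normalPart k F (F x₀) x = 0 ∧
      (Real.cos R ≠ 0 → normalPart k F p x = 0) := by
    filter_upwards [h5, hpos] with x hx hw
    refine hF.normalPart_eq_zero_of_shortfall hp hR0 hR hy hx₀ hcal (le_antisymm ?_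
      (hF.shortfall_nonneg hp hR0 hR hy hx₀ hcal x)) hw
    have h7 := ENNReal.ofReal_eq_zero.1 hx
    by_contra hneg
    have : 0 < shortfall k κ A B Aw Ax Bw Bx F (F x₀) p x := not_le.1 hneg
    exact absurd h7 (not_le.2 (by positivity))
  have hN : ∀ u, Continuous (normalPart k F u) := fun u => by
    have h1 : Continuous fun x => (inner ℝ (F x) u : ℝ) := hF.smooth.continuous.inner continuous_const
    exact (continuous_const.sub (h1.smul hF.smooth.continuous)).sub (hF.continuous_tangentProj u)
  refine ⟨congrFun (Measure.eq_of_ae_eq (h6.mono fun x hx => hx.1) (hN _) continuous_const) x,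
    fun ha => congrFun (Measure.eq_of_ae_eq (h6.mono fun x hx => hx.2 ha) (hN _)
      continuous_const) x⟩

omit hk in
/-- In the absence of a boundary the submanifold lies in the equator. -/
theorem inner_eq_cos_of_boundary_eq_empty (hb : (𝓡∂ k).boundary M = ∅) (x : M) :
    inner ℝ (F x) p = Real.cos R := by
  have := hF.isOpenPosMeasure
  have hfc := hF.smooth.continuous
  -- The constant field p has tangential divergence −k ⟨F, p⟩ ≤ 0, so ⟨F, p⟩ = 0; together with 0 ≤
  -- cos R ≤ ⟨F, p⟩ this also gives cos R = 0.
  have key := hF.integral_divergence (ι := Unit) hp hR0 hR (φ := fun _ _ => 1)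
    (φ' := fun _ _ => 0) (fun _ => p) (fun _ x => hasFDerivAt_const _ _)
    (fun _ => continuous_const) (fun x hx => by simp [hb] at hx)
  have hc : Continuous fun x => (inner ℝ (F x) p : ℝ) := hfc.inner continuous_const
  have h0 : ∀ x, 0 ≤ (inner ℝ (F x) p : ℝ) := fun x =>
    (cos_nonneg' hR0 hR).trans (hF.cos_le_inner hp hR0 hR x)
  have h1 : ∫ x, (inner ℝ (F x) p : ℝ) ∂(volumeMeasure k F) = 0 := by
    simp only [Finset.univ_unique, Finset.sum_singleton, zero_apply, one_mul, zero_sub] at key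
    rw [integral_neg, integral_const_mul] at key
    have hk0 : (k : ℝ) ≠ 0 := by exact_mod_cast NeZero.ne k
    simpa [hk0, real_inner_comm] using key
  have h2 := (integral_eq_zero_iff_of_nonneg h0 (hF.integrable_of_continuous hc)).1 h1
  have h3 := congrFun (Measure.eq_of_ae_eq h2 hc continuous_const) x
  have h4 := hF.cos_le_inner hp hR0 hR x
  have h5 := cos_nonneg' hR0 hR
  simp only [Pi.zero_apply] at h3
  linarith

theorem ballVolume_le [Nonempty M] : ballVolume k R ≤ volumeMeasure k F univ := by
  rcases ((𝓡∂ k).boundary M).eq_empty_or_nonempty with hb | ⟨x₀, hx₀⟩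
  · exact hF.ballVolume_le_of_inner_eq hk hp hR0 hR
      (hF.inner_eq_cos_of_boundary_eq_empty hp hR0 hR hb (Classical.arbitrary M))
  · exact hF.ballVolume_le_of_inner_eq hk hp hR0 hR (hF.cos_eq_inner hp hx₀)

/-- Without boundary every point is an interior point lying over the geodesic sphere, which would
double the lower bound. -/
theorem exists_mem_boundary [Nonempty M] (heq : volumeMeasure k F univ = ballVolume k R) :
    ((𝓡∂ k).boundary M).Nonempty := by
  by_contra hb
  rw [not_nonempty_iff_eq_empty] at hb
  have x₀ := Classical.arbitrary M
  exact not_two_mul_ballVolume_le hk hR0 hR (heq ▸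
    hF.two_mul_ballVolume_le_of_interior hk hp hR0 hR
      (hF.inner_eq_cos_of_boundary_eq_empty hp hR0 hR hb x₀) (by simp [hb]))

theorem eq_of_inner_eq (heq : volumeMeasure k F univ = ballVolume k R) {x x' : M}
    (hx : inner ℝ (F x) p = Real.cos R) (hxx : F x' = F x) : x' = x := by
  by_contra hne
  exact not_two_mul_ballVolume_le hk hR0 hR (heq ▸
    hF.two_mul_ballVolume_le_of_ne hk hp hR0 hR hx (Ne.symm hne) hxx)

end Volume

end IsFreeBoundaryMinimal


end

/-! ### Equality: the image lies in a linear subspace. -/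

section

open Filter Topology Set Metric

variable {k n : ℕ} [NeZero k] {M : Type*} [TopologicalSpace M]
  [ChartedSpace (EuclideanHalfSpace k) M]
  {F : M → Ambient n} {p y : Ambient n} {R : ℝ}

theorem convex_range : Convex ℝ (range (𝓡∂ k)) := by
  rw [range_modelWithCornersEuclideanHalfSpace]
  exact convex_halfSpace_ge (f := fun u : EuclideanSpace ℝ (Fin k) => u 0)
    ⟨fun _ _ => rfl, fun _ _ => rfl⟩ 0

/-- The divergence of the field `y - c w p` weighted by the square of a linear function that vanishes
at `y` and `p`, relative to this square. -/
def divergenceTerm (k : ℕ) (c a w X : ℝ) : ℝ :=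
  -2 * (1 - w) + c * (a - (1 - w) * X) + 2 * c * w * X - k * (1 - w) + k * c * w * X

/-- The derivative of `w` along the field `y - c w p`, divided by `-w`. -/
def gradientTerm (c a w X : ℝ) : ℝ := 2 - w - c * (a - (1 - w) * X)

/-- With the power κ + 1 the constants −2 − 2κ and 2(κ + 1) cancel exactly; there remain (κ + 1) w
and nonnegative multiples of c. -/
theorem le_divergenceTerm_add_gradientTerm {κ : ℕ} {c a w X : ℝ} (hc : 0 ≤ c) (ha : 0 ≤ a)
    (hw : 0 ≤ w) (hX : a ≤ X) :
    (κ + 1) * w ≤ divergenceTerm (2 * κ) c a w X + (κ + 1) * gradientTerm c a w X := by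
  have h4 : divergenceTerm (2 * κ) c a w X + (κ + 1) * gradientTerm c a w X = (κ + 1) * w +
      ((κ + 2) * (c * (w * X)) + κ * (c * (X - a))) := by
    simp only [divergenceTerm, gradientTerm]
    push_cast
    ring
  have h5 : 0 ≤ X := ha.trans hX
  have h6 : 0 ≤ X - a := sub_nonneg.2 hX
  have : 0 ≤ (κ + 2) * (c * (w * X)) + κ * (c * (X - a)) := by positivity
  linarith

/-- The bound l² = O(w²) makes up for two powers of w, which leaves the integrable majorant
w^(−(κ−1)), uniformly in ε. -/
theorem norm_weighted_le {κ : ℕ} (hκ : 1 ≤ κ) {w ε l C E E' K₁ K₂ : ℝ} (hw : 0 < w) (hε : 0 ≤ ε)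
    (hl : |l| ≤ C * w) (h1 : ‖E‖ ≤ K₁) (h2 : ‖E'‖ ≤ K₂) :
    ‖l ^ 2 * (((w + ε) ^ (κ + 1))⁻¹ * E + (κ + 1) * (((w + ε) ^ (κ + 2))⁻¹ * w) * E')‖ ≤
      C ^ 2 * (K₁ + (κ + 1) * K₂) * (w ^ (κ - 1))⁻¹ := by
  have h3 : l ^ 2 ≤ C ^ 2 * w ^ 2 := by
    rw [← mul_pow, ← sq_abs]
    gcongr
  have hwe : 0 < w + ε := by linarith
  have h4 : ((w + ε) ^ (κ + 1))⁻¹ ≤ (w ^ (κ + 1))⁻¹ := by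
    gcongr; linarith
  have h5 : ((w + ε) ^ (κ + 2))⁻¹ * w ≤ (w ^ (κ + 1))⁻¹ := by
    calc ((w + ε) ^ (κ + 2))⁻¹ * w ≤ (w ^ (κ + 2))⁻¹ * w := by
          gcongr; linarith
      _ = _ := by rw [pow_succ w (κ + 1)]; field_simp
  have hK₁0 : 0 ≤ K₁ := (norm_nonneg _).trans h1
  have hK₂0 : 0 ≤ K₂ := (norm_nonneg _).trans h2
  have h6 : (w ^ (κ + 1))⁻¹ * w ^ 2 = (w ^ (κ - 1))⁻¹ := by
    rw [show κ + 1 = κ - 1 + 2 by omega, pow_add]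
    field_simp
  rw [norm_mul, Real.norm_of_nonneg (sq_nonneg l)]
  calc _ ≤ C ^ 2 * w ^ 2 * (‖((w + ε) ^ (κ + 1))⁻¹ * E‖ +
        ‖(κ + 1) * (((w + ε) ^ (κ + 2))⁻¹ * w) * E'‖) := by
        gcongr
        exact norm_add_le _ _
    _ ≤ C ^ 2 * w ^ 2 * ((w ^ (κ + 1))⁻¹ * K₁ + (κ + 1) * (w ^ (κ + 1))⁻¹ * K₂) := by
        rw [norm_mul, norm_mul, Real.norm_of_nonneg (r := ((w + ε) ^ (κ + 1))⁻¹) (by positivity),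
          Real.norm_of_nonneg (r := (κ + 1) * (((w + ε) ^ (κ + 2))⁻¹ * w)) (by positivity)]
        gcongr
    _ = C ^ 2 * (K₁ + (κ + 1) * K₂) * ((w ^ (κ + 1))⁻¹ * w ^ 2) := by ring
    _ = _ := by rw [h6]

namespace IsFreeBoundaryMinimal

variable [IsManifold (𝓡∂ k) ∞ M]

/-- In a chart, an immersion is locally bi-Lipschitz, also at the boundary. -/
theorem exists_norm_sub_le (hF : IsFreeBoundaryMinimal (k := k) F p R) (x₀ : M) :
    ∃ K, 0 ≤ K ∧ ∃ r, 0 < r ∧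
      ball (extChartAt (𝓡∂ k) x₀ x₀) r ∩ range (𝓡∂ k) ⊆ (extChartAt (𝓡∂ k) x₀).target ∧
      ∀ u ∈ ball (extChartAt (𝓡∂ k) x₀ x₀) r ∩ range (𝓡∂ k),
      ∀ v ∈ ball (extChartAt (𝓡∂ k) x₀ x₀) r ∩ range (𝓡∂ k),
        ‖u - v‖ ≤ K * ‖localRep F x₀ u - localRep F x₀ v‖ := by
  set u₀ := extChartAt (𝓡∂ k) x₀ x₀ with hu₀
  have hu : u₀ ∈ (extChartAt (𝓡∂ k) x₀).target := mem_extChartAt_target x₀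
  set L := localDeriv F x₀ u₀ with hL
  obtain ⟨K, hK, hanti⟩ := LinearMap.exists_antilipschitzWith
    (L : EuclideanSpace ℝ (Fin k) →ₗ[ℝ] Ambient n)
    (LinearMap.ker_eq_bot.2 (hF.injective_localDeriv hu))
  have hK' : (0 : ℝ) < K := hK
  have hc := (contDiffWithinAt_fderivWithin_comp_symm hF.smooth hu).continuousWithinAt
  -- On a convex piece of the half-space where the derivative is this close to `L`, the mean value
  -- inequality loses at most half of the lower bound for `L`.
  have h1 : ∀ᶠ u in 𝓝[range (𝓡∂ k)] u₀, ‖localDeriv F x₀ u - L‖ ≤ (2 * K : ℝ)⁻¹ := by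
    have := (hc.sub (continuousWithinAt_const (b := L))).norm
    have h0 : ‖localDeriv F x₀ u₀ - L‖ < (2 * K : ℝ)⁻¹ := by
      rw [sub_self, norm_zero]; positivity
    exact (this.tendsto.eventually (gt_mem_nhds h0)).mono fun u h => le_of_lt h
  have h2 := h1.and (extChartAt_target_mem_nhdsWithin_of_mem (I := 𝓡∂ k) hu)
  obtain ⟨r, hr, hball⟩ := Metric.mem_nhdsWithin_iff.1 h2
  have hsub : ball u₀ r ∩ range (𝓡∂ k) ⊆ (extChartAt (𝓡∂ k) x₀).target := fun u hu => (hball hu).2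
  refine ⟨2 * K, by positivity, r, hr, hsub, fun u hu v hv => ?_⟩
  have hder : ∀ z ∈ ball u₀ r ∩ range (𝓡∂ k), HasFDerivWithinAt (localRep F x₀)
      (localDeriv F x₀ z) (ball u₀ r ∩ range (𝓡∂ k)) z := fun z hz => by
    rw [hF.localDeriv_eq (hsub hz)]
    exact (hasFDerivWithinAt_comp_symm hF.smooth (hsub hz)).mono inter_subset_right
  have h3 := ((convex_ball u₀ r).inter convex_range).norm_image_sub_le_of_norm_hasFDerivWithin_le'
    hder (fun z hz => (hball hz).1) hv hu
  have h4 : ‖u - v‖ ≤ K * ‖L (u - v)‖ := by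
    have := hanti.le_mul_dist u v
    rwa [dist_eq_norm, dist_eq_norm, ← map_sub] at this
  have h5 : ‖L (u - v)‖ ≤ ‖localRep F x₀ u - localRep F x₀ v‖ +
      ‖localRep F x₀ u - localRep F x₀ v - L (u - v)‖ := by
    have := norm_sub_le (localRep F x₀ u - localRep F x₀ v)
      (localRep F x₀ u - localRep F x₀ v - L (u - v))
    rwa [sub_sub_cancel] at this
  have h6 : K * ((2 * K : ℝ)⁻¹ * ‖u - v‖) = ‖u - v‖ / 2 := by field_simp
  have h7 := mul_le_mul_of_nonneg_left (h5.trans (add_le_add_right h3 _)) hK'.le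
  rw [mul_add, h6] at h7
  linarith

theorem exists_injOn (hF : IsFreeBoundaryMinimal (k := k) F p R) (x₀ : M) :
    ∃ U ∈ 𝓝 x₀, InjOn F U := by
  obtain ⟨K, hK, r, hr, hsub, h⟩ := hF.exists_norm_sub_le x₀
  refine ⟨(extChartAt (𝓡∂ k) x₀).source ∩ extChartAt (𝓡∂ k) x₀ ⁻¹' ball (extChartAt (𝓡∂ k) x₀ x₀) r,
    inter_mem (extChartAt_source_mem_nhds x₀)
      ((continuousAt_extChartAt x₀).preimage_mem_nhds (ball_mem_nhds _ hr)), ?_⟩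
  have hmem : ∀ x ∈ (extChartAt (𝓡∂ k) x₀).source, extChartAt (𝓡∂ k) x₀ x ∈ range (𝓡∂ k) :=
    fun x hx => extChartAt_target_subset_range x₀ ((extChartAt (𝓡∂ k) x₀).map_source hx)
  intro x hx x' hx' hxx
  have h1 := h _ ⟨hx.2, hmem x hx.1⟩ _ ⟨hx'.2, hmem x' hx'.1⟩
  simp only [localRep, Function.comp_apply, (extChartAt (𝓡∂ k) x₀).left_inv hx.1,
    (extChartAt (𝓡∂ k) x₀).left_inv hx'.1, hxx, sub_self, norm_zero, mul_zero] at h1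
  exact (extChartAt (𝓡∂ k) x₀).injOn hx.1 hx'.1 (sub_eq_zero.1 (norm_le_zero_iff.1 h1))

variable [CompactSpace M] [T2Space M]

/-- A linear function that vanishes to first order at `x₀` is controlled by the defect. -/
theorem exists_abs_inner_le (hF : IsFreeBoundaryMinimal (k := k) F p R) {x₀ : M}
    (huniq : ∀ x, F x = F x₀ → x = x₀) {e : Ambient n} (he : inner ℝ (F x₀) e = 0)
    (hdiff : ∀ v, inner ℝ (diff k F x₀ v) e = 0) :
    ∃ C, ∀ x, |inner ℝ (F x) e| ≤ C * defect F (F x₀) x := by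
  have hy := hF.norm_eq_one x₀
  have hloc : ∃ C, ∀ᶠ x in 𝓝 x₀, |inner ℝ (F x) e| ≤ C * defect F (F x₀) x := by
    obtain ⟨K, hK, r, hr, hsub, hlip⟩ := hF.exists_norm_sub_le x₀
    set u₀ := extChartAt (𝓡∂ k) x₀ x₀ with hu₀
    have hu : u₀ ∈ (extChartAt (𝓡∂ k) x₀).target := mem_extChartAt_target x₀
    have huR : u₀ ∈ range (𝓡∂ k) := extChartAt_target_subset_range x₀ hu
    set ℓ : Ambient n →L[ℝ] ℝ := innerSL ℝ e with hℓ
    have h0 : ℓ.comp (localDeriv F x₀ u₀) = 0 := by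
      ext v
      rw [hF.localDeriv_eq hu, hu₀, extChartAt_to_inv]
      simp only [hℓ, ContinuousLinearMap.comp_apply, innerSL_apply_apply, zero_apply]
      rw [real_inner_comm]
      exact hdiff _
    obtain ⟨C, hC⟩ := ((contDiffWithinAt_fderivWithin_comp_symm hF.smooth
      hu).differentiableWithinAt (by simp)).hasFDerivWithinAt.isBigO_sub.bound
    obtain ⟨r', hr', hball⟩ := Metric.mem_nhdsWithin_iff.1 hC
    set s := min r r' with hs
    have hs0 : 0 < s := lt_min hr hr'
    -- The differential of the linear function along F vanishes at u₀ and is O(ρ) at distance ρ, so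
    -- the function is O(ρ²) by the mean value inequality on a convex set.
    have hG : ∀ u ∈ ball u₀ s ∩ range (𝓡∂ k),
        |inner ℝ (localRep F x₀ u) e| ≤ ‖ℓ‖ * |C| * ‖u - u₀‖ ^ 2 := by
      intro u hus
      set ρ := ‖u - u₀‖ with hρ
      have hρs : ρ < s := by rw [hρ, ← dist_eq_norm]; exact hus.1
      have hcb : closedBall u₀ ρ ⊆ ball u₀ s := closedBall_subset_ball hρs
      have hder : ∀ z ∈ closedBall u₀ ρ ∩ range (𝓡∂ k), HasFDerivWithinAt
          (fun z => ℓ (localRep F x₀ z)) (ℓ.comp (localDeriv F x₀ z))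
          (closedBall u₀ ρ ∩ range (𝓡∂ k)) z := fun z hz => by
        have hzt := hsub ⟨ball_subset_ball (min_le_left _ _) (hcb hz.1), hz.2⟩
        rw [hF.localDeriv_eq hzt]
        exact ℓ.hasFDerivAt.comp_hasFDerivWithinAt z
          ((hasFDerivWithinAt_comp_symm hF.smooth hzt).mono inter_subset_right)
      have hbound : ∀ z ∈ closedBall u₀ ρ ∩ range (𝓡∂ k),
          ‖ℓ.comp (localDeriv F x₀ z)‖ ≤ ‖ℓ‖ * |C| * ρ := fun z hz => by
        have h1 : ‖localDeriv F x₀ z - localDeriv F x₀ u₀‖ ≤ C * ‖z - u₀‖ :=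
          hball ⟨ball_subset_ball (min_le_right _ _) (hcb hz.1), hz.2⟩
        have h2 : ‖z - u₀‖ ≤ ρ := by rw [← dist_eq_norm]; exact hz.1
        have h3 : ℓ.comp (localDeriv F x₀ z) = ℓ.comp (localDeriv F x₀ z - localDeriv F x₀ u₀) := by
          rw [ContinuousLinearMap.comp_sub, h0, sub_zero]
        rw [h3, mul_assoc]
        refine (ContinuousLinearMap.opNorm_comp_le _ _).trans ?_
        gcongr
        refine h1.trans ?_
        gcongr
        exact le_abs_self C
      have h4 := ((convex_closedBall u₀ ρ).inter convex_range).norm_image_sub_le_of_norm_hasFDerivWithin_le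
        hder hbound ⟨mem_closedBall_self (norm_nonneg _), huR⟩
        ⟨by rw [mem_closedBall, dist_eq_norm], hus.2⟩
      have h5 : ℓ (localRep F x₀ u₀) = 0 := by
        rw [hu₀, localRep, Function.comp_apply, extChartAt_to_inv, hℓ, innerSL_apply_apply,
          real_inner_comm, he]
      rw [h5, sub_zero, hℓ, innerSL_apply_apply, real_inner_comm, Real.norm_eq_abs] at h4
      rw [sq, ← mul_assoc]
      exact h4
    refine ⟨‖ℓ‖ * |C| * (2 * K ^ 2), ?_⟩
    filter_upwards [extChartAt_source_mem_nhds (I := 𝓡∂ k) x₀,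
      (continuousAt_extChartAt (I := 𝓡∂ k) x₀).preimage_mem_nhds (ball_mem_nhds _ hs0)] with x hx1 hx2
    have hxR : extChartAt (𝓡∂ k) x₀ x ∈ range (𝓡∂ k) :=
      extChartAt_target_subset_range x₀ ((extChartAt (𝓡∂ k) x₀).map_source hx1)
    have hx2' : extChartAt (𝓡∂ k) x₀ x ∈ ball u₀ s := hx2
    have h1 := hG _ ⟨hx2', hxR⟩
    have h2 := hlip _ ⟨ball_subset_ball (min_le_left _ _) hx2', hxR⟩ _ ⟨mem_ball_self hr, huR⟩
    have h3 : localRep F x₀ (extChartAt (𝓡∂ k) x₀ x) = F x := by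
      rw [localRep, Function.comp_apply, (extChartAt (𝓡∂ k) x₀).left_inv hx1]
    have h4 : localRep F x₀ u₀ = F x₀ := by
      rw [localRep, Function.comp_apply, hu₀, extChartAt_to_inv]
    rw [h3] at h1
    rw [h3, h4] at h2
    rw [hF.defect_eq hy]
    calc _ ≤ _ := h1
      _ ≤ ‖ℓ‖ * |C| * (K * ‖F x - F x₀‖) ^ 2 := by gcongr
      _ = _ := by ring
  obtain ⟨C₁, hC₁⟩ := hloc
  obtain ⟨U, hUsub, hU, hxU⟩ := mem_nhds_iff.1 hC₁
  have hℓc : Continuous fun x => |(inner ℝ (F x) e : ℝ)| :=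
    (hF.smooth.continuous.inner continuous_const).abs
  have hdc := hF.continuous_defect (F x₀)
  -- Away from x₀ the defect has no zeros, since x₀ is the only preimage, and compactness gives the
  -- bound.
  obtain ⟨C₂, hC₂⟩ := hU.isClosed_compl.isCompact.exists_bound_of_continuousOn
    (f := fun x => |(inner ℝ (F x) e : ℝ)| / defect F (F x₀) x)
    (hℓc.continuousOn.div hdc.continuousOn fun x hx h0 =>
      hx (by rw [huniq x ((hF.defect_eq_zero_iff hy).1 h0)]; exact hxU))
  refine ⟨max C₁ C₂, fun x => ?_⟩
  have hd0 := hF.defect_nonneg hy x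
  by_cases hx : x ∈ U
  · refine (hUsub hx : |inner ℝ (F x) e| ≤ C₁ * defect F (F x₀) x).trans ?_
    gcongr
    exact le_max_left _ _
  · have hpos : 0 < defect F (F x₀) x := lt_of_le_of_ne hd0 fun h0 =>
      hx (by rw [huniq x ((hF.defect_eq_zero_iff hy).1 h0.symm)]; exact hxU)
    have h1 := (le_abs_self _).trans (hC₂ x hx)
    rw [div_le_iff₀ hpos] at h1
    refine h1.trans ?_
    gcongr
    exact le_max_right _ _

variable [MeasurableSpace M] [BorelSpace M]

/-- The field `ℓ² (w + ε)^(-j) (y - c w p)` with a linear function `ℓ` has vanishing total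
divergence. -/
theorem exists_divergence_inner_sq_eq (hF : IsFreeBoundaryMinimal (k := k) F p R) {κ : ℕ}
    (hp : ‖p‖ = 1)
    (hR0 : 0 < R) (hR : R ≤ Real.pi / 2) (hy : ‖y‖ = 1) (hyp : inner ℝ y p = Real.cos R)
    (hny : ∀ x, normalPart k F y x = 0) (hnp : Real.cos R ≠ 0 → ∀ x, normalPart k F p x = 0)
    {e : Ambient n} (hey : inner ℝ y e = 0) (hep : inner ℝ p e = 0) {c : ℝ}
    (hcb : c * (1 - Real.cos R ^ 2) = Real.cos R) (hc0 : Real.cos R = 0 → c = 0)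
    {ε : ℝ} (hε : 0 < ε) : ∃ f : M → ℝ, Continuous f ∧ ∫ x, f x ∂(volumeMeasure k F) = 0 ∧
      ∀ x, f x = inner ℝ (F x) e ^ 2 * (((defect F y x + ε) ^ (κ + 1))⁻¹ *
        divergenceTerm k c (Real.cos R) (defect F y x) (inner ℝ (F x) p) +
        (κ + 1) * (((defect F y x + ε) ^ (κ + 2))⁻¹ * defect F y x) *
          gradientTerm c (Real.cos R) (defect F y x) (inner ℝ (F x) p)) := by
  have hdc := hF.continuous_defect y
  have hℓc : Continuous fun x => (inner ℝ (F x) e : ℝ) := hF.smooth.continuous.inner continuous_const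
  have hlin : ∀ (e : Ambient n) x, HasFDerivAt (fun q : Ambient n => (inner ℝ q e : ℝ))
      (innerSL ℝ e) (F x) := fun e x => by
    have h1 : HasFDerivAt (fun q : Ambient n => inner ℝ e q) (innerSL ℝ e) (F x) :=
      (innerSL ℝ e).hasFDerivAt
    simpa only [real_inner_comm _ e] using h1
  have hA : ∀ x, HasFDerivAt (fun q : Ambient n => (inner ℝ q e : ℝ) ^ 2)
      ((2 * inner ℝ (F x) e : ℝ) • innerSL ℝ e) (F x) := fun x =>
    ((hlin e x).pow 2).congr_fderiv (by ext v; simp)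
  have hB : ∀ x, HasFDerivAt (fun q : Ambient n => -c * ((1 - inner ℝ q y) * (inner ℝ q e : ℝ) ^ 2))
      ((c * inner ℝ (F x) e ^ 2 : ℝ) • innerSL ℝ y +
        (-2 * c * defect F y x * inner ℝ (F x) e : ℝ) • innerSL ℝ e) (F x) := fun x =>
    ((((hlin y x).const_sub 1).mul (hA x)).const_mul (-c)).congr_fderiv (by
      ext v
      simp only [defect, add_apply, smul_apply, neg_apply, smul_eq_mul, innerSL_apply_apply]
      ring)
  have key := hF.integral_weighted_divergence hp hR0 hR hy hyp hA hB
    ((continuous_const.mul hℓc).smul continuous_const)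
    (((continuous_const.mul (hℓc.pow 2)).smul continuous_const).add
      (((continuous_const.mul hdc).mul hℓc).smul continuous_const))
    (fun x _ => by
      rw [show 1 - inner ℝ (F x) y = defect F y x from rfl]
      linear_combination (-defect F y x * inner ℝ (F x) e ^ 2) * hcb) (κ + 1) hε
  refine ⟨_, key.1, key.2, fun x => ?_⟩
  have e0 : 1 - inner ℝ (F x) y = defect F y x := rfl
  have e0' : inner ℝ (F x) y = 1 - defect F y x := by rw [defect]; ring
  have hPy : tangentProj k F x y = y - (1 - defect F y x) • F x := by
    have := hny x
    rw [normalPart, e0', sub_eq_zero] at this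
    exact this.symm
  have e1 : inner ℝ e (tangentProj k F x y) = -((1 - defect F y x) * inner ℝ (F x) e) := by
    rw [hPy, inner_sub_right, inner_smul_right, real_inner_comm, hey, real_inner_comm, zero_sub]
  -- If cos R = 0 nothing is known about the normal part of p, but then c = 0; hence the factor c on
  -- both sides.
  have e2 : c * inner ℝ e (tangentProj k F x p) = -(c * (inner ℝ (F x) p * inner ℝ (F x) e)) := by
    rcases eq_or_ne (Real.cos R) 0 with h0 | h0
    · rw [hc0 h0]; simp
    · have := hnp h0 x
      rw [normalPart, sub_eq_zero] at this
      rw [← this, inner_sub_right, inner_smul_right, real_inner_comm, hep, real_inner_comm e (F x)]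
      ring
  have e3 : inner ℝ y (tangentProj k F x p) = tau k F y p x := by
    rw [tau_comm, tau, real_inner_comm]
  have hyy := hF.tau_eq y y x
  have hyp' := hF.tau_eq y p x
  rw [hny x, inner_zero_left, real_inner_self_eq_norm_sq, hy, e0'] at hyy
  rw [hny x, inner_zero_left, hyp, e0'] at hyp'
  simp only [add_apply, smul_apply, smul_eq_mul, innerSL_apply_apply, e0, e1, e3, hyy,
    hyp', divergenceTerm, gradientTerm]
  push_cast
  linear_combination (-2 * defect F y x * inner ℝ (F x) e *
    ((defect F y x + ε) ^ (κ + 1))⁻¹) * e2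

/-- If `M` is conical about `y` and `p`, then a linear function that vanishes at these two points and
is controlled by the defect vanishes on the submanifold. -/
theorem inner_eq_zero_of_normalPart (hF : IsFreeBoundaryMinimal (k := k) F p R) {κ : ℕ}
    (hk : k = 2 * κ) (hκ : 2 ≤ κ) (hp : ‖p‖ = 1)
    (hR0 : 0 < R) (hR : R ≤ Real.pi / 2) (hy : ‖y‖ = 1) (hyp : inner ℝ y p = Real.cos R)
    (hny : ∀ x, normalPart k F y x = 0) (hnp : Real.cos R ≠ 0 → ∀ x, normalPart k F p x = 0)
    {e : Ambient n} (hey : inner ℝ y e = 0) (hep : inner ℝ p e = 0) {C : ℝ}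
    (hC : ∀ x, |inner ℝ (F x) e| ≤ C * defect F y x) (x : M) : inner ℝ (F x) e = 0 := by
  have ha0 := cos_nonneg' hR0 hR
  have hb := one_sub_sq_pos ha0 (cos_lt_one' hR0 hR)
  have hax := hF.cos_le_inner hp hR0 hR
  obtain ⟨c, hc, hcb, hcz⟩ : ∃ c, 0 ≤ c ∧ c * (1 - Real.cos R ^ 2) = Real.cos R ∧
      (Real.cos R = 0 → c = 0) :=
    ⟨Real.cos R / (1 - Real.cos R ^ 2), by positivity, by field_simp, fun h => by rw [h]; simp⟩
  have hdc := hF.continuous_defect y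
  have hd0 := hF.defect_nonneg hy
  have hpos := hF.ae_defect_pos hp hR0 hR hy hyp (by omega)
  have hint := hF.integrable_defect_pow_inv hp hR0 hR hy hyp (by omega) (κ - 1) (by omega)
  have hℓc : Continuous fun x => (inner ℝ (F x) e : ℝ) := hF.smooth.continuous.inner continuous_const
  have hXc : Continuous fun x => (inner ℝ (F x) p : ℝ) := hF.smooth.continuous.inner continuous_const
  obtain ⟨E₁, hE₁⟩ : ∃ E₁ : M → ℝ, ∀ x, E₁ x =
    divergenceTerm k c (Real.cos R) (defect F y x) (inner ℝ (F x) p) := ⟨_, fun _ => rfl⟩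
  obtain ⟨E₂, hE₂⟩ : ∃ E₂ : M → ℝ, ∀ x, E₂ x =
    gradientTerm c (Real.cos R) (defect F y x) (inner ℝ (F x) p) := ⟨_, fun _ => rfl⟩
  have hE₁c : Continuous E₁ := by
    rw [funext hE₁]
    unfold divergenceTerm
    fun_prop
  have hE₂c : Continuous E₂ := by
    rw [funext hE₂]
    unfold gradientTerm
    fun_prop
  obtain ⟨K₁, hK₁⟩ := isCompact_univ.exists_bound_of_continuousOn hE₁c.continuousOn
  obtain ⟨K₂, hK₂⟩ := isCompact_univ.exists_bound_of_continuousOn hE₂c.continuousOn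
  obtain ⟨δ, hδ, hδ0, -⟩ := exists_seq_tendsto_zero_le_one
  choose f hfc hf0 hf using fun m => hF.exists_divergence_inner_sq_eq (κ := κ) hp hR0 hR hy hyp
    hny hnp hey hep hcb hcz (hδ0 m)
  simp only [← hE₁, ← hE₂] at hf
  have hpt : ∀ x, 0 < defect F y x →
      (κ + 1) * defect F y x ≤ E₁ x + (κ + 1) * E₂ x := fun x hx => by
    rw [hE₁, hE₂, hk]
    exact le_divergenceTerm_add_gradientTerm hc ha0 hx.le (hax x)
  clear hE₁ hE₂
  obtain ⟨ℓ, hℓ⟩ : ∃ ℓ : M → ℝ, ∀ x, inner ℝ (F x) e = ℓ x := ⟨_, fun _ => rfl⟩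
  simp only [hℓ] at hf hC hℓc ⊢
  have hbound : ∀ x, 0 < defect F y x → ∀ ε : ℝ, 0 ≤ ε →
      ‖ℓ x ^ 2 * (((defect F y x + ε) ^ (κ + 1))⁻¹ * E₁ x +
        (κ + 1) * (((defect F y x + ε) ^ (κ + 2))⁻¹ * defect F y x) * E₂ x)‖ ≤
      C ^ 2 * (K₁ + (κ + 1) * K₂) * (defect F y x ^ (κ - 1))⁻¹ := fun x hx ε hε =>
    norm_weighted_le (by omega) hx hε (hC x) (hK₁ x (mem_univ x)) (hK₂ x (mem_univ x))
  obtain ⟨g, hg⟩ : ∃ g : M → ℝ, ∀ x, g x = ℓ x ^ 2 * (((defect F y x) ^ (κ + 1))⁻¹ * E₁ x +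
        (κ + 1) * (((defect F y x) ^ (κ + 2))⁻¹ * defect F y x) * E₂ x) := ⟨_, fun _ => rfl⟩
  have hgm : AEStronglyMeasurable g (volumeMeasure k F) := by
    rw [funext hg]
    exact ((hℓc.measurable.pow_const 2).mul ((((hdc.measurable.pow_const _).inv).mul
      hE₁c.measurable).add ((((hdc.measurable.pow_const _).inv.mul hdc.measurable).const_mul _).mul
        hE₂c.measurable))).aestronglyMeasurable
  have hgi : Integrable g (volumeMeasure k F) := by
    refine (hint.const_mul (C ^ 2 * (K₁ + (κ + 1) * K₂))).mono' hgm ?_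
    filter_upwards [hpos] with x hx
    have := hbound x hx 0 le_rfl
    rw [hg]
    simpa only [add_zero] using this
  have hlim : Tendsto (fun m => ∫ x, f m x ∂(volumeMeasure k F)) atTop
      (𝓝 (∫ x, g x ∂(volumeMeasure k F))) := by
    refine tendsto_integral_of_dominated_convergence _
      (fun m => (hfc m).measurable.aestronglyMeasurable)
      (hint.const_mul (C ^ 2 * (K₁ + (κ + 1) * K₂))) (fun m => ?_) ?_
    · filter_upwards [hpos] with x hx
      rw [hf]
      exact hbound x hx _ (hδ0 m).le
    · filter_upwards [hpos] with x hx
      have h1 : Tendsto (fun m => defect F y x + δ m) atTop (𝓝 (defect F y x)) := by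
        simpa using hδ.const_add (defect F y x)
      have h2 := ((h1.pow (κ + 1)).inv₀ (pow_ne_zero _ hx.ne')).mul_const (E₁ x)
      have h3 := ((((h1.pow (κ + 2)).inv₀ (pow_ne_zero _ hx.ne')).mul_const
        (defect F y x)).const_mul (κ + 1 : ℝ)).mul_const (E₂ x)
      rw [hg]
      exact ((h2.add h3).const_mul _).congr fun m => (hf m x).symm
  have hg0 : ∫ x, g x ∂(volumeMeasure k F) = 0 := by
    refine tendsto_nhds_unique hlim ?_
    simp only [hf0]
    exact tendsto_const_nhds
  -- The limit integrand is at least (κ + 1) ℓ² w^(−κ) while its integral is zero, so ℓ vanishes.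
  have hgge : ∀ x, 0 < defect F y x →
      ℓ x ^ 2 * ((defect F y x ^ (κ + 1))⁻¹ * ((κ + 1) * defect F y x)) ≤ g x := by
    intro x hx
    have h2 : ((defect F y x) ^ (κ + 2))⁻¹ * defect F y x = (defect F y x ^ (κ + 1))⁻¹ := by
      rw [pow_succ _ (κ + 1)]; field_simp
    rw [hg, h2]
    have h3 := hpt x hx
    calc _ ≤ ℓ x ^ 2 * ((defect F y x ^ (κ + 1))⁻¹ * (E₁ x + (κ + 1) * E₂ x)) := by gcongr
      _ = _ := by ring
  have hgn : 0 ≤ᵐ[volumeMeasure k F] g := by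
    filter_upwards [hpos] with x hx
    exact le_trans (by positivity) (hgge x hx)
  have hgz := (integral_eq_zero_iff_of_nonneg_ae hgn hgi).1 hg0
  have := hF.isOpenPosMeasure
  refine congrFun (Measure.eq_of_ae_eq (μ := volumeMeasure k F) (f := ℓ) (g := fun _ => 0) ?_ hℓc
    continuous_const) x
  filter_upwards [hpos, hgz] with x hx hx0
  have h1 := hgge x hx
  rw [hx0] at h1
  by_contra hne
  have : 0 < ℓ x ^ 2 := by positivity
  exact absurd h1 (not_le.2 (by simp only [Pi.zero_apply]; positivity))

end IsFreeBoundaryMinimal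


end

/-! ### Equality: injectivity, and the image as a full geodesic ball. -/

section

open Filter Topology Set Metric

section Cone

variable {n : ℕ} {p : Ambient n} {V : Submodule ℝ (Ambient n)} {a : ℝ}

/-- A closed subset of a great sphere that is open in it over an open spherical cap, and that meets
this cap, contains the closed cap. -/
theorem mem_of_le_inner_of_open (hp : ‖p‖ = 1) (hpV : p ∈ V) (ha : 0 ≤ a) (ha1 : a < 1)
    {Z : Set (Ambient n)} (hZ : IsClosed Z)
    (hopen : ∀ v : V, (v : Ambient n) ∈ Z → a < inner ℝ (v : Ambient n) p →
      ∀ᶠ v' : V in 𝓝 v, ‖v'‖⁻¹ • (v' : Ambient n) ∈ Z)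
    (hne : ∃ v : V, (v : Ambient n) ∈ Z ∧ ‖v‖ = 1 ∧ a < inner ℝ (v : Ambient n) p)
    {v : Ambient n} (hv : v ∈ V) (hv1 : ‖v‖ = 1) (hvp : a ≤ inner ℝ v p) : v ∈ Z := by
  set N : V → Ambient n := fun v => ‖v‖⁻¹ • (v : Ambient n) with hN
  -- The cone over the open cap. It is convex because a ≥ 0, so its connectedness replaces that of
  -- the cap.
  set K : Set V := {v | a * ‖v‖ < inner ℝ (v : Ambient n) p} with hK
  have hinner : Continuous fun v : V => (inner ℝ (v : Ambient n) p : ℝ) :=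
    continuous_subtype_val.inner continuous_const
  have hKo : IsOpen K := isOpen_lt (continuous_const.mul continuous_norm) hinner
  have hK0 : ∀ v ∈ K, 0 < ‖v‖ := by
    intro v hv
    refine norm_pos_iff.2 fun h0 => ?_
    have hv' : a * ‖v‖ < inner ℝ (v : Ambient n) p := hv
    simp [h0] at hv'
  have hKc : Convex ℝ K := by
    intro v hv w hw s t hs ht hst
    have hv' : a * ‖v‖ < inner ℝ (v : Ambient n) p := hv
    have hw' : a * ‖w‖ < inner ℝ (w : Ambient n) p := hw
    change a * ‖s • v + t • w‖ < inner ℝ ((s • v + t • w : V) : Ambient n) p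
    have h1 : ‖s • v + t • w‖ ≤ s * ‖v‖ + t * ‖w‖ := by
      refine (norm_add_le _ _).trans ?_
      rw [norm_smul, norm_smul, Real.norm_of_nonneg hs, Real.norm_of_nonneg ht]
    have h2 : inner ℝ ((s • v + t • w : V) : Ambient n) p =
        s * inner ℝ (v : Ambient n) p + t * inner ℝ (w : Ambient n) p := by
      simp [inner_add_left, inner_smul_left]
    rw [h2]
    have h3 := mul_le_mul_of_nonneg_left h1 ha
    rcases hs.eq_or_lt with h0 | h0
    · have : t = 1 := by linarith
      subst this
      rw [← h0] at h3 ⊢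
      linarith
    · have h4 := mul_lt_mul_of_pos_left hv' h0
      have h5 := mul_le_mul_of_nonneg_left hw'.le ht
      linarith
  have hNc : ContinuousOn N K := fun v hv =>
    ((continuous_norm.continuousAt.inv₀ (hK0 v hv).ne').smul
      continuous_subtype_val.continuousAt).continuousWithinAt
  have hNn : ∀ v ∈ K, ∃ v' : V, (v' : Ambient n) = N v ∧ a < inner ℝ (v' : Ambient n) p := by
    intro v hv
    have hv' : a * ‖v‖ < inner ℝ (v : Ambient n) p := hv
    refine ⟨‖v‖⁻¹ • v, rfl, ?_⟩
    rw [Submodule.coe_smul, inner_smul_left, conj_trivial, inv_mul_eq_div, lt_div_iff₀ (hK0 v hv)]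
    exact hv'
  have hsub : K ⊆ K ∩ N ⁻¹' Z := by
    refine IsPreconnected.subset_left_of_subset_union (v := K ∩ N ⁻¹' Zᶜ) ?_
      (hNc.isOpen_inter_preimage hKo hZ.isOpen_compl) ?_ ?_ ?_ hKc.isPreconnected
    · rw [isOpen_iff_mem_nhds]
      rintro v ⟨hv, hvZ⟩
      refine inter_mem (hKo.mem_nhds hv) ?_
      obtain ⟨v', hv', hv'p⟩ := hNn v hv
      have h1 := hopen v' (by rw [hv']; exact hvZ) hv'p
      have h2 : Tendsto (fun z : V => ‖v‖⁻¹ • z) (𝓝 v) (𝓝 v') := by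
        have : v' = ‖v‖⁻¹ • v := Subtype.ext hv'
        rw [this]
        exact (continuous_const_smul _).tendsto v
      filter_upwards [h2.eventually h1] with z hz
      have h3 := hK0 v hv
      have h4 : ‖‖v‖⁻¹ • z‖⁻¹ • ((‖v‖⁻¹ • z : V) : Ambient n) = N z := by
        rw [norm_smul, norm_inv, norm_norm, Submodule.coe_smul, smul_smul, mul_inv, inv_inv]
        simp only [hN]
        congr 1
        field_simp
      rw [h4] at hz
      exact hz
    · exact Set.disjoint_left.2 fun z hz hz' => hz'.2 hz.2
    · intro z hz
      by_cases h : N z ∈ Z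
      · exact Or.inl ⟨hz, h⟩
      · exact Or.inr ⟨hz, h⟩
    · obtain ⟨z, hzZ, hz1, hz⟩ := hne
      have hzK : z ∈ K := by
        change a * ‖z‖ < _
        rwa [hz1, mul_one]
      refine ⟨z, hzK, hzK, ?_⟩
      change ‖z‖⁻¹ • (z : Ambient n) ∈ Z
      rwa [hz1, inv_one, one_smul]
  -- A point of the closed cap is approached from the open cap by pushing it towards p.
  have hlim : Tendsto (fun s : ℝ => ‖v + s • p‖⁻¹ • (v + s • p)) (𝓝[>] 0) (𝓝 v) := by
    have h1 : Tendsto (fun s : ℝ => v + s • p) (𝓝[>] 0) (𝓝 v) := by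
      have : Tendsto (fun s : ℝ => v + s • p) (𝓝 0) (𝓝 (v + (0 : ℝ) • p)) :=
        (continuous_const.add (continuous_id.smul continuous_const)).tendsto 0
      rw [zero_smul, add_zero] at this
      exact this.mono_left nhdsWithin_le_nhds
    have h2 := (h1.norm.inv₀ (by rw [hv1]; exact one_ne_zero)).smul h1
    rwa [hv1, inv_one, one_smul] at h2
  refine hZ.mem_of_tendsto hlim ?_
  filter_upwards [self_mem_nhdsWithin] with s hs
  have hs0 : (0 : ℝ) < s := hs
  set z : V := ⟨v + s • p, V.add_mem hv (V.smul_mem s hpV)⟩ with hz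
  have hzK : z ∈ K := by
    change a * ‖v + s • p‖ < inner ℝ (v + s • p) p
    have h1 : ‖v + s • p‖ ≤ 1 + s := by
      refine (norm_add_le _ _).trans ?_
      rw [norm_smul, hv1, hp, Real.norm_of_nonneg hs0.le, mul_one]
    rw [inner_add_left, inner_smul_left, conj_trivial, real_inner_self_eq_norm_sq, hp]
    have h2 := mul_le_mul_of_nonneg_left h1 ha
    nlinarith
  exact (hsub hzK).2

end Cone

namespace IsFreeBoundaryMinimal

variable {k n : ℕ} [NeZero k] {M : Type*} [TopologicalSpace M]
  [ChartedSpace (EuclideanHalfSpace k) M] [IsManifold (𝓡∂ k) ∞ M]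
  {F : M → Ambient n} {p : Ambient n} {R : ℝ}

variable [CompactSpace M] [T2Space M]

/-- Inside a great sphere of the same dimension, the submanifold is open at interior points. -/
theorem eventually_exists_eq (hF : IsFreeBoundaryMinimal (k := k) F p R)
    {V : Submodule ℝ (Ambient n)} (hdim : Module.finrank ℝ V = k + 1) (hFV : ∀ x, F x ∈ V) {x₀ : M}
    (hx₀ : x₀ ∉ (𝓡∂ k).boundary M) {U : Set M} (hU : U ∈ 𝓝 x₀) {v₀ : V} (hv₀ : (v₀ : Ambient n) = F x₀) :
    ∀ᶠ v : V in 𝓝 v₀, ∃ x ∈ U, F x = ‖v‖⁻¹ • (v : Ambient n) := by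
  set u₀ := extChartAt (𝓡∂ k) x₀ x₀ with hu₀
  have hu : u₀ ∈ (extChartAt (𝓡∂ k) x₀).target := mem_extChartAt_target x₀
  have hint : range (𝓡∂ k) ∈ 𝓝 u₀ := by
    rw [← ModelWithCorners.compl_interior, notMem_compl_iff] at hx₀
    exact mem_interior_iff_mem_nhds.1 hx₀
  have htgt : (extChartAt (𝓡∂ k) x₀).target ∈ 𝓝 u₀ := by
    have h2 := extChartAt_target_mem_nhdsWithin_of_mem (I := 𝓡∂ k) hu
    rwa [nhdsWithin_eq_nhds.2 hint] at h2
  have hinv : (extChartAt (𝓡∂ k) x₀).symm u₀ = x₀ := extChartAt_to_inv x₀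
  set L := localDeriv F x₀ u₀ with hL
  have hLinj : Function.Injective L := hF.injective_localDeriv hu
  have hstrict : HasStrictFDerivAt (localRep F x₀) L u₀ := by
    have h1 : ContDiffAt ℝ ∞ (localRep F x₀) u₀ :=
      (contDiffOn_comp_symm hF.smooth x₀).contDiffAt htgt
    have h2 := h1.hasStrictFDerivAt (by simp)
    have h3 : L = fderiv ℝ (localRep F x₀) u₀ := fderivWithin_of_mem_nhds hint
    rwa [h3]
  have hLV : ∀ v, L v ∈ V := by
    intro v
    rw [← Submodule.starProjection_eq_self_iff]
    have h1 : HasFDerivAt (localRep F x₀) (V.starProjection.comp L) u₀ := by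
      refine (V.starProjection.hasFDerivAt.comp u₀ hstrict.hasFDerivAt).congr_of_eventuallyEq ?_
      exact Eventually.of_forall fun u => (Submodule.starProjection_eq_self_iff.2 (hFV _)).symm
    exact DFunLike.congr_fun (h1.unique hstrict.hasFDerivAt) v
  have hLF : ∀ v, inner ℝ (F x₀) (L v) = 0 := by
    intro v
    rw [hL, hF.localDeriv_eq hu, hinv]
    exact hF.inner_diff_self x₀ _
  set π := V.orthogonalProjectionOnto with hπ
  have hπv : ∀ z (hz : z ∈ V), π z = ⟨z, hz⟩ := fun z hz =>
    Submodule.orthogonalProjectionOnto_mem_subspace_eq_self ⟨z, hz⟩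
  -- The cone map (u, r) ↦ r F(u). Its derivative at (u₀, 1) is injective because F is orthogonal to
  -- the tangent plane, hence bijective by dimension, so Φ is locally open.
  set Φ : EuclideanSpace ℝ (Fin k) × ℝ → V := fun q => q.2 • π (localRep F x₀ q.1) with hΦ
  have hfst : HasStrictFDerivAt (fun q : EuclideanSpace ℝ (Fin k) × ℝ => π (localRep F x₀ q.1))
      ((π.comp L).comp (ContinuousLinearMap.fst ℝ _ ℝ)) (u₀, 1) :=
    HasStrictFDerivAt.comp (g := fun u => π (localRep F x₀ u)) (u₀, (1 : ℝ))
      (π.hasStrictFDerivAt.comp u₀ hstrict) hasStrictFDerivAt_fst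
  have hsnd : HasStrictFDerivAt (fun q : EuclideanSpace ℝ (Fin k) × ℝ => q.2)
      (ContinuousLinearMap.snd ℝ (EuclideanSpace ℝ (Fin k)) ℝ) (u₀, 1) := hasStrictFDerivAt_snd
  set Φ' : EuclideanSpace ℝ (Fin k) × ℝ →L[ℝ] V :=
    (1 : ℝ) • (π.comp L).comp (ContinuousLinearMap.fst ℝ _ ℝ) +
      (ContinuousLinearMap.snd ℝ (EuclideanSpace ℝ (Fin k)) ℝ).smulRight (π (localRep F x₀ u₀)) with hΦ'
  have hder : HasStrictFDerivAt Φ Φ' (u₀, 1) := hsnd.smul hfst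
  have hrep : localRep F x₀ u₀ = F x₀ := by rw [localRep, Function.comp_apply, hinv]
  have hΦ'v : ∀ v s, ((Φ' (v, s) : V) : Ambient n) = L v + s • F x₀ := by
    intro v s
    simp only [hΦ', add_apply, one_smul, ContinuousLinearMap.comp_apply,
      ContinuousLinearMap.smulRight_apply, ContinuousLinearMap.coe_fst', ContinuousLinearMap.coe_snd',
      hrep, hπv _ (hLV v), hπv _ (hFV x₀)]
    rfl
  have hinj : Function.Injective (Φ' : EuclideanSpace ℝ (Fin k) × ℝ →ₗ[ℝ] V) := by
    rw [injective_iff_map_eq_zero]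
    rintro ⟨v, s⟩ h0
    have h1 : L v + s • F x₀ = 0 := by
      rw [← hΦ'v]
      exact congrArg Subtype.val h0
    have h2 : s = 0 := by
      have := congrArg (fun z => (inner ℝ (F x₀) z : ℝ)) h1
      simpa [inner_add_right, inner_smul_right, hLF, real_inner_self_eq_norm_sq,
        hF.norm_eq_one] using this
    rw [h2, zero_smul, add_zero] at h1
    rw [h2, hLinj (h1.trans (map_zero L).symm)]
    rfl
  have hrange : LinearMap.range (Φ' : EuclideanSpace ℝ (Fin k) × ℝ →ₗ[ℝ] V) = ⊤ := by
    refine LinearMap.range_eq_top.2 ((LinearMap.injective_iff_surjective_of_finrank_eq_finrank ?_).1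
      hinj)
    rw [hdim, Module.finrank_prod, finrank_euclideanSpace_fin, Module.finrank_self]
  have hmap := HasStrictFDerivAt.map_nhds_eq_of_surj hder hrange
  have hΦ0 : Φ (u₀, 1) = v₀ := by
    refine Subtype.ext ?_
    simp only [hΦ, hrep, one_smul, hπv _ (hFV x₀), hv₀]
  rw [hΦ0] at hmap
  have hUu : (extChartAt (𝓡∂ k) x₀).symm ⁻¹' U ∈ 𝓝 u₀ := by
    refine ((continuousOn_extChartAt_symm (I := 𝓡∂ k) x₀).continuousAt htgt).preimage_mem_nhds ?_
    rwa [hinv]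
  have hnhds : ((extChartAt (𝓡∂ k) x₀).symm ⁻¹' U) ×ˢ Ioi (0 : ℝ) ∈
      𝓝 ((u₀, 1) : EuclideanSpace ℝ (Fin k) × ℝ) :=
    prod_mem_nhds hUu (Ioi_mem_nhds one_pos)
  rw [← hmap]
  refine Filter.mem_of_superset (image_mem_map hnhds) ?_
  rintro _ ⟨⟨u, r⟩, ⟨huU, hr⟩, rfl⟩
  have hr0 : (0 : ℝ) < r := hr
  refine ⟨(extChartAt (𝓡∂ k) x₀).symm u, huU, ?_⟩
  have h1 : ((r • π (localRep F x₀ u) : V) : Ambient n) =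
      r • F ((extChartAt (𝓡∂ k) x₀).symm u) := by
    rw [localRep, Function.comp_apply, hπv _ (hFV _)]
    rfl
  change _ = ‖r • π (localRep F x₀ u)‖⁻¹ • ((r • π (localRep F x₀ u) : V) : Ambient n)
  rw [← Submodule.norm_coe, h1, norm_smul, hF.norm_eq_one, mul_one, Real.norm_of_nonneg hr0.le,
    smul_smul, inv_mul_cancel₀ hr0.ne', one_smul]

/-- The set of double points is closed, since an immersion is locally injective. -/
theorem isClosed_doublePoints (hF : IsFreeBoundaryMinimal (k := k) F p R) :
    IsClosed {z | ∃ x x', x ≠ x' ∧ F x = z ∧ F x' = z} := by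
  have hFc := hF.smooth.continuous
  have hclosed : IsClosed {q : M × M | F q.1 = F q.2 ∧ q.1 ≠ q.2} := by
    rw [← isOpen_compl_iff, isOpen_iff_mem_nhds]
    rintro ⟨x, x'⟩ hx
    by_cases hxx : F x = F x'
    · have h1 : x = x' := by
        by_contra h
        exact hx ⟨hxx, h⟩
      subst h1
      obtain ⟨U, hU, hinj⟩ := hF.exists_injOn x
      filter_upwards [prod_mem_nhds hU hU] with q hq h
      exact h.2 (hinj hq.1 hq.2 h.1)
    · have h1 : {q : M × M | F q.1 ≠ F q.2} ∈ 𝓝 (x, x') :=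
        (isOpen_ne_fun (hFc.comp continuous_fst) (hFc.comp continuous_snd)).mem_nhds hxx
      filter_upwards [h1] with q hq h
      exact hq h.1
  have h2 : {z | ∃ x x', x ≠ x' ∧ F x = z ∧ F x' = z} =
      (fun q : M × M => F q.1) '' {q : M × M | F q.1 = F q.2 ∧ q.1 ≠ q.2} := by
    ext z
    constructor
    · rintro ⟨x, x', hne, h1, h2⟩
      exact ⟨(x, x'), ⟨h1.trans h2.symm, hne⟩, h1⟩
    · rintro ⟨⟨x, x'⟩, ⟨h1, hne⟩, h2⟩
      exact ⟨x, x', hne, h2, h1.symm.trans h2⟩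
  rw [h2]
  exact (hclosed.isCompact.image (hFc.comp continuous_fst)).isClosed

theorem eq_smul_sub_of_mem_boundary (hF : IsFreeBoundaryMinimal (k := k) F p R) (hR0 : 0 < R)
    (hR : R ≤ Real.pi / 2) {x₀ : M} (hx₀ : x₀ ∈ (𝓡∂ k).boundary M) :
    ∃ v, p = Real.cos R • F x₀ - diff k F x₀ v := by
  obtain ⟨v, hv⟩ : ∃ v : EuclideanSpace ℝ (Fin k), diff k F x₀ v = distGradient p (F x₀) :=
    hF.orthogonal x₀ hx₀
  have hd := (hF.boundary x₀ hx₀).2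
  have hsin : Real.sin R ≠ 0 := (Real.sin_pos_of_pos_of_lt_pi hR0 (by linarith [Real.pi_pos])).ne'
  have hv' : diff k F x₀ v = (Real.sin R)⁻¹ • (Real.cos R • F x₀ - p) := by
    rw [distGradient, hd] at hv
    exact hv
  refine ⟨Real.sin R • v, ?_⟩
  rw [map_smul, hv', smul_smul, mul_inv_cancel₀ hsin, one_smul, sub_sub_cancel]

/-- If ⟨F, p⟩ were constant, p would be orthogonal to the tangent planes. The free boundary
condition writes p as cos R · F(x₀) minus a tangent vector, and pairing with p would give 1 = cos²
R. -/
theorem exists_cos_lt_inner (hF : IsFreeBoundaryMinimal (k := k) F p R) (hp : ‖p‖ = 1) (hR0 : 0 < R)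
    (hR : R ≤ Real.pi / 2) {x₀ : M} (hx₀ : x₀ ∈ (𝓡∂ k).boundary M) :
    ∃ x, Real.cos R < inner ℝ (F x) p := by
  by_contra hne
  push Not at hne
  have hconst : (fun x => inner ℝ p (F x)) = fun _ => Real.cos R := by
    funext x
    rw [real_inner_comm]
    exact le_antisymm (hne x) (hF.cos_le_inner hp hR0 hR x)
  obtain ⟨v, hv⟩ := hF.eq_smul_sub_of_mem_boundary hR0 hR hx₀
  have h1 : HasMFDerivAt (𝓡∂ k) 𝓘(ℝ, Ambient n) F x₀ (diff k F x₀) :=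
    (hF.smooth.mdifferentiable (by simp) x₀).hasMFDerivAt
  have h2 : HasFDerivAt (fun q : Ambient n => (inner ℝ p q : ℝ)) (innerSL ℝ p) (F x₀) :=
    (innerSL ℝ p).hasFDerivAt
  have h3 := h2.hasMFDerivAt.comp x₀ h1
  have h4 : (fun q : Ambient n => (inner ℝ p q : ℝ)) ∘ F = fun _ => Real.cos R := hconst
  rw [h4] at h3
  have h5 := hasMFDerivAt_unique h3 (hasMFDerivAt_const _ x₀)
  have h6 := DFunLike.congr_fun h5 v
  have h7 : inner ℝ p (diff k F x₀ v) = 0 := h6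
  have h8 : inner ℝ p (F x₀) = Real.cos R := congrFun hconst x₀
  have h9 : (1 : ℝ) = Real.cos R * Real.cos R := by
    have h10 : inner ℝ p p = (1 : ℝ) := by rw [real_inner_self_eq_norm_sq, hp]; norm_num
    have h11 := congrArg (fun z => (inner ℝ p z : ℝ)) hv
    simp only [inner_sub_right, inner_smul_right, h7, h8, h10, sub_zero] at h11
    exact h11
  nlinarith [cos_nonneg' hR0 hR, cos_lt_one' hR0 hR]

variable [MeasurableSpace M] [BorelSpace M]

/-- The case of equality. -/
theorem injective_and_isTotallyGeodesicBall [Nonempty M] (hF : IsFreeBoundaryMinimal (k := k) F p R)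
    (hk : k = 4 ∨ k = 6) (hp : ‖p‖ = 1) (hR0 : 0 < R) (hR : R ≤ Real.pi / 2)
    (heq : volumeMeasure k F univ = ballVolume k R) :
    Function.Injective F ∧ IsTotallyGeodesicBall k p R (range F) := by
  obtain ⟨κ, hκ, hκ2⟩ : ∃ κ, k = 2 * κ ∧ 2 ≤ κ := by
    rcases hk with rfl | rfl
    · exact ⟨2, rfl, le_rfl⟩
    · exact ⟨3, rfl, by norm_num⟩
  have ha0 := cos_nonneg' hR0 hR
  have ha1 := cos_lt_one' hR0 hR
  have hFc := hF.smooth.continuous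
  obtain ⟨x₀, hx₀⟩ := hF.exists_mem_boundary hk hp hR0 hR heq
  have hyp := hF.cos_eq_inner hp hx₀
  have hy := hF.norm_eq_one x₀
  have huniq : ∀ x x', inner ℝ (F x) p = Real.cos R → F x' = F x → x' = x := fun x x' hx hxx =>
    hF.eq_of_inner_eq hk hp hR0 hR heq hx hxx
  have hnormal := hF.normalPart_eq_zero_of_volume_eq hk hp hR0 hR hyp heq
  obtain ⟨v₀, hv₀⟩ := hF.eq_smul_sub_of_mem_boundary hR0 hR hx₀
  -- The range of T is spanned by y and the tangent plane at the boundary point x₀; the free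
  -- boundary condition puts p into it.
  set T : EuclideanSpace ℝ (Fin k) × ℝ →ₗ[ℝ] Ambient n :=
    (diff k F x₀ : EuclideanSpace ℝ (Fin k) →ₗ[ℝ] Ambient n).coprod
      (LinearMap.toSpanSingleton ℝ _ (F x₀)) with hT
  have hTv : ∀ v s, T (v, s) = diff k F x₀ v + s • F x₀ := fun v s => by
    simp [hT, LinearMap.coprod_apply]
  have hTinj : Function.Injective T := by
    rw [injective_iff_map_eq_zero]
    rintro ⟨v, s⟩ h0
    rw [hTv] at h0
    have h2 : s = 0 := by
      have := congrArg (fun z => (inner ℝ (F x₀) z : ℝ)) h0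
      simpa [inner_add_right, inner_smul_right, hF.inner_diff_self, real_inner_self_eq_norm_sq,
        hF.norm_eq_one] using this
    rw [h2, zero_smul, add_zero] at h0
    rw [h2, hF.injective_diff x₀ (h0.trans (map_zero _).symm)]
    rfl
  set V := LinearMap.range T with hV
  have hdim : Module.finrank ℝ V = k + 1 := by
    rw [hV, LinearMap.finrank_range_of_inj hTinj, Module.finrank_prod, finrank_euclideanSpace_fin,
      Module.finrank_self]
  have hyV : F x₀ ∈ V := ⟨(0, 1), by rw [hTv]; simp⟩
  have hdV : ∀ v, diff k F x₀ v ∈ V := fun v => ⟨(v, 0), by rw [hTv]; simp⟩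
  have hpV : p ∈ V := by
    rw [hv₀]
    exact V.sub_mem (V.smul_mem _ hyV) (hdV _)
  have hFV : ∀ x, F x ∈ V := by
    intro x
    rw [← Submodule.orthogonal_orthogonal V, Submodule.mem_orthogonal']
    intro e he
    rw [Submodule.mem_orthogonal] at he
    obtain ⟨C, hC⟩ := hF.exists_abs_inner_le (huniq x₀ · hyp) (he _ hyV) (fun v => he _ (hdV v))
    exact hF.inner_eq_zero_of_normalPart hκ hκ2 hp hR0 hR hy hyp (fun x => (hnormal x).1)
      (fun ha x => (hnormal x).2 ha) (he _ hyV) (he _ hpV) hC x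
  have hnb : ∀ x, Real.cos R < inner ℝ (F x) p → x ∉ (𝓡∂ k).boundary M := fun x hx hb =>
    hx.ne' (hF.cos_eq_inner hp hb)
  refine ⟨?_, V, hdim, hpV, ?_⟩
  · intro x x' hxx
    by_contra hne
    have hlt : Real.cos R < inner ℝ (F x) p :=
      lt_of_le_of_ne (hF.cos_le_inner hp hR0 hR x) fun h => hne (huniq x x' h.symm hxx.symm).symm
    -- A double point must lie over the open cap. Images of disjoint neighbourhoods overlap nearby,
    -- so double points fill the closed cap and include y, which has only one preimage.
    have h := mem_of_le_inner_of_open hp hpV ha0 ha1 hF.isClosed_doublePoints (by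
        rintro v ⟨z, z', hzne, hz, hz'⟩ hv
        obtain ⟨U, U', hU, hU', hzU, hzU', hUU⟩ := t2_separation hzne
        rw [← hz] at hv
        have h1 := hF.eventually_exists_eq hdim hFV (hnb z hv) (hU.mem_nhds hzU) hz.symm
        rw [hz, ← hz'] at hv
        have h2 := hF.eventually_exists_eq hdim hFV (hnb z' hv) (hU'.mem_nhds hzU') hz'.symm
        filter_upwards [h1, h2] with v' h1 h2
        obtain ⟨q, hqU, hq⟩ := h1
        obtain ⟨q', hqU', hq'⟩ := h2
        exact ⟨q, q', fun h => Set.disjoint_left.1 hUU hqU (h ▸ hqU'), hq, hq'⟩)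
      ⟨⟨F x, hFV x⟩, ⟨x, x', hne, rfl, hxx.symm⟩, hF.norm_eq_one x, hlt⟩ hyV hy hyp.ge
    obtain ⟨z, z', hzne, hz, hz'⟩ := h
    exact hzne ((huniq x₀ z hyp hz).trans (huniq x₀ z' hyp hz').symm)
  · refine Subset.antisymm (range_subset_iff.2 fun x => ⟨hF.mem_ball x, hFV x⟩) ?_
    rintro v ⟨⟨hv1, hvR⟩, hvV⟩
    obtain ⟨x, hx⟩ := hF.exists_cos_lt_inner hp hR0 hR hx₀
    -- Over the open cap there are no boundary points, so the image is open there in the great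
    -- sphere; it is closed by compactness.
    refine mem_of_le_inner_of_open hp hpV ha0 ha1 (isCompact_range hFc).isClosed ?_
      ⟨⟨F x, hFV x⟩, ⟨x, rfl⟩, hF.norm_eq_one x, hx⟩ hvV hv1 ?_
    · rintro v ⟨z, hz⟩ hv
      rw [← hz] at hv
      filter_upwards [hF.eventually_exists_eq hdim hFV (hnb z hv) univ_mem hz.symm] with v' h1
      obtain ⟨q, -, hq⟩ := h1
      exact ⟨q, hq⟩
    · have h2 : inner ℝ v p = Real.cos (geodesicDist p v) := by
        rw [geodesicDist, InnerProductGeometry.cos_angle, hp, hv1, real_inner_comm]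
        simp
      rw [h2]
      exact Real.cos_le_cos_of_nonneg_of_le_pi (InnerProductGeometry.angle_nonneg _ _)
        (by linarith [Real.pi_pos]) hvR

end IsFreeBoundaryMinimal


end

end SphereFreeBoundary

end

theorem theorem1p1 {k n : ℕ} [NeZero k] (hk : k = 4 ∨ k = 6)
    {M : Type*} [TopologicalSpace M] [T2Space M] [CompactSpace M] [Nonempty M]
    [ChartedSpace (EuclideanHalfSpace k) M] [IsManifold (𝓡∂ k) ∞ M]
    (p : EuclideanSpace ℝ (Fin (n + 1))) (hp : ‖p‖ = 1)
    (R : ℝ) (hR0 : 0 < R) (hR : R ≤ Real.pi / 2)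
    (F : M → EuclideanSpace ℝ (Fin (n + 1)))
    (hF : SphereFreeBoundary.IsFreeBoundaryMinimal (k := k) F p R) :
    SphereFreeBoundary.ballVolume k R ≤ SphereFreeBoundary.immersedVolume (k := k) F ∧
    (SphereFreeBoundary.immersedVolume (k := k) F = SphereFreeBoundary.ballVolume k R →
      Function.Injective F ∧
        SphereFreeBoundary.IsTotallyGeodesicBall k p R (Set.range F)) := by
  let _ : MeasurableSpace M := borel M
  have : BorelSpace M := ⟨rfl⟩
  have hvol := hF.volumeMeasure_univ
  refine ⟨?_, fun heq => ?_⟩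
  · rw [← hvol]
    exact hF.ballVolume_le hk hp hR0 hR
  · exact hF.injective_and_isTotallyGeodesicBall hk hp hR0 hR (hvol.trans heq)
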